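/- All graphs are simple and undirected. A cycle of length $p\ge 3$ in a graph is a sequence of $p$ distinct vertices $v_1,\ldots,v_p$ such that $v_iv_{i+1}$ is an edge for each $i$ modulo $p$; a chord of the cycle is an edge $v_iv_j$ between two vertices that are not cyclically consecutive. A hole is a chordless cycle of length at least four, it is odd if its length is odd, and an antihole is the complementary graph of a hole. A graph is a Meyniel graph if each of its odd cycles of length at least five has at least two chords. A prism is a graph formed by three vertex-disjoint chordless paths $u_0$-$\cdots$-$u_r$, $v_0$-$\cdots$-$v_s$, $w_0$-$\cdots$-$w_t$ with $r,s,t\ge 1$ such that $\{u_0,v_0,w_0\}$ and $\{u_r,v_s,w_t\}$ are cliques and there is no other edge between the three paths. A graph is an Artemis graph if it contains, as an induced subgraph, no odd hole, no antihole on at least five vertices, and no prism. Let $\mathcal Q$ be a pre-co-coloring of a graph $G$, that is, a collection of pairwise disjoint cliques of $G$. The co-contracted graph $G^{\mathcal Q}$ is obtained from $G$ by contracting each $C\in\mathcal Q$ into one vertex $c_C$: vertices of $G$ outside $\bigcup\mathcal Q$ keep the adjacencies they have in $G$; a vertex $x\notin\bigcup\mathcal Q$ is adjacent to $c_C$ in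 $G^{\mathcal Q}$ if and only if $x$ is adjacent in $G$ to every vertex of $C$; and no two of the vertices $c_C$ are adjacent. Theorem. If $G$ is a Meyniel graph and $\mathcal Q$ is any pre-co-coloring of $G$, then the co-contracted graph $G^{\mathcal Q}$ is an Artemis graph. -/

import Mathlib

namespace CoContraction

open SimpleGraph

/-- The sequence `v` of `n ≥ 3` distinct vertices is a cycle of length `n` in `G`:
cyclically consecutive vertices are adjacent. -/
def IsCycle {V : Type*} (G : SimpleGraph V) {n : ℕ} (v : Fin n → V) : Prop :=
  3 ≤ n ∧ Function.Injective v ∧ ∀ i j, (cycleGraph n).Adj i j → G.Adj (v i) (v j)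

/-- The chords of a cycle: edges of `G` joining two vertices of the cycle that are not
cyclically consecutive. -/
def chords {V : Type*} (G : SimpleGraph V) {n : ℕ} (v : Fin n → V) : Set (Sym2 V) :=
  {e | ∃ i j, ¬ (cycleGraph n).Adj i j ∧ G.Adj (v i) (v j) ∧ e = s(v i, v j)}

/-- A hole: a chordless cycle of length at least four. -/
def IsHole {V : Type*} (G : SimpleGraph V) {n : ℕ} (v : Fin n → V) : Prop :=
  4 ≤ n ∧ IsCycle G v ∧ chords G v = ∅

/-- An antihole: the vertices induce in `G` the complementary graph of a hole. -/
def IsAntihole {V : Type*} (G : SimpleGraph V) {n : ℕ} (v : Fin n → V) : Prop :=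
  IsHole Gᶜ v

/-- A Meyniel graph: every odd cycle of length at least five has at least two chords. -/
def IsMeyniel {V : Type*} (G : SimpleGraph V) : Prop :=
  ∀ (n : ℕ) (v : Fin n → V), IsCycle G v → Odd n → 5 ≤ n → 2 ≤ (chords G v).encard

/-- The three sequences `u`, `v`, `w` are the paths of an induced prism of `G`. The paths are
chordless because they are induced copies of path graphs; they are pairwise disjoint, and the
edges between two of them are exactly the edge between their first vertices and the edge between
their last vertices. -/
structure IsPrism {V : Type*} (G : SimpleGraph V) {r s t : ℕ}
    (u : pathGraph (r + 1) ↪g G) (v : pathGraph (s + 1) ↪g G) (w : pathGraph (t + 1) ↪g G) :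
    Prop where
  one_le_r : 1 ≤ r
  one_le_s : 1 ≤ s
  one_le_t : 1 ≤ t
  disjoint_uv : ∀ i j, u i ≠ v j
  disjoint_uw : ∀ i j, u i ≠ w j
  disjoint_vw : ∀ i j, v i ≠ w j
  adj_uv : ∀ i j, G.Adj (u i) (v j) ↔ (i = 0 ∧ j = 0) ∨ (i = Fin.last r ∧ j = Fin.last s)
  adj_uw : ∀ i j, G.Adj (u i) (w j) ↔ (i = 0 ∧ j = 0) ∨ (i = Fin.last r ∧ j = Fin.last t)
  adj_vw : ∀ i j, G.Adj (v i) (w j) ↔ (i = 0 ∧ j = 0) ∨ (i = Fin.last s ∧ j = Fin.last t)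

/-- An Artemis graph: no odd hole, no antihole on at least five vertices, and no prism. -/
structure IsArtemis {V : Type*} (G : SimpleGraph V) : Prop where
  no_odd_hole : ∀ (n : ℕ) (v : Fin n → V), Odd n → ¬ IsHole G v
  no_antihole : ∀ (n : ℕ) (v : Fin n → V), 5 ≤ n → ¬ IsAntihole G v
  no_prism : ∀ (r s t : ℕ) (u : pathGraph (r + 1) ↪g G) (v : pathGraph (s + 1) ↪g G)
    (w : pathGraph (t + 1) ↪g G), ¬ IsPrism G u v w

/-- A pre-co-coloring: a collection of pairwise disjoint cliques. -/
def IsPreCoColoring {V : Type*} (G : SimpleGraph V) (Q : Set (Set V)) : Prop :=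
  (∀ C ∈ Q, G.IsClique C) ∧ Q.PairwiseDisjoint id

/-- The co-contracted graph. Its vertices are the vertices of `G` outside the members of `Q`,
together with one vertex for each member `C` of `Q`. An uncontracted vertex is adjacent to the
vertex of `C` iff it is adjacent in `G` to every vertex of `C`. -/
def coContraction {V : Type*} (G : SimpleGraph V) (Q : Set (Set V)) :
    SimpleGraph ({x : V // x ∉ ⋃₀ Q} ⊕ {C : Set V // C ∈ Q}) where
  Adj a b :=
    match a, b with
    | .inl x, .inl y => G.Adj x.1 y.1
    | .inl x, .inr C => ∀ q ∈ C.1, G.Adj x.1 q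
    | .inr C, .inl x => ∀ q ∈ C.1, G.Adj x.1 q
    | .inr _, .inr _ => False
  symm := ⟨by
    rintro (x | C) (y | D) h
    · exact h.symm
    · exact h
    · exact h
    · exact h⟩
  loopless := ⟨by
    rintro (x | C) h
    · exact h.ne rfl
    · exact h⟩

end CoContraction

/-!
# Co-contractions of Meyniel graphs

Everything rests on a coarse structure of a Meyniel graph around an edge `ab` that lies in a hole
(`Closed.exists_core`). In a finite vertex set `W` that contains the hole there are a set `Z`
containing `a` and `b`, a set `U` complete to `Z`, and a labelling of `W` such that adjacency
between vertices of `Z` with different labels depends only on the labels, through a *bipartite*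
relation `R`, and such that outside `U` every edge between different labels lies inside `Z`. The
labels of `a` and `b` differ, and whichever label is removed, two nonadjacent vertices of `Z`
remain.

To construct it, consider bipartite induced subgraphs that are prime for the split decomposition
(`PrimeBip`). In a Meyniel graph a vertex outside such a subgraph `D` is complete to `D`, a twin of
a vertex of `D`, has at most one neighbour in `D`, or extends `D` to a larger one
(`PrimeBip.vertex_cases`); twins of different vertices of `D` match as these do or extend `D`, and
an ear extends `D`. So for `D` as large as possible one takes for `Z` the twins, labelled by the
vertices of `D`, and for `U` the vertices complete to `D`. Vertices that are neither form components
each of which sees at most one twin class, and they get the label of this class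
(`IsMaxPrime.exists_core`). If no prime `D` contains `a` and `b`, the hole is a square, because the
vertex set of a longer hole is prime (`Closed.primeBip`). In this case `Z` is a largest pair of
sets that are complete to each other and connected in the complement, with two labels
(`IsCoPair.exists_core`).

A hole or prism of the co-contracted graph `K` is finite, so each contracted clique may be replaced
by finitely many witnesses of its missing adjacencies (`exists_expansion`). Contracted vertices
being pairwise nonadjacent, an odd hole or a prism of `K` has an edge `ab` with both ends
uncontracted, and the edge of `G` that represents it lies in a hole (`Expansion.exists_frame`). Now
pull the labels of the core back to `K`. Two adjacent vertices of `K` with different labels show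
these labels only, and inside `Z` (`Frame.pure_of_ne`); conversely, vertices that show single
related labels inside `Z` are adjacent in `K` unless both are contracted (`Frame.adj_of_pure`). On
an odd hole the labels cannot change along every edge, because `R` is bipartite. The end points of a
run of equal labels, and the corresponding places of a prism, produce adjacencies that `K` does not
have, unless all vertices but one show the same label. Then the other vertices of `Z` form part of a
single clique, which the core excludes (`Frame.not_all_label`).

Antiholes are elementary. The one on five vertices is an odd hole. On a longer one the contracted
vertices are at most two consecutive vertices of the complementary hole, and five consecutive
vertices of this hole, at most the last of them contracted, yield a cycle of length five with a
single chord in `G`.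
-/

namespace CoContraction

open SimpleGraph

/-! ### Cycles, chordless paths and links -/

section

variable {V : Type*} {G : SimpleGraph V}

theorem cycleGraph_adj_iff {n : ℕ} (hn : 3 ≤ n) (i j : Fin n) :
    (cycleGraph n).Adj i j ↔ i.val + 1 = j.val ∨ j.val + 1 = i.val ∨
      (i.val = 0 ∧ j.val + 1 = n) ∨ (j.val = 0 ∧ i.val + 1 = n) := by
  rw [cycleGraph_adj', Fin.sub_def, Fin.sub_def]
  simp only
  have hi := i.2
  have hj := j.2
  rcases lt_trichotomy i.val j.val with h | h | h
  · rw [Nat.mod_eq_of_lt (show n - j.val + i.val < n by omega),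
      show n - i.val + j.val = (j.val - i.val) + n by omega, Nat.add_mod_right,
      Nat.mod_eq_of_lt (by omega)]
    omega
  · rw [show n - j.val + i.val = n by omega, show n - i.val + j.val = n by omega, Nat.mod_self]
    omega
  · rw [Nat.mod_eq_of_lt (show n - i.val + j.val < n by omega),
      show n - j.val + i.val = (i.val - j.val) + n by omega, Nat.add_mod_right,
      Nat.mod_eq_of_lt (by omega)]
    omega

/-- An odd cycle `p 0, …, p k` of length at least five has a chord other than any given one. -/
theorem IsMeyniel.exists_chord (hG : IsMeyniel G) {k : ℕ} (hk : 4 ≤ k) (hodd : Even k)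
    (p : ℕ → V) (hinj : ∀ i j, i < j → j ≤ k → p i ≠ p j)
    (hadj : ∀ i, i < k → G.Adj (p i) (p (i + 1))) (hclose : G.Adj (p 0) (p k)) (a b : ℕ) :
    ∃ i j, i + 1 < j ∧ j ≤ k ∧ (i ≠ 0 ∨ j ≠ k) ∧ G.Adj (p i) (p j) ∧ (i ≠ a ∨ j ≠ b) := by
  by_contra! hcon
  have hcyc : IsCycle G (fun i : Fin (k + 1) => p i) := by
    refine ⟨by omega, ?_, ?_⟩
    · intro i j hij
      by_contra hne
      have : i.val ≠ j.val := fun h => hne (Fin.ext h)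
      rcases lt_or_gt_of_ne this with h | h
      · exact hinj _ _ h (by omega) hij
      · exact hinj _ _ h (by omega) hij.symm
    · intro i j hij
      rw [cycleGraph_adj_iff (by omega)] at hij
      have hi := i.2
      have hj := j.2
      show G.Adj (p i) (p j)
      rcases hij with h | h | ⟨h, h'⟩ | ⟨h, h'⟩
      · rw [← h]; exact hadj _ (by omega)
      · rw [← h]; exact (hadj _ (by omega)).symm
      · rw [h, show j.val = k by omega]; exact hclose
      · rw [h, show i.val = k by omega]; exact hclose.symm
  have h2 := hG (k + 1) _ hcyc hodd.add_one (by omega)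
  have hsub : chords G (fun i : Fin (k + 1) => p i) ⊆ {s(p a, p b)} := by
    rintro e ⟨i, j, hij, hadj', rfl⟩
    rw [cycleGraph_adj_iff (by omega)] at hij
    push Not at hij
    have hi := i.2
    have hj := j.2
    have hne : i.val ≠ j.val := fun h => by
      have : i = j := Fin.ext h
      subst this; exact hadj'.ne rfl
    simp only [Set.mem_singleton_iff]
    rcases lt_or_gt_of_ne hne with h | h
    · obtain ⟨ha, hb⟩ := hcon i j (by omega) (by omega) (by omega) hadj'
      rw [ha, hb]
    · obtain ⟨ha, hb⟩ := hcon j i (by omega) (by omega) (by omega) hadj'.symm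
      rw [ha, hb, Sym2.eq_swap]
  have := h2.trans (Set.encard_le_encard hsub)
  rw [Set.encard_singleton] at this
  exact absurd this (by norm_num)

/-- The sequence `p 0, …, p k` is a chordless path. -/
structure Chordless (G : SimpleGraph V) (k : ℕ) (p : ℕ → V) : Prop where
  ne : ∀ i j, i < j → j ≤ k → p i ≠ p j
  adj : ∀ i j, i < j → j ≤ k → (G.Adj (p i) (p j) ↔ j = i + 1)

/-- The sequence `p 0, …, p k` is a chordless cycle of length `k + 1`, a hole when `3 ≤ k`. -/
structure Closed (G : SimpleGraph V) (k : ℕ) (p : ℕ → V) : Prop where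
  ne : ∀ i j, i < j → j ≤ k → p i ≠ p j
  adj : ∀ i j, i < j → j ≤ k → (G.Adj (p i) (p j) ↔ j = i + 1 ∨ (i = 0 ∧ j = k))

theorem Closed.odd (hG : IsMeyniel G) {k : ℕ} {p : ℕ → V} (hp : Closed G k p) (hk : 3 ≤ k) :
    Odd k := by
  by_contra hodd
  rw [Nat.not_odd_iff_even] at hodd
  have hk4 : 4 ≤ k := by
    rcases hodd with ⟨m, rfl⟩
    omega
  obtain ⟨i, j, hij, hj, h0, hadj, -⟩ := hG.exists_chord hk4 hodd p hp.ne
    (fun i hi => (hp.adj i (i + 1) (by omega) (by omega)).2 (Or.inl rfl))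
    ((hp.adj 0 k (by omega) le_rfl).2 (Or.inr ⟨rfl, rfl⟩)) 0 0
  rcases (hp.adj i j (by omega) hj).1 hadj with h | h <;> omega

/-- A vertex adjacent to two consecutive vertices of a hole has a third neighbour on it:
otherwise it closes an odd cycle with a single chord. -/
theorem Closed.exists_adj_inner (hG : IsMeyniel G) {k : ℕ} {p : ℕ → V} (hp : Closed G k p)
    (hk : 3 ≤ k) {v : V} (hv : ∀ i ≤ k, v ≠ p i) (h0 : G.Adj v (p 0)) (h1 : G.Adj v (p k)) :
    ∃ i, 0 < i ∧ i < k ∧ G.Adj v (p i) := by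
  let q : ℕ → V := fun i => Nat.casesOn i v p
  have hodd := hp.odd hG hk
  obtain ⟨i, j, hij, hj, hne, hadj, hab⟩ := hG.exists_chord (k := k + 1) (by omega)
    hodd.add_one q (by
      intro i j hij hj
      obtain ⟨j, rfl⟩ : ∃ j', j = j' + 1 := ⟨j - 1, by omega⟩
      cases i with
      | zero => exact hv _ (by omega)
      | succ i => exact hp.ne _ _ (by omega) (by omega)) (by
      intro i hi
      cases i with
      | zero => exact h0
      | succ i => exact (hp.adj i (i + 1) (by omega) (by omega)).2 (Or.inl rfl)) h1 1 (k + 1)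
  obtain ⟨j, rfl⟩ : ∃ j', j = j' + 1 := ⟨j - 1, by omega⟩
  cases i with
  | zero => exact ⟨j, by omega, by omega, hadj⟩
  | succ i => rcases (hp.adj i j (by omega) (by omega)).1 hadj with h | h <;> omega

/-- A vertex adjacent to the first two vertices and the last vertex of a chordless path is
adjacent to all of it. -/
theorem Chordless.adj_all (hG : IsMeyniel G) {k : ℕ} {p : ℕ → V} (hp : Chordless G k p)
    {v : V} (hv : ∀ i ≤ k, v ≠ p i) (h0 : G.Adj v (p 0)) (h1 : G.Adj v (p 1))
    (hk : G.Adj v (p k)) : ∀ i ≤ k, G.Adj v (p i) := by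
  classical
  by_contra! hcon
  have hj := Nat.find_spec hcon
  have hjmin := fun i => Nat.find_min (m := i) hcon
  set j := Nat.find hcon
  have hj0 : j ≠ 0 := fun h => hj.2 (h ▸ h0)
  have hj1 : j ≠ 1 := fun h => hj.2 (h ▸ h1)
  have hjk : j ≠ k := fun h => hj.2 (h ▸ hk)
  have hbef : ∀ i < j, G.Adj v (p i) := fun i hi => by
    by_contra h
    exact hjmin i hi ⟨by omega, h⟩
  have hex : ∃ e, j < e ∧ e ≤ k ∧ G.Adj v (p e) := ⟨k, by omega, le_rfl, hk⟩
  have he := Nat.find_spec hex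
  have hemin := fun i => Nat.find_min (m := i) hex
  set e := Nat.find hex
  have hmid : ∀ i, j ≤ i → i < e → ¬ G.Adj v (p i) := by
    intro i hi hie h
    rcases hi.eq_or_lt with h' | h'
    · exact hj.2 (h' ▸ h)
    · exact hemin i hie ⟨h', by omega, h⟩
  -- the hole is `p (j - 1), …, p e, v`, with the vertex `p (j - 2)` above the edge `v, p (j - 1)`
  let q : ℕ → V := fun i => if i ≤ e - j + 1 then p (j - 1 + i) else v
  have hq : Closed G (e - j + 2) q := by
    constructor
    · intro i i' hi hi'
      simp only [q]
      rw [if_pos (by omega)]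
      split_ifs with h
      · exact hp.ne _ _ (by omega) (by omega)
      · exact (hv _ (by omega)).symm
    · intro i i' hi hi'
      simp only [q]
      rw [if_pos (by omega)]
      split_ifs with h
      · rw [hp.adj _ _ (by omega) (by omega)]
        omega
      · rw [G.adj_comm]
        constructor
        · intro hadj
          by_contra hc
          exact hmid (j - 1 + i) (by omega) (by omega) hadj
        · intro hc
          by_cases h0 : i = 0
          · exact hbef _ (by omega)
          · rw [show j - 1 + i = e by omega]
            exact he.2.2
  obtain ⟨i, hi0, hik, hadj⟩ := hq.exists_adj_inner hG (by omega) (v := p (j - 2)) (by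
      intro i hi
      simp only [q]
      split_ifs with h
      · exact hp.ne _ _ (by omega) (by omega)
      · exact (hv _ (by omega)).symm) (by
      simp only [q, Nat.zero_le, if_true]
      exact (hp.adj _ _ (by omega) (by omega)).2 (by omega)) (by
      simp only [q]
      rw [if_neg (by omega)]
      exact (hbef _ (by omega)).symm)
  simp only [q] at hadj
  rw [if_pos (by omega), hp.adj _ _ (by omega) (by omega)] at hadj
  omega

/-- `Reach G S x w`: some walk of `G` from `x` to `w` has all its vertices after `x` in `S`. -/
def Reach (G : SimpleGraph V) (S : Set V) : V → V → Prop :=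
  Relation.ReflTransGen fun u w => G.Adj u w ∧ w ∈ S

/-- The sequence `p 0 = x, …, p k = y` is a walk with at least one inner vertex and all inner
vertices in `S`. -/
structure IsLink (G : SimpleGraph V) (S : Set V) (x y : V) (k : ℕ) (p : ℕ → V) : Prop where
  two_le : 2 ≤ k
  zero : p 0 = x
  last : p k = y
  mem : ∀ i, 0 < i → i < k → p i ∈ S
  adj : ∀ i, i < k → G.Adj (p i) (p (i + 1))

theorem Reach.exists_seq {S : Set V} {x w : V} (h : Reach G S x w) :
    ∃ (k : ℕ) (p : ℕ → V), p 0 = x ∧ p k = w ∧ (∀ i, 0 < i → i ≤ k → p i ∈ S) ∧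
      ∀ i, i < k → G.Adj (p i) (p (i + 1)) := by
  induction h with
  | refl => exact ⟨0, fun _ => x, rfl, rfl, fun i _ _ => by omega, fun i _ => by omega⟩
  | tail _ h ih =>
    obtain ⟨k, p, h0, hk, hS, hadj⟩ := ih
    rename_i b c _
    refine ⟨k + 1, fun i => if i ≤ k then p i else c, by simpa using h0, by simp, ?_, ?_⟩
    · intro i hi hik
      dsimp only
      split_ifs with h'
      · exact hS i hi h'
      · exact h.2
    · intro i hi
      dsimp only
      rw [if_pos (by omega)]
      split_ifs with h'
      · exact hadj i (by omega)
      · rw [show i = k by omega, hk]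
        exact h.1

theorem Reach.exists_isLink {S : Set V} {x y w : V} (h : Reach G S x w) (hx : x ∉ S) (hw : w ∈ S)
    (hwy : G.Adj w y) : ∃ k p, IsLink G S x y k p := by
  obtain ⟨k, p, h0, hk, hS, hadj⟩ := h.exists_seq
  have hk0 : k ≠ 0 := by
    rintro rfl
    exact hx (h0 ▸ hk ▸ hw)
  refine ⟨k + 1, fun i => if i ≤ k then p i else y, by omega, by simpa using h0, by simp, ?_, ?_⟩
  · intro i hi hik
    rw [if_pos (by omega)]
    exact hS i hi (by omega)
  · intro i hi
    rw [if_pos (by omega)]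
    split_ifs with h'
    · exact hadj i (by omega)
    · rw [show i = k by omega, hk]
      exact hwy

/-- The link that jumps along the edge from `p i` to `p (i + 1 + d)` over the `d` vertices between
them. -/
theorem IsLink.shortcut {S : Set V} {x y : V} {k : ℕ} {p : ℕ → V} (h : IsLink G S x y k p)
    (i d : ℕ) (hd : i + 1 + d ≤ k) (hk : d + 2 ≤ k) (hadj : G.Adj (p i) (p (i + 1 + d))) :
    IsLink G S x y (k - d) (fun t => if t ≤ i then p t else p (t + d)) := by
  refine ⟨by omega, by simpa using h.zero, ?_, ?_, ?_⟩
  · rw [if_neg (by omega), Nat.sub_add_cancel (by omega)]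
    exact h.last
  · intro t ht htk
    split_ifs with h'
    · exact h.mem _ ht (by omega)
    · exact h.mem _ (by omega) (by omega)
  · intro t ht
    split_ifs with h1 h2 h2
    · exact h.adj _ (by omega)
    · obtain rfl : t = i := by omega
      exact hadj
    · omega
    · rw [show t + 1 + d = t + d + 1 by omega]
      exact h.adj _ (by omega)

/-- A shortest link has no shortcut except possibly an edge between its ends. -/
theorem IsLink.exists_minimal {S : Set V} {x y : V} {k : ℕ} {p : ℕ → V} (h : IsLink G S x y k p)
    (hx : x ∉ S) (hy : y ∉ S) :
    ∃ k p, IsLink G S x y k p ∧ ∀ i j, i < j → j ≤ k → (i ≠ 0 ∨ j ≠ k) →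
      p i ≠ p j ∧ (G.Adj (p i) (p j) ↔ j = i + 1) := by
  classical
  have hex : ∃ k p, IsLink G S x y k p := ⟨k, p, h⟩
  obtain ⟨p, hp⟩ := Nat.find_spec hex
  have hmin := fun i => Nat.find_min (m := i) hex
  refine ⟨Nat.find hex, p, hp, ?_⟩
  set k := Nat.find hex
  intro i j hij hj hne
  constructor
  · intro heq
    have hi0 : i ≠ 0 := by
      rintro rfl
      exact hx (hp.zero ▸ heq ▸ hp.mem j (by omega) (by omega))
    have hjk : j ≠ k := by
      rintro rfl
      exact hy (hp.last ▸ heq ▸ hp.mem i (by omega) (by omega))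
    refine hmin (k - (j - i)) (by omega) ⟨_, hp.shortcut i (j - i) (by omega) (by omega) ?_⟩
    rw [heq, show i + 1 + (j - i) = j + 1 by omega]
    exact hp.adj j (by omega)
  · constructor
    · intro hadj
      by_contra hc
      refine hmin (k - (j - i - 1)) (by omega)
        ⟨_, hp.shortcut i (j - i - 1) (by omega) (by omega) ?_⟩
      rwa [show i + 1 + (j - i - 1) = j by omega]
    · rintro rfl
      exact hp.adj i (by omega)

/-- Two vertices joined by a link are the ends of a link that is a chordless path, or a hole if
the two vertices are adjacent. -/
theorem Reach.exists_chordless {S : Set V} {x y w : V} (h : Reach G S x w) (hx : x ∉ S)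
    (hy : y ∉ S) (hw : w ∈ S) (hwy : G.Adj w y) (hxy : x ≠ y) :
    ∃ k p, IsLink G S x y k p ∧ (G.Adj x y → 2 ≤ k ∧ Closed G k p) ∧
      (¬ G.Adj x y → Chordless G k p) := by
  obtain ⟨k, p, hp⟩ := h.exists_isLink hx hw hwy
  obtain ⟨k, p, hp, hmin⟩ := hp.exists_minimal hx hy
  have hne : ∀ i j, i < j → j ≤ k → p i ≠ p j := by
    intro i j hij hj
    by_cases h0 : i ≠ 0 ∨ j ≠ k
    · exact (hmin i j hij hj h0).1
    · push Not at h0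
      rw [h0.1, h0.2, hp.zero, hp.last]
      exact hxy
  have h2 := hp.two_le
  refine ⟨k, p, hp, fun hadj => ⟨h2, hne, ?_⟩, fun hadj => ⟨hne, ?_⟩⟩
  · intro i j hij hj
    by_cases h0 : i ≠ 0 ∨ j ≠ k
    · rw [(hmin i j hij hj h0).2]
      omega
    · push Not at h0
      rw [h0.1, h0.2, hp.zero, hp.last]
      simp [hadj]
  · intro i j hij hj
    by_cases h0 : i ≠ 0 ∨ j ≠ k
    · exact (hmin i j hij hj h0).2
    · push Not at h0
      rw [h0.1, h0.2, hp.zero, hp.last]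
      simp only [hadj, false_iff]
      omega

end

/-! ### Prime bipartite graphs -/

section

variable {V : Type*} {G : SimpleGraph V}

theorem Reach.of_adj {S : Set V} {x w : V} (h : G.Adj x w) (hw : w ∈ S) : Reach G S x w :=
  Relation.ReflTransGen.single ⟨h, hw⟩

theorem Reach.symm {S : Set V} {x w : V} (h : Reach G S x w) (hx : x ∈ S) : Reach G S w x := by
  induction h using Relation.ReflTransGen.head_induction_on with
  | refl => exact .refl
  | head h _ ih => exact (ih h.2).tail ⟨h.1.symm, hx⟩

/-- A walk from `x` through `S` to a neighbour of `y`, traversed backwards. -/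
theorem Reach.reverse {S : Set V} {x y w : V} (h : Reach G S x w) (hx : x ∉ S) (hw : w ∈ S)
    (hwy : G.Adj w y) : ∃ u ∈ S, Reach G S y u ∧ G.Adj u x := by
  rcases h.cases_head with h' | ⟨b, hb, hbw⟩
  · exact absurd (h' ▸ hw) hx
  · exact ⟨b, hb.2, (Reach.of_adj hwy.symm hw).trans (Reach.symm hbw hb.2), hb.1.symm⟩

theorem IsLink.reach {S : Set V} {x y : V} {k : ℕ} {p : ℕ → V} (h : IsLink G S x y k p) :
    ∀ i, i < k → Reach G S x (p i) := by
  intro i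
  induction i with
  | zero => intro _; rw [h.zero]; exact .refl
  | succ i ih =>
    intro hi
    exact (ih (by omega)).tail ⟨h.adj i (by omega), h.mem _ (by omega) hi⟩

/-- The colours alternate along a properly coloured walk. -/
theorem color_path {k : ℕ} {p : ℕ → V} {c : V → Bool}
    (h : ∀ i, i < k → c (p i) ≠ c (p (i + 1))) :
    ∀ i ≤ k, (c (p i) = c (p 0) ↔ Even i) := by
  intro i
  induction i with
  | zero => simp
  | succ i ih =>
    intro hi
    have h1 := ih (by omega)
    have h2 := h i (by omega)
    rw [Nat.even_add_one, ← h1]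
    revert h2
    cases c (p i) <;> cases c (p (i + 1)) <;> cases c (p 0) <;> simp

/-- The edges of `G[D]` that leave `P` do not form a complete bipartite graph between their
ends inside `P` and their ends outside `P`. -/
def Cross (G : SimpleGraph V) (D P : Set V) : Prop :=
  ∃ s₁ s₂ t₁ t₂, (s₁ ∈ D ∧ s₁ ∈ P) ∧ (s₂ ∈ D ∧ s₂ ∈ P) ∧ (t₁ ∈ D ∧ t₁ ∉ P) ∧
    (t₂ ∈ D ∧ t₂ ∉ P) ∧ G.Adj s₁ t₁ ∧ G.Adj s₂ t₂ ∧ ¬ G.Adj s₁ t₂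

theorem Cross.of_compl {D P : Set V} (h : Cross G D Pᶜ) : Cross G D P := by
  obtain ⟨s₁, s₂, t₁, t₂, h1, h2, h3, h4, h5, h6, h7⟩ := h
  exact ⟨t₂, t₁, s₂, s₁, ⟨h4.1, not_not.1 h4.2⟩, ⟨h3.1, not_not.1 h3.2⟩, ⟨h2.1, h2.2⟩,
    ⟨h1.1, h1.2⟩, h6.symm, h5.symm, fun h => h7 h.symm⟩

theorem Cross.mono {D E P : Set V} (h : Cross G D P) (hDE : D ⊆ E) : Cross G E P := by
  obtain ⟨s₁, s₂, t₁, t₂, h1, h2, h3, h4, h⟩ := h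
  exact ⟨s₁, s₂, t₁, t₂, ⟨hDE h1.1, h1.2⟩, ⟨hDE h2.1, h2.2⟩, ⟨hDE h3.1, h3.2⟩,
    ⟨hDE h4.1, h4.2⟩, h⟩

/-- `c` is a proper 2-colouring of the graph induced by `D`. -/
def TwoColored (G : SimpleGraph V) (D : Set V) (c : V → Bool) : Prop :=
  ∀ x ∈ D, ∀ y ∈ D, G.Adj x y → c x ≠ c y

/-- `D` induces a bipartite graph on at least four vertices that is prime for the split
decomposition: no partition of `D` into two parts with at least two vertices each is a split. -/
structure PrimeBip (G : SimpleGraph V) (D : Set V) : Prop where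
  bip : ∃ c, TwoColored G D c
  large : ∀ x y z, ∃ w ∈ D, w ≠ x ∧ w ≠ y ∧ w ≠ z
  cut : ∀ P : Set V, ∀ x ∈ D, ∀ x' ∈ D, ∀ y ∈ D, ∀ y' ∈ D, x ≠ x' → y ≠ y' → x ∈ P → x' ∈ P →
    y ∉ P → y' ∉ P → Cross G D P

theorem TwoColored.not_triangle {D : Set V} {c : V → Bool} (hc : TwoColored G D c) {x y z : V}
    (hx : x ∈ D) (hy : y ∈ D) (hz : z ∈ D) (hxy : G.Adj x y) (hyz : G.Adj y z) :
    ¬ G.Adj x z := by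
  intro hxz
  have h1 := hc x hx y hy hxy
  have h2 := hc y hy z hz hyz
  have h3 := hc x hx z hz hxz
  revert h1 h2 h3
  cases c x <;> cases c y <;> cases c z <;> simp

namespace PrimeBip

variable {D : Set V}

theorem not_triangle (hD : PrimeBip G D) {x y z : V} (hx : x ∈ D) (hy : y ∈ D) (hz : z ∈ D)
    (hxy : G.Adj x y) (hyz : G.Adj y z) : ¬ G.Adj x z := by
  obtain ⟨c, hc⟩ := hD.bip
  exact hc.not_triangle hx hy hz hxy hyz

/-- Every vertex of `D` has at least two neighbours in `D`. -/
theorem exists_adj_ne (hD : PrimeBip G D) {d : V} (hd : d ∈ D) (y : V) :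
    ∃ z ∈ D, z ≠ y ∧ G.Adj d z := by
  have key : ∀ y ∈ D, y ≠ d → ∃ z ∈ D, z ≠ y ∧ G.Adj d z := by
    intro y hy hyd
    obtain ⟨w, hw, hw1, hw2, -⟩ := hD.large d y d
    obtain ⟨w', hw', hw1', hw2', hww⟩ := hD.large d y w
    obtain ⟨s₁, s₂, t₁, t₂, h1, h2, h3, h4, h5, h6, h7⟩ := hD.cut {d, y} d hd y hy w hw w' hw'
      hyd.symm hww.symm (by simp) (by simp) (by simp [hw1, hw2]) (by simp [hw1', hw2'])
    simp only [Set.mem_insert_iff, Set.mem_singleton_iff, not_or] at h1 h2 h3 h4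
    rcases h1.2 with rfl | rfl
    · exact ⟨t₁, h3.1, h3.2.2, h5⟩
    · rcases h2.2 with rfl | rfl
      · exact ⟨t₂, h4.1, h4.2.2, h6⟩
      · exact absurd h6 h7
  by_cases hy : y ∈ D ∧ y ≠ d
  · exact key y hy.1 hy.2
  · obtain ⟨w, hw, hwd, -⟩ := hD.large d d d
    obtain ⟨z, hz, -, hdz⟩ := key w hw hwd
    refine ⟨z, hz, ?_, hdz⟩
    rintro rfl
    exact hy ⟨hz, hdz.ne'⟩

theorem exists_adj (hD : PrimeBip G D) {d : V} (hd : d ∈ D) : ∃ z ∈ D, G.Adj d z := by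
  obtain ⟨z, hz, -, h⟩ := hD.exists_adj_ne hd d
  exact ⟨z, hz, h⟩

/-- No two vertices of `D` have the same neighbours in the rest of `D`. -/
theorem exists_separating (hD : PrimeBip G D) {d d' : V} (hd : d ∈ D) (hd' : d' ∈ D)
    (hne : d ≠ d') : ∃ z ∈ D, z ≠ d ∧ z ≠ d' ∧ ¬ (G.Adj d z ↔ G.Adj d' z) := by
  obtain ⟨w, hw, hw1, hw2, -⟩ := hD.large d d' d
  obtain ⟨w', hw', hw1', hw2', hww⟩ := hD.large d d' w
  obtain ⟨s₁, s₂, t₁, t₂, h1, h2, h3, h4, h5, h6, h7⟩ := hD.cut {d, d'} d hd d' hd' w hw w' hw'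
    hne hww.symm (by simp) (by simp) (by simp [hw1, hw2]) (by simp [hw1', hw2'])
  simp only [Set.mem_insert_iff, Set.mem_singleton_iff, not_or] at h1 h2 h3 h4
  refine ⟨t₂, h4.1, h4.2.1, h4.2.2, ?_⟩
  rcases h1.2 with rfl | rfl <;> rcases h2.2 with rfl | rfl <;> tauto

theorem exists_crossing (hD : PrimeBip G D) (P : Set V) {x y : V} (hx : x ∈ D) (hy : y ∈ D)
    (hxP : x ∈ P) (hyP : y ∉ P) : ∃ s ∈ D, ∃ t ∈ D, s ∈ P ∧ t ∉ P ∧ G.Adj s t := by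
  by_cases h1 : ∃ x' ∈ D, x' ∈ P ∧ x' ≠ x
  · by_cases h2 : ∃ y' ∈ D, y' ∉ P ∧ y' ≠ y
    · obtain ⟨x', hx', hxP', hne⟩ := h1
      obtain ⟨y', hy', hyP', hne'⟩ := h2
      obtain ⟨s₁, s₂, t₁, t₂, h1, h2, h3, h4, h5, h6, h7⟩ :=
        hD.cut P x hx x' hx' y hy y' hy' hne.symm hne'.symm hxP hxP' hyP hyP'
      exact ⟨s₁, h1.1, t₁, h3.1, h1.2, h3.2, h5⟩
    · push Not at h2
      obtain ⟨z, hz, hyz⟩ := hD.exists_adj hy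
      refine ⟨z, hz, y, hy, ?_, hyP, hyz.symm⟩
      by_contra hzP
      exact hyz.ne (h2 z hz hzP).symm
  · push Not at h1
    obtain ⟨z, hz, hxz⟩ := hD.exists_adj hx
    exact ⟨x, hx, z, hz, hxP, fun hzP => hxz.ne (h1 z hz hzP).symm, hxz⟩

theorem exists_chordless (hD : PrimeBip G D) {x y : V} (hx : x ∈ D) (hy : y ∈ D) (hne : x ≠ y) :
    ∃ k p, 1 ≤ k ∧ Chordless G k p ∧ p 0 = x ∧ p k = y ∧ ∀ i ≤ k, p i ∈ D := by
  by_cases hxy : G.Adj x y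
  · refine ⟨1, fun i => if i = 0 then x else y, le_rfl, ⟨?_, ?_⟩, by simp, by simp, ?_⟩
    · intro i j hij hj
      obtain ⟨rfl, rfl⟩ : i = 0 ∧ j = 1 := by omega
      simpa using hne
    · intro i j hij hj
      obtain ⟨rfl, rfl⟩ : i = 0 ∧ j = 1 := by omega
      simpa using hxy
    · intro i _
      dsimp only
      split_ifs <;> assumption
  · obtain ⟨s, hs, t, ht, hsP, htP, hst⟩ := hD.exists_crossing
      {z | z = x ∨ z ∈ D \ {x, y} ∧ Reach G (D \ {x, y}) x z} hx hy (Or.inl rfl)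
      (by simp [hne.symm])
    have hty : t = y := by
      by_contra hty
      have htx : t ≠ x := fun h => htP (Or.inl h)
      have htS : t ∈ D \ {x, y} := ⟨ht, by simp [htx, hty]⟩
      refine htP (Or.inr ⟨htS, ?_⟩)
      rcases hsP with rfl | hsP
      · exact Reach.of_adj hst htS
      · exact hsP.2.tail ⟨hst, htS⟩
    subst hty
    rcases hsP with rfl | hsP
    · exact absurd hst hxy
    · obtain ⟨k, p, hp, -, hch⟩ := hsP.2.exists_chordless (by simp) (by simp) hsP.1 hst hne
      have := hp.two_le
      refine ⟨k, p, by omega, hch hxy, hp.zero, hp.last, ?_⟩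
      intro i hi
      by_cases h0 : i = 0
      · rw [h0, hp.zero]; exact hx
      by_cases hk : i = k
      · rw [hk, hp.last]; exact hy
      exact (hp.mem i (by omega) (by omega)).1

theorem image (hD : PrimeBip G D) (f : V → V) (hf : Set.InjOn f D)
    (hadj : ∀ x ∈ D, ∀ y ∈ D, (G.Adj (f x) (f y) ↔ G.Adj x y)) : PrimeBip G (f '' D) := by
  classical
  have hch : ∀ x ∈ D, ∀ h : ∃ y ∈ D, f y = f x, h.choose = x := fun x hx h =>
    hf h.choose_spec.1 hx h.choose_spec.2
  refine ⟨?_, ?_, ?_⟩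
  · obtain ⟨c, hc⟩ := hD.bip
    refine ⟨fun w => if h : ∃ y ∈ D, f y = w then c h.choose else false, ?_⟩
    rintro _ ⟨x, hx, rfl⟩ _ ⟨y, hy, rfl⟩ hxy
    have h1 : ∃ z ∈ D, f z = f x := ⟨x, hx, rfl⟩
    have h2 : ∃ z ∈ D, f z = f y := ⟨y, hy, rfl⟩
    simp only [dif_pos h1, dif_pos h2]
    rw [hch x hx h1, hch y hy h2]
    exact hc x hx y hy ((hadj x hx y hy).1 hxy)
  · intro x y z
    have hpre : ∀ x, ∃ x', ∀ w ∈ D, f w = x → w = x' := by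
      intro x
      by_cases h : ∃ w ∈ D, f w = x
      · obtain ⟨w, hw, rfl⟩ := h
        exact ⟨w, fun w' hw' h => hf hw' hw h⟩
      · exact ⟨x, fun w hw hx => absurd ⟨w, hw, hx⟩ h⟩
    obtain ⟨x', hx'⟩ := hpre x
    obtain ⟨y', hy'⟩ := hpre y
    obtain ⟨z', hz'⟩ := hpre z
    obtain ⟨w, hw, h1, h2, h3⟩ := hD.large x' y' z'
    exact ⟨f w, ⟨w, hw, rfl⟩, fun h => h1 (hx' w hw h), fun h => h2 (hy' w hw h),
      fun h => h3 (hz' w hw h)⟩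
  · rintro P _ ⟨x, hx, rfl⟩ _ ⟨x', hx', rfl⟩ _ ⟨y, hy, rfl⟩ _ ⟨y', hy', rfl⟩ hxx hyy h1 h2 h3 h4
    obtain ⟨s₁, s₂, t₁, t₂, a1, a2, a3, a4, a5, a6, a7⟩ := hD.cut (f ⁻¹' P) x hx x' hx' y hy y' hy'
      (by rintro rfl; exact hxx rfl) (by rintro rfl; exact hyy rfl) h1 h2 h3 h4
    exact ⟨f s₁, f s₂, f t₁, f t₂, ⟨⟨_, a1.1, rfl⟩, a1.2⟩, ⟨⟨_, a2.1, rfl⟩, a2.2⟩,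
      ⟨⟨_, a3.1, rfl⟩, a3.2⟩, ⟨⟨_, a4.1, rfl⟩, a4.2⟩, (hadj _ a1.1 _ a3.1).2 a5,
      (hadj _ a2.1 _ a4.1).2 a6, fun h => a7 ((hadj _ a1.1 _ a4.1).1 h)⟩

/-- A bipartite superset of a prime set `D` is prime as soon as it has no split with at most one
vertex of `D` on one side: any other split would restrict to a split of `D`. -/
theorem of_superset (hD : PrimeBip G D) {E : Set V} (hDE : D ⊆ E) (hE : ∃ c, TwoColored G E c)
    (hext : ∀ P : Set V, (∀ x ∈ D, ∀ x' ∈ D, x ∈ P → x' ∈ P → x = x') →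
      (∃ x ∈ E, ∃ x' ∈ E, x ∈ P ∧ x' ∈ P ∧ x ≠ x') → Cross G E P) : PrimeBip G E := by
  refine ⟨hE, fun x y z => ?_, ?_⟩
  · obtain ⟨w, hw, h⟩ := hD.large x y z
    exact ⟨w, hDE hw, h⟩
  · intro P x hx x' hx' y hy y' hy' hxx hyy hxP hxP' hyP hyP'
    by_cases h1 : ∀ x ∈ D, ∀ x' ∈ D, x ∈ P → x' ∈ P → x = x'
    · exact hext P h1 ⟨x, hx, x', hx', hxP, hxP', hxx⟩
    by_cases h2 : ∀ x ∈ D, ∀ x' ∈ D, x ∈ Pᶜ → x' ∈ Pᶜ → x = x'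
    · exact (hext Pᶜ h2 ⟨y, hy, y', hy', hyP, hyP', hyy⟩).of_compl
    push Not at h1 h2
    obtain ⟨u, hu, u', hu', huP, huP', huu⟩ := h1
    obtain ⟨v, hv, v', hv', hvP, hvP', hvv⟩ := h2
    exact (hD.cut P u hu u' hu' v hv v' hv' huu hvv huP huP' hvP hvP').mono hDE

end PrimeBip

/-! ### A vertex seen from a prime bipartite graph -/

section OneVertex

variable {E : Set V} {v : V}

/-- Two adjacent neighbours of `v` are not linked through non-neighbours of `v`. -/
theorem not_linked_of_adj (hG : IsMeyniel G) (hE : PrimeBip G E) (hv : v ∉ E) {q y w : V}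
    (hq : q ∈ E) (hy : y ∈ E) (hvq : G.Adj v q) (hvy : G.Adj v y) (hqy : G.Adj q y)
    (hr : Reach G {z | z ∈ E ∧ ¬ G.Adj v z} q w) (hw : w ∈ E) (hvw : ¬ G.Adj v w) :
    ¬ G.Adj w y := by
  intro hwy
  obtain ⟨k, p, hp, hcl, -⟩ := hr.exists_chordless (fun h => h.2 hvq) (fun h => h.2 hvy)
    ⟨hw, hvw⟩ hwy hqy.ne
  obtain ⟨h2, hcl⟩ := hcl hqy
  have hk : k ≠ 2 := by
    rintro rfl
    have h1 := hp.mem 1 (by omega) (by omega)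
    have ha := hp.adj 0 (by omega)
    have hb := hp.adj 1 (by omega)
    rw [hp.zero] at ha
    rw [show 1 + 1 = 2 from rfl, hp.last] at hb
    exact hE.not_triangle hq h1.1 hy ha hb hqy
  obtain ⟨i, hi0, hik, hadj⟩ := hcl.exists_adj_inner hG (by omega) (v := v) (by
    intro i hi h
    rcases Nat.eq_zero_or_pos i with rfl | h0
    · exact hv (h ▸ hp.zero ▸ hq)
    rcases hi.eq_or_lt with rfl | h1
    · exact hv (h ▸ hp.last ▸ hy)
    · exact hv (h ▸ (hp.mem i h0 h1).1)) (by rw [hp.zero]; exact hvq) (by rw [hp.last]; exact hvy)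
  exact (hp.mem i hi0 hik).2 hadj

/-- If `q` and `y` are adjacent neighbours of `v`, then `y` is adjacent to each neighbour of `v`
that is linked to `q` through non-neighbours of `v`. -/
theorem adj_of_linked (hG : IsMeyniel G) (hE : PrimeBip G E) (hv : v ∉ E) {q y t w : V}
    (hq : q ∈ E) (hy : y ∈ E) (ht : t ∈ E) (hvq : G.Adj v q) (hvy : G.Adj v y) (hvt : G.Adj v t)
    (hqy : G.Adj q y) (hqt : q ≠ t)
    (hr : Reach G {z | z ∈ E ∧ ¬ G.Adj v z} q w) (hw : w ∈ E) (hvw : ¬ G.Adj v w)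
    (hwt : G.Adj w t) : G.Adj y t := by
  by_contra hyt
  have hqt' : ¬ G.Adj q t := fun h => not_linked_of_adj hG hE hv hq ht hvq hvt h hr hw hvw hwt
  have hyne : y ≠ t := by rintro rfl; exact hqt' hqy
  obtain ⟨k, p, hp, -, hch⟩ := hr.exists_chordless (fun h => h.2 hvq) (fun h => h.2 hvt)
    ⟨hw, hvw⟩ hwt hqt
  have hch := hch hqt'
  have h2 := hp.two_le
  let r : ℕ → V := fun i => Nat.casesOn i y p
  have hr' : Chordless G (k + 1) r := by
    constructor
    · intro i j hij hj
      obtain ⟨j, rfl⟩ : ∃ j', j = j' + 1 := ⟨j - 1, by omega⟩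
      cases i with
      | zero =>
        show y ≠ p j
        intro h
        rcases Nat.eq_zero_or_pos j with rfl | h0
        · rw [hp.zero] at h; exact hqy.ne h.symm
        rcases (show j ≤ k by omega).eq_or_lt with rfl | h1
        · exact hyne (h.trans hp.last)
        · exact (hp.mem j h0 h1).2 (h ▸ hvy)
      | succ i => exact hch.ne _ _ (by omega) (by omega)
    · intro i j hij hj
      obtain ⟨j, rfl⟩ : ∃ j', j = j' + 1 := ⟨j - 1, by omega⟩
      cases i with
      | zero =>
        show G.Adj y (p j) ↔ _
        constructor
        · intro h
          by_contra hj0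
          rcases (show j ≤ k by omega).eq_or_lt with rfl | h1
          · rw [hp.last] at h; exact hyt h
          · have hm := hp.mem j (by omega) h1
            exact not_linked_of_adj hG hE hv hq hy hvq hvy hqy (hp.reach j h1) hm.1 hm.2 h.symm
        · intro h
          obtain rfl : j = 0 := by omega
          rw [hp.zero]; exact hqy.symm
      | succ i =>
        show G.Adj (p i) (p j) ↔ _
        rw [hch.adj _ _ (by omega) (by omega)]
        omega
  have hall := hr'.adj_all hG (v := v) (by
    intro i hi h
    cases i with
    | zero => exact hvy.ne h
    | succ i =>
      replace h : v = p i := h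
      rcases Nat.eq_zero_or_pos i with rfl | h0
      · exact hv (h ▸ hp.zero ▸ hq)
      rcases (show i ≤ k by omega).eq_or_lt with rfl | h1
      · exact hv (h ▸ hp.last ▸ ht)
      · exact hv (h ▸ (hp.mem i h0 h1).1)) hvy (by
      show G.Adj v (p 0)
      rw [hp.zero]; exact hvq) (by
      show G.Adj v (p k)
      rw [hp.last]; exact hvt) 2 (by omega)
  exact (hp.mem 1 (by omega) (by omega)).2 hall

/-- A vertex outside a prime bipartite graph that is adjacent to both ends of one of its edges
is complete to it or a true twin of one of its vertices. -/
theorem complete_or_trueTwin (hG : IsMeyniel G) (hE : PrimeBip G E) (hv : v ∉ E) {y y' : V}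
    (hy : y ∈ E) (hy' : y' ∈ E) (hvy : G.Adj v y) (hvy' : G.Adj v y') (hyy : G.Adj y y') :
    (∀ z ∈ E, G.Adj v z) ∨
      ∃ e ∈ E, G.Adj v e ∧ ∀ z ∈ E, z ≠ e → (G.Adj v z ↔ G.Adj e z) := by
  by_contra! hcon
  obtain ⟨⟨x₀, hx₀, hvx₀⟩, hcon⟩ := hcon
  -- a vertex `q₁` with a neighbour `y₁` adjacent to `v` and a neighbour `x` not adjacent to `v`
  obtain ⟨q₁, hq₁, x, hx, ⟨hvq₁, y₁, hy₁, hvy₁, hqy₁⟩, hxP, hqx⟩ := hE.exists_crossing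
    {z | G.Adj v z ∧ ∃ y ∈ E, G.Adj v y ∧ G.Adj z y} hy hx₀ ⟨hvy, y', hy', hvy', hyy⟩
    (fun h => hvx₀ h.1)
  have hvx : ¬ G.Adj v x := fun h => hxP ⟨h, q₁, hq₁, hvq₁, hqx.symm⟩
  -- `P` holds the neighbours of `v` that agree with `q₁` on the neighbours of `v`, and `S` adds the
  -- non-neighbours of `v` that can be reached from `P`; all edges that leave `S` join `P` to the
  -- common neighbours of `v` and `q₁`
  set O : Set V := {z | z ∈ E ∧ ¬ G.Adj v z} with hO
  let P : Set V := {q | q ∈ E ∧ G.Adj v q ∧ ∀ y ∈ E, G.Adj v y → (G.Adj y q ↔ G.Adj y q₁)}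
  let S : Set V := {z | z ∈ P ∨ z ∈ O ∧ ∃ q ∈ P, Reach G O q z}
  have hq₁P : q₁ ∈ P := ⟨hq₁, hvq₁, fun _ _ _ => Iff.rfl⟩
  have hxS : x ∈ S := Or.inr ⟨⟨hx, hvx⟩, q₁, hq₁P, Reach.of_adj hqx ⟨hx, hvx⟩⟩
  have hy₁S : y₁ ∉ S := by
    rintro (h | h)
    · exact (h.2.2 y₁ hy₁ hvy₁).2 hqy₁.symm |>.ne rfl
    · exact h.1.2 hvy₁
  have hclaim : ∀ s ∈ S, ∀ t ∈ E, t ∉ S → G.Adj s t → s ∈ P ∧ G.Adj v t ∧ G.Adj t q₁ := by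
    intro s hs t ht htS hst
    have hvt : G.Adj v t := by
      by_contra hvt
      refine htS (Or.inr ⟨⟨ht, hvt⟩, ?_⟩)
      rcases hs with hs | ⟨-, q, hq, hr⟩
      · exact ⟨s, hs, Reach.of_adj hst ⟨ht, hvt⟩⟩
      · exact ⟨q, hq, hr.tail ⟨hst, ht, hvt⟩⟩
    rcases hs with hs | ⟨hsO, q, hq, hr⟩
    · exact ⟨hs, hvt, (hs.2.2 t ht hvt).1 hst.symm⟩
    · exfalso
      refine htS (Or.inl ⟨ht, hvt, ?_⟩)
      have hqt : q ≠ t := fun h => htS (Or.inl (h ▸ hq))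
      have hqO : q ∉ O := fun h => h.2 hq.2.1
      intro z hz hvz
      rw [← hq.2.2 z hz hvz]
      constructor
      · intro hzt
        obtain ⟨u, hu, hru, huq⟩ := hr.reverse hqO hsO hst
        exact adj_of_linked hG hE hv ht hz hq.1 hvt hvz hq.2.1 hzt.symm hqt.symm hru hu.1 hu.2 huq
      · intro hzq
        exact adj_of_linked hG hE hv hq.1 hz ht hq.2.1 hvz hvt hzq.symm hqt hr hsO.1 hsO.2 hst
  -- `S` would be one side of a split, so `y₁` is the only vertex outside of it
  have hall : ∀ z ∈ E, z ≠ y₁ → z ∈ S := by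
    intro z hz hne
    by_contra hzS
    obtain ⟨s₁, s₂, t₁, t₂, h1, h2, h3, h4, h5, h6, h7⟩ := hE.cut S q₁ hq₁ x hx y₁ hy₁ z hz
      hqx.ne hne.symm (Or.inl hq₁P) hxS hy₁S hzS
    obtain ⟨hs₁, -, -⟩ := hclaim s₁ h1.2 t₁ h3.1 h3.2 h5
    obtain ⟨-, hvt₂, ht₂⟩ := hclaim s₂ h2.2 t₂ h4.1 h4.2 h6
    exact h7 ((hs₁.2.2 t₂ h4.1 hvt₂).2 ht₂).symm
  obtain ⟨z, hz, hne, hz'⟩ := hcon y₁ hy₁ hvy₁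
  have hzS := hall z hz hne
  have : G.Adj v z ↔ G.Adj y₁ z := by
    constructor
    · intro hvz
      rcases hzS with h | h
      · exact (h.2.2 y₁ hy₁ hvy₁).2 hqy₁.symm
      · exact absurd hvz h.1.2
    · intro h
      exact (hclaim z hzS y₁ hy₁ hy₁S h.symm).1.2.1
  tauto

/-- A vertex with neighbours of both colours is adjacent to both ends of some edge: otherwise a
shortest path between its neighbours of different colours closes an odd hole. -/
theorem exists_full_edge (hG : IsMeyniel G) (hE : PrimeBip G E) (hv : v ∉ E) {c : V → Bool}
    (hc : TwoColored G E c) {y y' : V} (hy : y ∈ E) (hy' : y' ∈ E) (hvy : G.Adj v y)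
    (hvy' : G.Adj v y') (hcy : c y ≠ c y') :
    ∃ z ∈ E, ∃ z' ∈ E, G.Adj v z ∧ G.Adj v z' ∧ G.Adj z z' := by
  by_contra! hcon
  set O : Set V := {z | z ∈ E ∧ ¬ G.Adj v z} with hO
  obtain ⟨s, hs, t, ht, ⟨q, hq, hvq, hcq, hr, hsq⟩, htP, hst⟩ := hE.exists_crossing
    {z | ∃ q ∈ E, G.Adj v q ∧ c q = c y ∧ Reach G O q z ∧ (z = q ∨ z ∈ O)} hy hy'
    ⟨y, hy, hvy, rfl, .refl, Or.inl rfl⟩ (by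
      rintro ⟨q, hq, hvq, hcq, -, rfl | h⟩
      · exact hcy hcq.symm
      · exact h.2 hvy')
  have hvt : G.Adj v t := by
    by_contra hvt
    exact htP ⟨q, hq, hvq, hcq, hr.tail ⟨hst, ht, hvt⟩, Or.inr ⟨ht, hvt⟩⟩
  have hct : c t ≠ c y := fun h => htP ⟨t, ht, hvt, h, .refl, Or.inl rfl⟩
  rcases hsq with rfl | hsO
  · exact hcon s hs t ht hvq hvt hst
  have hqt : ¬ G.Adj q t := hcon q hq t ht hvq hvt
  obtain ⟨k, p, hp, -, hch⟩ := hr.exists_chordless (fun h => h.2 hvq) (fun h => h.2 hvt)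
    hsO hst (by rintro rfl; exact hct hcq)
  have hch := hch hqt
  have h2 := hp.two_le
  have hpE : ∀ i ≤ k, p i ∈ E := by
    intro i hi
    rcases Nat.eq_zero_or_pos i with rfl | h0
    · exact hp.zero ▸ hq
    rcases hi.eq_or_lt with rfl | h1
    · exact hp.last ▸ ht
    · exact (hp.mem i h0 h1).1
  have hpv : ∀ i ≤ k, (G.Adj v (p i) ↔ i = 0 ∨ i = k) := by
    intro i hi
    rcases Nat.eq_zero_or_pos i with rfl | h0
    · simp [hp.zero, hvq]
    rcases hi.eq_or_lt with rfl | h1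
    · simp [hp.last, hvt]
    · simp only [(hp.mem i h0 h1).2, false_iff]
      omega
  have hpar := color_path (k := k) (p := p) (c := c)
    (fun i hi => hc _ (hpE i (by omega)) _ (hpE (i + 1) (by omega)) (hp.adj i hi)) k le_rfl
  rw [hp.zero, hp.last, hcq] at hpar
  have hodd : ¬ Even k := fun h => hct (hpar.2 h)
  have hhole : Closed G (k + 1) (fun i => if i ≤ k then p i else v) := by
    constructor
    · intro i j hij hj
      rw [if_pos (by omega)]
      split_ifs with h
      · exact hch.ne _ _ hij h
      · rintro rfl; exact hv (hpE i (by omega))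
    · intro i j hij hj
      rw [if_pos (by omega)]
      split_ifs with h
      · rw [hch.adj _ _ hij h]; omega
      · rw [G.adj_comm, hpv i (by omega)]; omega
  have := hhole.odd hG (by omega)
  rw [Nat.odd_add_one, Nat.not_odd_iff_even] at this
  exact hodd this

/-- A vertex outside a prime bipartite graph `E` is complete to `E`, or a twin of a vertex of `E`,
or has at most one neighbour in `E`, or extends `E` to a larger prime bipartite graph. -/
theorem PrimeBip.vertex_cases (hG : IsMeyniel G) (hE : PrimeBip G E) (hv : v ∉ E) :
    (∀ z ∈ E, G.Adj v z) ∨ (∃ e ∈ E, ∀ z ∈ E, z ≠ e → (G.Adj v z ↔ G.Adj e z)) ∨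
      (∀ z ∈ E, ∀ z' ∈ E, G.Adj v z → G.Adj v z' → z = z') ∨ PrimeBip G (insert v E) := by
  classical
  by_cases hfull : ∃ z ∈ E, ∃ z' ∈ E, G.Adj v z ∧ G.Adj v z' ∧ G.Adj z z'
  · obtain ⟨z, hz, z', hz', h1, h2, h3⟩ := hfull
    rcases complete_or_trueTwin hG hE hv hz hz' h1 h2 h3 with h | ⟨e, he, -, h⟩
    · exact Or.inl h
    · exact Or.inr (Or.inl ⟨e, he, h⟩)
  refine Or.inr ?_
  by_contra! hcon
  obtain ⟨htwin, ⟨y, hy, y', hy', hvy, hvy', hyy⟩, hprime⟩ := hcon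
  refine hprime (hE.of_superset (Set.subset_insert _ _) ?_ ?_)
  · obtain ⟨c, hc⟩ := hE.bip
    have hmono : ∀ z ∈ E, G.Adj v z → c z = c y := by
      intro z hz hvz
      by_contra h
      exact hfull (exists_full_edge hG hE hv hc hz hy hvz hvy h)
    refine ⟨fun z => if z = v then !c y else c z, ?_⟩
    rintro a (rfl | ha) b (rfl | hb) hab
    · exact absurd rfl hab.ne
    · simp [hab.ne', hmono b hb hab]
    · simp [hab.ne, hmono a ha hab.symm]
    · have h1 : a ≠ v := by rintro rfl; exact hv ha
      have h2 : b ≠ v := by rintro rfl; exact hv hb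
      simpa [h1, h2] using hc a ha b hb hab
  · rintro P hP ⟨a, ha, b, hb, haP, hbP, hab⟩
    obtain ⟨d, hd, hdP, hvP⟩ : ∃ d ∈ E, d ∈ P ∧ v ∈ P := by
      rcases ha with rfl | ha <;> rcases hb with rfl | hb
      · exact absurd rfl hab
      · exact ⟨b, hb, hbP, haP⟩
      · exact ⟨a, ha, haP, hbP⟩
      · exact absurd (hP a ha b hb haP hbP) hab
    have hnP : ∀ z ∈ E, z ≠ d → z ∉ P := fun z hz hne h => hne (hP z hz d hd h hdP)
    obtain ⟨t, ht, hne, h⟩ := htwin d hd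
    by_cases hdt : G.Adj d t
    · have hvt : ¬ G.Adj v t := by tauto
      obtain ⟨x, hx, hxd, hvx⟩ : ∃ x ∈ E, x ≠ d ∧ G.Adj v x := by
        by_cases hyd : y = d
        · exact ⟨y', hy', fun h => hyy (hyd.trans h.symm), hvy'⟩
        · exact ⟨y, hy, hyd, hvy⟩
      exact ⟨v, d, x, t, ⟨Or.inl rfl, hvP⟩, ⟨Or.inr hd, hdP⟩, ⟨Or.inr hx, hnP x hx hxd⟩,
        ⟨Or.inr ht, hnP t ht hne⟩, hvx, hdt, hvt⟩
    · have hvt : G.Adj v t := by tauto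
      obtain ⟨x, hx, hdx⟩ := hE.exists_adj hd
      exact ⟨d, v, x, t, ⟨Or.inr hd, hdP⟩, ⟨Or.inl rfl, hvP⟩, ⟨Or.inr hx, hnP x hx hdx.ne'⟩,
        ⟨Or.inr ht, hnP t ht hne⟩, hdx, hvt, hdt⟩

end OneVertex

end

/-! ### Twins of vertices of a prime bipartite graph -/

section

variable {V : Type*} {G : SimpleGraph V} {D : Set V}

/-- `t` is the vertex `d` of `D`, or lies outside `D` and has the same neighbours as `d` in the
rest of `D`. -/
structure IsTwin (G : SimpleGraph V) (D : Set V) (d t : V) : Prop where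
  mem : d ∈ D
  eq_or : t = d ∨ t ∉ D
  adj : ∀ z ∈ D, z ≠ d → (G.Adj t z ↔ G.Adj d z)

theorem IsTwin.refl {d : V} (hd : d ∈ D) : IsTwin G D d d := ⟨hd, Or.inl rfl, fun _ _ _ => Iff.rfl⟩

theorem PrimeBip.twin_unique (hD : PrimeBip G D) {d d' t : V} (h : IsTwin G D d t)
    (h' : IsTwin G D d' t) : d = d' := by
  by_contra hne
  obtain ⟨z, hz, h1, h2, h3⟩ := hD.exists_separating h.mem h'.mem hne
  exact h3 ((h.adj z hz h1).symm.trans (h'.adj z hz h2))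

/-- The set `D` with its vertex `d` replaced by `t`. -/
def exchange (D : Set V) (d t : V) : Set V := insert t (D \ {d})

theorem mem_exchange {d t z : V} : z ∈ exchange D d t ↔ z = t ∨ z ∈ D ∧ z ≠ d := by
  simp [exchange]

theorem PrimeBip.exchanged (hD : PrimeBip G D) {d t : V} (h : IsTwin G D d t) :
    PrimeBip G (exchange D d t) := by
  classical
  have heq : CoContraction.exchange D d t = (fun z => if z = d then t else z) '' D := by
    ext z
    rw [mem_exchange]
    constructor
    · rintro (rfl | ⟨hz, hne⟩)
      · exact ⟨d, h.mem, by simp⟩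
      · exact ⟨z, hz, by simp [hne]⟩
    · rintro ⟨y, hy, rfl⟩
      by_cases hyd : y = d
      · simp [hyd]
      · simp [hyd, hy]
  have hneq : ∀ z ∈ D, z ≠ d → z ≠ t := by
    rintro z hz hne rfl
    exact h.eq_or.elim hne fun h => h hz
  rw [heq]
  refine hD.image _ ?_ ?_
  · intro x hx y hy hxy
    by_cases h1 : x = d <;> by_cases h2 : y = d
    · rw [h1, h2]
    · simp only [h1, h2, if_true, if_false] at hxy
      exact absurd hxy.symm (hneq y hy h2)
    · simp only [h1, h2, if_true, if_false] at hxy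
      exact absurd hxy (hneq x hx h1)
    · simpa [h1, h2] using hxy
  · intro x hx y hy
    by_cases h1 : x = d <;> by_cases h2 : y = d
    · simp [h1, h2]
    · simp [h1, h2, h.adj y hy h2]
    · simp only [h1, h2, if_true, if_false]
      rw [G.adj_comm, h.adj x hx h1, G.adj_comm]
    · simp [h1, h2]

/-- No vertex of `D` is adjacent to all the others but one. -/
theorem PrimeBip.exists_not_adj (hD : PrimeBip G D) {d e : V} (hd : d ∈ D) (he : e ∈ D)
    (hne : d ≠ e) : ∃ z ∈ D, z ≠ d ∧ z ≠ e ∧ ¬ G.Adj e z := by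
  by_contra! hall
  obtain ⟨z, hz, hz1, hz2, hsep⟩ := hD.exists_separating hd he hne
  have hez := hall z hz hz1 hz2
  have hdz : ¬ G.Adj d z := by tauto
  obtain ⟨y, hy, hye, hzy⟩ := hD.exists_adj_ne hz e
  have hyd : y ≠ d := by rintro rfl; exact hdz hzy.symm
  exact hD.not_triangle he hz hy hez hzy (hall y hy hyd hye)

section TwinPair

variable {d d' t t' : V}

/-- A twin of `d'` adjacent to `d'` sees the twins of `d` as `d'` sees `d`. -/
theorem adj_iff_of_trueTwin (hG : IsMeyniel G) (hD : PrimeBip G D) (h : IsTwin G D d t)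
    (h' : IsTwin G D d' t') (hne : d ≠ d') (ht : t ∉ D) (ht' : t' ∉ D) (htt : t ≠ t')
    (htd : G.Adj t' d') : (G.Adj t t' ↔ G.Adj d d') := by
  by_contra hmis
  have hE := hD.exchanged h
  have hd'E : d' ∈ exchange D d t := mem_exchange.2 (Or.inr ⟨h'.mem, hne.symm⟩)
  have ht'E : t' ∉ exchange D d t := by
    rw [mem_exchange]
    rintro (h | h)
    · exact htt h.symm
    · exact ht' h.1
  obtain ⟨z, hz, hzd, hdz⟩ := hD.exists_adj_ne h'.mem d
  rcases complete_or_trueTwin hG hE ht'E hd'E (mem_exchange.2 (Or.inr ⟨hz, hzd⟩)) htd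
    ((h'.adj z hz hdz.ne').2 hdz) hdz with hall | ⟨e, he, hte, htw⟩
  · obtain ⟨z, hz, h1, h2, h3⟩ := hD.exists_not_adj h.mem h'.mem hne
    exact h3 ((h'.adj z hz h2).1 (hall z (mem_exchange.2 (Or.inr ⟨hz, h1⟩))))
  · rcases mem_exchange.1 he with rfl | ⟨heD, hed⟩
    · obtain ⟨z, hz, hz1, hz2, hsep⟩ := hD.exists_separating h.mem h'.mem hne
      have h1 := htw z (mem_exchange.2 (Or.inr ⟨hz, hz1⟩)) (by rintro rfl; exact ht hz)
      rw [h'.adj z hz hz2, h.adj z hz hz1] at h1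
      exact hsep h1.symm
    · have htE : t ∈ exchange D d t := mem_exchange.2 (Or.inl rfl)
      have hte' := htw t htE (by rintro rfl; exact ht heD)
      by_cases hed' : e = d'
      · subst hed'
        rw [G.adj_comm t', G.adj_comm e, h.adj e heD hed] at hte'
        exact hmis hte'
      have hed'' : G.Adj e d' := (htw d' hd'E (Ne.symm hed')).1 htd
      have hno : ∀ z ∈ D, z ≠ d → z ≠ d' → z ≠ e → ¬ G.Adj d' z ∧ ¬ G.Adj e z := by
        intro z hz h1 h2 h3
        have h4 := htw z (mem_exchange.2 (Or.inr ⟨hz, h1⟩)) h3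
        rw [h'.adj z hz h2] at h4
        constructor
        · intro h6
          exact hD.not_triangle heD h'.mem hz hed'' h6 (h4.1 h6)
        · intro h6
          exact hD.not_triangle heD h'.mem hz hed'' (h4.2 h6) h6
      obtain ⟨x, hx, hxe, hd'x⟩ := hD.exists_adj_ne h'.mem e
      have hxd : x = d := by
        by_contra hxd
        exact (hno x hx hxd hd'x.ne' hxe).1 hd'x
      obtain ⟨y, hy, hyd', hey⟩ := hD.exists_adj_ne heD d'
      have hyd : y = d := by
        by_contra hyd
        exact (hno y hy hyd hyd' hey.ne').2 hey
      subst hxd hyd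
      exact hD.not_triangle heD h'.mem h.mem hed'' hd'x hey

/-- The sets with exactly one of two mismatched twins and at most one vertex of `D` are not sides
of a split of `D ∪ {t, t'}`. -/
theorem cross_of_mismatch (hD : PrimeBip G D) (h : IsTwin G D d t) (h' : IsTwin G D d' t')
    (hne : d ≠ d') (hmis : ¬ (G.Adj t t' ↔ G.Adj d d')) {E P : Set V} (hDE : D ⊆ E)
    (htE : t ∈ E) (ht'E : t' ∈ E) (htP : t ∈ P) (ht'P : t' ∉ P) {x : V} (hx : x ∈ D) (hxP : x ∈ P)
    (hP : ∀ z ∈ D, z ≠ x → z ∉ P) : Cross G E P := by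
  by_cases hxd : x = d
  · subst hxd
    obtain ⟨z, hz, hxz⟩ := hD.exists_adj hx
    have htz := (h.adj z hz hxz.ne').2 hxz
    have hzP := hP z hz hxz.ne'
    have h1 : G.Adj x t' ↔ G.Adj x d' := by
      rw [G.adj_comm, h'.adj x hx hne, G.adj_comm]
    by_cases hxt : G.Adj x t'
    · exact ⟨t, x, z, t', ⟨htE, htP⟩, ⟨hDE hx, hxP⟩, ⟨hDE hz, hzP⟩, ⟨ht'E, ht'P⟩, htz, hxt,
        by tauto⟩
    · exact ⟨x, t, z, t', ⟨hDE hx, hxP⟩, ⟨htE, htP⟩, ⟨hDE hz, hzP⟩, ⟨ht'E, ht'P⟩, hxz,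
        by tauto, hxt⟩
  · obtain ⟨z, hz, hzx, hzd, hsep⟩ := hD.exists_separating hx h.mem hxd
    rw [← h.adj z hz hzd] at hsep
    have hzP := hP z hz hzx
    by_cases hxz : G.Adj x z
    · obtain ⟨y, hy, hyx, hdy⟩ := hD.exists_adj_ne h.mem x
      exact ⟨t, x, y, z, ⟨htE, htP⟩, ⟨hDE hx, hxP⟩, ⟨hDE hy, hP y hy hyx⟩, ⟨hDE hz, hzP⟩,
        (h.adj y hy hdy.ne').2 hdy, hxz, by tauto⟩
    · obtain ⟨y, hy, hxy⟩ := hD.exists_adj hx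
      exact ⟨x, t, y, z, ⟨hDE hx, hxP⟩, ⟨htE, htP⟩, ⟨hDE hy, hP y hy hxy.ne'⟩, ⟨hDE hz, hzP⟩,
        hxy, by tauto, hxz⟩

/-- Two false twins of differently coloured vertices, mismatched, extend `D`. -/
theorem PrimeBip.insert_twins (hD : PrimeBip G D) {c : V → Bool} (hc : TwoColored G D c)
    (h : IsTwin G D d t) (h' : IsTwin G D d' t') (hne : d ≠ d') (ht : t ∉ D) (ht' : t' ∉ D)
    (htt : t ≠ t') (htd : ¬ G.Adj t d) (htd' : ¬ G.Adj t' d') (hcd : c d ≠ c d')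
    (hmis : ¬ (G.Adj t t' ↔ G.Adj d d')) : PrimeBip G (insert t (insert t' D)) := by
  classical
  have hN : ∀ {d t}, IsTwin G D d t → ¬ G.Adj t d → ∀ z ∈ D, G.Adj t z → c z ≠ c d := by
    intro d t h htd z hz htz
    have hzd : z ≠ d := by rintro rfl; exact htd htz
    exact (hc d h.mem z hz ((h.adj z hz hzd).1 htz)).symm
  refine hD.of_superset (fun z hz => Or.inr (Or.inr hz))
    ⟨fun z => if z = t then c d else if z = t' then c d' else c z, ?_⟩ ?_
  · have hDt : ∀ z ∈ D, z ≠ t ∧ z ≠ t' := fun z hz =>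
      ⟨by rintro rfl; exact ht hz, by rintro rfl; exact ht' hz⟩
    rintro a (rfl | rfl | ha) b (rfl | rfl | hb) hab
    · exact absurd rfl hab.ne
    · simpa [htt.symm] using hcd
    · simpa [(hDt b hb).1, (hDt b hb).2] using (hN h htd b hb hab).symm
    · simpa [htt.symm] using hcd.symm
    · exact absurd rfl hab.ne
    · simpa [(hDt b hb).1, (hDt b hb).2, htt.symm] using (hN h' htd' b hb hab).symm
    · simpa [(hDt a ha).1, (hDt a ha).2] using hN h htd a ha hab.symm
    · simpa [(hDt a ha).1, (hDt a ha).2, htt.symm] using hN h' htd' a ha hab.symm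
    · simpa [(hDt a ha).1, (hDt a ha).2, (hDt b hb).1, (hDt b hb).2] using hc a ha b hb hab
  · rintro P hP ⟨a, ha, b, hb, haP, hbP, hab⟩
    have hDE : D ⊆ insert t (insert t' D) := fun z hz => Or.inr (Or.inr hz)
    have htE : t ∈ insert t (insert t' D) := Or.inl rfl
    have htE' : t' ∈ insert t (insert t' D) := Or.inr (Or.inl rfl)
    by_cases htP : t ∈ P
    · by_cases htP' : t' ∈ P
      · obtain ⟨x, hx⟩ : ∃ x, ∀ z ∈ D, z ≠ x → z ∉ P := by
          by_cases hx : ∃ x ∈ D, x ∈ P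
          · obtain ⟨x, hx, hxP⟩ := hx
            exact ⟨x, fun z hz hne hzP => hne (hP z hz x hx hzP hxP)⟩
          · push Not at hx
            exact ⟨t, fun z hz _ => hx z hz⟩
        obtain ⟨y, hy, hyx, hdy⟩ := hD.exists_adj_ne h.mem x
        obtain ⟨z, hz, hzx, hdz⟩ := hD.exists_adj_ne h'.mem x
        refine ⟨t, t', y, z, ⟨htE, htP⟩, ⟨htE', htP'⟩, ⟨hDE hy, hx y hy hyx⟩, ⟨hDE hz, hx z hz hzx⟩,
          (h.adj y hy hdy.ne').2 hdy, (h'.adj z hz hdz.ne').2 hdz, fun htz => ?_⟩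
        have h1 := hN h htd z hz htz
        have h2 := hc d' h'.mem z hz hdz
        revert h1 h2 hcd
        cases c z <;> cases c d <;> cases c d' <;> simp
      · obtain ⟨x, hx, hxP⟩ : ∃ x ∈ D, x ∈ P := by
          rcases ha with rfl | rfl | ha
          · rcases hb with rfl | rfl | hb
            · exact absurd rfl hab
            · exact absurd hbP htP'
            · exact ⟨b, hb, hbP⟩
          · exact absurd haP htP'
          · exact ⟨a, ha, haP⟩
        exact cross_of_mismatch hD h h' hne hmis hDE htE htE' htP htP' hx hxP
          fun z hz hne hzP => hne (hP z hz x hx hzP hxP)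
    · by_cases htP' : t' ∈ P
      · obtain ⟨x, hx, hxP⟩ : ∃ x ∈ D, x ∈ P := by
          rcases ha with rfl | rfl | ha
          · exact absurd haP htP
          · rcases hb with rfl | rfl | hb
            · exact absurd hbP htP
            · exact absurd rfl hab
            · exact ⟨b, hb, hbP⟩
          · exact ⟨a, ha, haP⟩
        exact cross_of_mismatch hD h' h hne.symm (by rwa [G.adj_comm t', G.adj_comm d']) hDE
          htE' htE htP' htP hx hxP fun z hz hne hzP => hne (hP z hz x hx hzP hxP)
      · rcases ha with rfl | rfl | ha
        · exact absurd haP htP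
        · exact absurd haP htP'
        rcases hb with rfl | rfl | hb
        · exact absurd hbP htP
        · exact absurd hbP htP'
        exact absurd (hP a ha b hb haP hbP) hab

/-- Twins of two different vertices of `D` are adjacent exactly when the two vertices are, unless
they extend `D`. -/
theorem PrimeBip.adj_iff_or_insert_twins (hG : IsMeyniel G) (hD : PrimeBip G D)
    (h : IsTwin G D d t) (h' : IsTwin G D d' t') (hne : d ≠ d') (ht : t ∉ D) (ht' : t' ∉ D)
    (htt : t ≠ t') :
    (G.Adj t t' ↔ G.Adj d d') ∨ PrimeBip G (insert t (insert t' D)) := by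
  by_contra! hcon
  obtain ⟨hmis', hprime⟩ := hcon
  have hmis : ¬ (G.Adj t t' ↔ G.Adj d d') := by tauto
  by_cases htd' : G.Adj t' d'
  · exact hmis (adj_iff_of_trueTwin hG hD h h' hne ht ht' htt htd')
  by_cases htd : G.Adj t d
  · have := adj_iff_of_trueTwin hG hD h' h hne.symm ht' ht htt.symm htd
    rw [G.adj_comm t', G.adj_comm d'] at this
    exact hmis this
  obtain ⟨c, hc⟩ := hD.bip
  refine hprime (hD.insert_twins hc h h' hne ht ht' htt htd htd' ?_ hmis)
  intro hcd
  have hdd : ¬ G.Adj d d' := fun hadj => hc d h.mem d' h'.mem hadj hcd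
  have htt' : G.Adj t t' := by tauto
  -- on `D` with `d` replaced by `t`, the vertex `t'` has neighbours of both colours
  have hE := hD.exchanged h
  have htE : t ∈ exchange D d t := mem_exchange.2 (Or.inl rfl)
  have ht'E : t' ∉ exchange D d t := by
    rw [mem_exchange]
    rintro (h | h)
    · exact htt h.symm
    · exact ht' h.1
  have hfull : ∃ y ∈ exchange D d t, ∃ y' ∈ exchange D d t,
      G.Adj t' y ∧ G.Adj t' y' ∧ G.Adj y y' := by
    classical
    have hc' : TwoColored G (exchange D d t) (fun z => if z = t then c d else c z) := by
      have hDt : ∀ z ∈ D, z ≠ t := by rintro z hz rfl; exact ht hz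
      intro a ha b hb hab
      rcases mem_exchange.1 ha with ha' | ⟨ha', had⟩ <;>
        rcases mem_exchange.1 hb with hb' | ⟨hb', hbd⟩
      · exact absurd (ha'.trans hb'.symm) hab.ne
      · rw [ha'] at hab ⊢
        simpa [hDt b hb'] using hc d h.mem b hb' ((h.adj b hb' hbd).1 hab)
      · rw [hb'] at hab ⊢
        simpa [hDt a ha'] using (hc d h.mem a ha' ((h.adj a ha' had).1 hab.symm)).symm
      · simpa [hDt a ha', hDt b hb'] using hc a ha' b hb' hab
    obtain ⟨z, hz, hdz⟩ := hD.exists_adj h'.mem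
    have hzd : z ≠ d := by rintro rfl; exact hdd hdz.symm
    refine exists_full_edge hG hE ht'E hc' htE (mem_exchange.2 (Or.inr ⟨hz, hzd⟩)) htt'.symm
      ((h'.adj z hz hdz.ne').2 hdz) ?_
    have hzt : z ≠ t := by rintro rfl; exact ht hz
    simpa [hzt, hcd] using hc d' h'.mem z hz hdz
  obtain ⟨y, hy, y', hy', h1, h2, h3⟩ := hfull
  have hd'E : d' ∈ exchange D d t := mem_exchange.2 (Or.inr ⟨h'.mem, hne.symm⟩)
  rcases complete_or_trueTwin hG hE ht'E hy hy' h1 h2 h3 with hall | ⟨e, he, hte, htw⟩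
  · exact htd' (hall d' hd'E)
  · rcases mem_exchange.1 he with rfl | ⟨heD, hed⟩
    · obtain ⟨z, hz, hz1, hz2, hsep⟩ := hD.exists_separating h.mem h'.mem hne
      have h1 := htw z (mem_exchange.2 (Or.inr ⟨hz, hz1⟩)) (by rintro rfl; exact ht hz)
      rw [h'.adj z hz hz2, h.adj z hz hz1] at h1
      exact hsep h1.symm
    · have hed' : e ≠ d' := by rintro rfl; exact htd' hte
      have h4 := htw d' hd'E hed'.symm
      have h5 := (h'.adj e heD hed').1 hte
      exact htd' (h4.2 h5.symm)

end TwinPair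

end

/-! ### Ears -/

section

variable {V : Type*} {G : SimpleGraph V} {D : Set V}

/-- `p 0, …, p k` is a chordless path outside `D` with at least two vertices, whose only edges
to `D` join `p 0` to `t₁` and `p k` to `t₂`. -/
structure IsEar (G : SimpleGraph V) (D : Set V) (t₁ t₂ : V) (k : ℕ) (p : ℕ → V) : Prop where
  one_le : 1 ≤ k
  chordless : Chordless G k p
  mem₁ : t₁ ∈ D
  mem₂ : t₂ ∈ D
  ne : t₁ ≠ t₂
  not_mem : ∀ i ≤ k, p i ∉ D
  adj : ∀ i ≤ k, ∀ z ∈ D, (G.Adj (p i) z ↔ i = 0 ∧ z = t₁ ∨ i = k ∧ z = t₂)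

/-- Prescribed colours on a path extend a colouring of the other vertices. -/
theorem exists_color_extending {k : ℕ} {p : ℕ → V} (hp : ∀ i j, i < j → j ≤ k → p i ≠ p j)
    (c : V → Bool) (f : ℕ → Bool) :
    ∃ c' : V → Bool, (∀ i ≤ k, c' (p i) = f i) ∧ ∀ z, (∀ i ≤ k, p i ≠ z) → c' z = c z := by
  classical
  refine ⟨fun z => if h : ∃ i ≤ k, p i = z then f h.choose else c z, ?_, ?_⟩
  · intro i hi
    have h : ∃ j ≤ k, p j = p i := ⟨i, hi, rfl⟩
    simp only [dif_pos h]
    congr 1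
    by_contra hne
    rcases lt_or_gt_of_ne hne with h' | h'
    · exact hp _ _ h' hi h.choose_spec.2
    · exact hp _ _ h' h.choose_spec.1 h.choose_spec.2.symm
  · intro z hz
    have h : ¬ ∃ i ≤ k, p i = z := by
      rintro ⟨i, hi, h⟩
      exact hz i hi h
    simp only [dif_neg h]

theorem Chordless.adj_iff {k : ℕ} {p : ℕ → V} (hp : Chordless G k p) {i j : ℕ} (hi : i ≤ k)
    (hj : j ≤ k) : G.Adj (p i) (p j) ↔ j = i + 1 ∨ i = j + 1 := by
  rcases lt_trichotomy i j with h | rfl | h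
  · rw [hp.adj i j h hj]; omega
  · simp
  · rw [G.adj_comm, hp.adj j i h hi]; omega

namespace IsEar

variable {t₁ t₂ : V} {k : ℕ} {p : ℕ → V}

/-- The set of vertices of an ear together with `D`. -/
def union (D : Set V) (k : ℕ) (p : ℕ → V) : Set V := D ∪ {z | ∃ i ≤ k, p i = z}

/-- A 2-colouring of `D` extends over an ear whose length has the right parity. -/
theorem twoColored (h : IsEar G D t₁ t₂ k p) {c : V → Bool} (hc : TwoColored G D c)
    (hpar : c t₂ = c t₁ ↔ Even k) : ∃ c', TwoColored G (union D k p) c' := by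
  obtain ⟨c', h1, h2⟩ := exists_color_extending h.chordless.ne c
    (fun i => if Even i then !c t₁ else c t₁)
  have h2' : ∀ z ∈ D, c' z = c z := fun z hz => h2 z fun i hi hne => h.not_mem i hi (hne ▸ hz)
  have h3 : ∀ i ≤ k, ∀ z ∈ D, G.Adj (p i) z → c' (p i) ≠ c' z := by
    intro i hi z hz hadj
    rw [h1 i hi, h2' z hz]
    rcases (h.adj i hi z hz).1 hadj with ⟨rfl, rfl⟩ | ⟨rfl, rfl⟩
    · simp
    · by_cases hk : Even i
      · simp [hk, hpar.2 hk]
      · have := mt hpar.1 hk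
        simpa [hk] using Ne.symm this
  refine ⟨c', ?_⟩
  rintro a (ha | ⟨i, hi, rfl⟩) b (hb | ⟨j, hj, rfl⟩) hab
  · rw [h2' a ha, h2' b hb]
    exact hc a ha b hb hab
  · exact (h3 j hj a ha hab.symm).symm
  · exact h3 i hi b hb hab
  · rw [h1 i hi, h1 j hj]
    rcases (h.chordless.adj_iff hi hj).1 hab with rfl | rfl
    · by_cases hE : Even i <;> simp [Nat.even_add_one, hE]
    · by_cases hE : Even j <;> simp [Nat.even_add_one, hE]

/-- If every vertex of `D` has degree at least two in `D`, then a set with at most one vertex of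
`D` is not a side of a split of `D` with an ear added. -/
theorem cross (h : IsEar G D t₁ t₂ k p) (hdeg : ∀ d ∈ D, ∀ y, ∃ z ∈ D, z ≠ y ∧ G.Adj d z)
    {P : Set V} (hP : ∀ x ∈ D, ∀ x' ∈ D, x ∈ P → x' ∈ P → x = x')
    (hE : ∃ x ∈ union D k p, ∃ x' ∈ union D k p, x ∈ P ∧ x' ∈ P ∧ x ≠ x') :
    Cross G (union D k p) P := by
  classical
  have hk := h.one_le
  have hpE : ∀ i ≤ k, p i ∈ union D k p := fun i hi => Or.inr ⟨i, hi, rfl⟩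
  have hDE : ∀ z ∈ D, z ∈ union D k p := fun z hz => Or.inl hz
  by_cases hd : ∃ d ∈ D, d ∈ P
  · obtain ⟨d, hd, hdP⟩ := hd
    have hnP : ∀ z ∈ D, z ≠ d → z ∉ P := fun z hz hne hzP => hne (hP z hz d hd hzP hdP)
    obtain ⟨i, hi, hiP⟩ : ∃ i ≤ k, p i ∈ P := by
      obtain ⟨x, hx, x', hx', hxP, hxP', hne⟩ := hE
      rcases hx with hx | ⟨i, hi, rfl⟩
      · rcases hx' with hx' | ⟨i, hi, rfl⟩
        · exact absurd (hP x hx x' hx' hxP hxP') hne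
        · exact ⟨i, hi, hxP'⟩
      · exact ⟨i, hi, hxP⟩
    by_cases hg : ∃ i ≤ k, p i ∈ P ∧ ∃ g ∈ union D k p, g ∉ P ∧ G.Adj (p i) g
    · obtain ⟨i, hi, hiP, g, hg, hgP, hig⟩ := hg
      obtain ⟨y, hy, hne, hdy⟩ := hdeg d hd (if i = 0 then t₁ else t₂)
      refine ⟨p i, d, g, y, ⟨hpE i hi, hiP⟩, ⟨hDE d hd, hdP⟩, ⟨hg, hgP⟩,
        ⟨hDE y hy, hnP y hy hdy.ne'⟩, hig, hdy, ?_⟩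
      rw [h.adj i hi y hy]
      rintro (⟨h0, h1⟩ | ⟨h0, h1⟩)
      · simp [h0, h1] at hne
      · rw [if_neg (by omega)] at hne
        exact hne h1
    · push Not at hg
      have hg' : ∀ i ≤ k, p i ∈ P → ∀ z ∈ union D k p, G.Adj (p i) z → z ∈ P := by
        intro i hi hiP z hz hadj
        by_contra hzP
        exact hg i hi hiP z hz hzP hadj
      have hup : ∀ j, i ≤ j → j ≤ k → p j ∈ P := by
        intro j hij
        induction j, hij using Nat.le_induction with
        | base => exact fun _ => hiP
        | succ j _ ih =>
          intro hj
          exact hg' j (by omega) (ih (by omega)) _ (hpE _ hj)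
            ((h.chordless.adj _ _ (by omega) hj).2 rfl)
      have hdown : ∀ j, j ≤ i → p (i - j) ∈ P := by
        intro j
        induction j with
        | zero => exact fun _ => hiP
        | succ j ih =>
          intro hj
          exact hg' (i - j) (by omega) (ih (by omega)) _ (hpE _ (by omega))
            ((h.chordless.adj_iff (by omega) (by omega)).2 (by omega))
      have h1 : t₁ ∈ P := hg' 0 (by omega) (by simpa using hdown i le_rfl) _ (hDE _ h.mem₁)
        ((h.adj 0 (by omega) _ h.mem₁).2 (Or.inl ⟨rfl, rfl⟩))
      have h2 : t₂ ∈ P := hg' k le_rfl (hup k hi le_rfl) _ (hDE _ h.mem₂)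
        ((h.adj k le_rfl _ h.mem₂).2 (Or.inr ⟨rfl, rfl⟩))
      exact absurd (hP _ h.mem₁ _ h.mem₂ h1 h2) h.ne
  · push Not at hd
    obtain ⟨x, hx, x', hx', hxP, hxP', hne⟩ := hE
    rcases hx with hx | ⟨i₀, hi₀, rfl⟩
    · exact absurd hxP (hd x hx)
    rcases hx' with hx' | ⟨j₀, hj₀, rfl⟩
    · exact absurd hxP' (hd x' hx')
    have hex : ∃ i, i ≤ k ∧ p i ∈ P := ⟨i₀, hi₀, hxP⟩
    have hi := Nat.find_spec hex
    have himin := fun i => Nat.find_min (m := i) hex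
    have hi1 := Nat.find_min' hex ⟨hi₀, hxP⟩
    have hi2 := Nat.find_min' hex ⟨hj₀, hxP'⟩
    set i := Nat.find hex
    have hj := Nat.findGreatest_spec (P := fun j => p j ∈ P) hi₀ hxP
    have hjmax := fun j => Nat.findGreatest_is_greatest (P := fun j => p j ∈ P) (n := k) (k := j)
    have hj1 := Nat.le_findGreatest (P := fun j => p j ∈ P) hi₀ hxP
    have hj2 := Nat.le_findGreatest (P := fun j => p j ∈ P) hj₀ hxP'
    have hjk := Nat.findGreatest_le (P := fun j => p j ∈ P) k
    set j := Nat.findGreatest (fun j => p j ∈ P) k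
    have hij : i < j := by
      have : i₀ ≠ j₀ := by rintro rfl; exact hne rfl
      omega
    obtain ⟨g, hg, hgP, hig⟩ : ∃ g ∈ union D k p, g ∉ P ∧ G.Adj (p i) g := by
      by_cases h0 : i = 0
      · exact ⟨t₁, hDE _ h.mem₁, hd _ h.mem₁, (h.adj i hi.1 _ h.mem₁).2 (Or.inl ⟨h0, rfl⟩)⟩
      · exact ⟨p (i - 1), hpE _ (by omega), fun hP => himin (i - 1) (by omega) ⟨by omega, hP⟩,
          (h.chordless.adj_iff hi.1 (by omega)).2 (by omega)⟩
    obtain ⟨g', hg', hgP', hjg, hig'⟩ : ∃ g ∈ union D k p, g ∉ P ∧ G.Adj (p j) g ∧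
        ¬ G.Adj (p i) g := by
      by_cases h0 : j = k
      · refine ⟨t₂, hDE _ h.mem₂, hd _ h.mem₂, (h.adj j hjk _ h.mem₂).2 (Or.inr ⟨h0, rfl⟩), ?_⟩
        rw [h.adj i hi.1 _ h.mem₂]
        rintro (⟨-, h1⟩ | ⟨h1, -⟩)
        · exact h.ne h1.symm
        · omega
      · refine ⟨p (j + 1), hpE _ (by omega), hjmax (j + 1) (by omega) (by omega),
          (h.chordless.adj_iff hjk (by omega)).2 (by omega), ?_⟩
        rw [h.chordless.adj_iff hi.1 (by omega)]
        omega
    exact ⟨p i, p j, g, g', ⟨hpE i hi.1, hi.2⟩, ⟨hpE j hjk, hj⟩, ⟨hg, hgP⟩, ⟨hg', hgP'⟩, hig, hjg,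
      hig'⟩

/-- A prime bipartite graph stays prime bipartite when an ear is added; its parity is right
because it closes to a hole with a path of `D`. -/
theorem primeBip (hG : IsMeyniel G) (hD : PrimeBip G D) (h : IsEar G D t₁ t₂ k p) :
    PrimeBip G (union D k p) := by
  refine hD.of_superset (fun z hz => Or.inl hz) ?_
    (fun P hP hE => h.cross (fun d hd y => hD.exists_adj_ne hd y) hP hE)
  obtain ⟨c, hc⟩ := hD.bip
  refine h.twoColored hc ?_
  obtain ⟨m, q, hm, hq, hq0, hqm, hqD⟩ := hD.exists_chordless h.mem₁ h.mem₂ h.ne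
  have hk := h.one_le
  have hpar := color_path (k := m) (p := q) (c := c) (fun i hi => hc _ (hqD i (by omega)) _
    (hqD (i + 1) (by omega)) ((hq.adj _ _ (by omega) (by omega)).2 rfl)) m le_rfl
  rw [hq0, hqm] at hpar
  rw [hpar]
  -- the hole `q 0, …, q m, p k, …, p 0`
  have hhole : Closed G (m + k + 1) (fun i => if i ≤ m then q i else p (m + k + 1 - i)) := by
    have hqp : ∀ i ≤ m, ∀ j ≤ k, (G.Adj (q i) (p j) ↔ j = 0 ∧ i = 0 ∨ j = k ∧ i = m) := by
      intro i hi j hj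
      have hinj : ∀ i ≤ m, ∀ i' ≤ m, q i = q i' → i = i' := by
        intro i hi i' hi' heq
        by_contra hne
        rcases lt_or_gt_of_ne hne with h | h
        · exact hq.ne _ _ h hi' heq
        · exact hq.ne _ _ h hi heq.symm
      rw [G.adj_comm, h.adj j hj _ (hqD i hi), ← hq0, ← hqm]
      constructor
      · rintro (⟨h1, h2⟩ | ⟨h1, h2⟩)
        · exact Or.inl ⟨h1, hinj _ hi _ (by omega) h2⟩
        · exact Or.inr ⟨h1, hinj _ hi _ (by omega) h2⟩
      · rintro (⟨h1, rfl⟩ | ⟨h1, rfl⟩)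
        · exact Or.inl ⟨h1, rfl⟩
        · exact Or.inr ⟨h1, rfl⟩
    constructor
    · intro i j hij hj
      split_ifs with h1 h2 h2
      · exact hq.ne _ _ hij h2
      · intro heq
        exact h.not_mem _ (by omega) (heq ▸ hqD i h1)
      · omega
      · exact (h.chordless.ne _ _ (by omega) (by omega)).symm
    · intro i j hij hj
      split_ifs with h1 h2 h2
      · rw [hq.adj _ _ hij h2]; omega
      · rw [hqp i h1 _ (by omega)]; omega
      · omega
      · rw [h.chordless.adj_iff (by omega) (by omega)]; omega
  have hodd := hhole.odd hG (by omega)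
  rw [Nat.odd_add_one, Nat.not_odd_iff_even, Nat.even_add] at hodd
  exact hodd

end IsEar

theorem exists_ne_of_four {E : Set V} {a b c d : V} (ha : a ∈ E) (hb : b ∈ E) (hc : c ∈ E)
    (hd : d ∈ E) (h1 : a ≠ b) (h2 : a ≠ c) (h3 : a ≠ d) (h4 : b ≠ c) (h5 : b ≠ d) (h6 : c ≠ d)
    (x y z : V) : ∃ w ∈ E, w ≠ x ∧ w ≠ y ∧ w ≠ z := by
  classical
  by_contra! hcon
  have hsub : ({a, b, c, d} : Finset V) ⊆ {x, y, z} := by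
    intro w hw
    have hwE : w ∈ E := by
      simp only [Finset.mem_insert, Finset.mem_singleton] at hw
      rcases hw with rfl | rfl | rfl | rfl <;> assumption
    have := hcon w hwE
    simp only [Finset.mem_insert, Finset.mem_singleton]
    tauto
  have := (Finset.card_le_card hsub).trans Finset.card_le_three
  simp [h1, h2, h3, h4, h5, h6] at this

/-- Two nonadjacent pairs, complete to each other, form a prime bipartite graph together with an
ear of even order that joins the two pairs. -/
theorem primeBip_of_square_ear {a₀ a₁ b₀ b₁ : V} (ha : ¬ G.Adj a₀ a₁) (hb : ¬ G.Adj b₀ b₁)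
    (ha' : a₀ ≠ a₁) (hb' : b₀ ≠ b₁) (h00 : G.Adj a₀ b₀) (h01 : G.Adj a₀ b₁) (h10 : G.Adj a₁ b₀)
    (h11 : G.Adj a₁ b₁) {k : ℕ} {p : ℕ → V} (hk : Odd k)
    (h : IsEar G {a₀, a₁, b₀, b₁} a₁ b₁ k p) :
    PrimeBip G (IsEar.union {a₀, a₁, b₀, b₁} k p) := by
  classical
  have hk1 := h.one_le
  have hdeg : ∀ d ∈ ({a₀, a₁, b₀, b₁} : Set V), ∀ y, ∃ z ∈ ({a₀, a₁, b₀, b₁} : Set V),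
      z ≠ y ∧ G.Adj d z := by
    rintro d (rfl | rfl | rfl | rfl) y
    · by_cases hy : y = b₀
      · exact ⟨b₁, by simp, hy ▸ hb'.symm, h01⟩
      · exact ⟨b₀, by simp, Ne.symm hy, h00⟩
    · by_cases hy : y = b₀
      · exact ⟨b₁, by simp, hy ▸ hb'.symm, h11⟩
      · exact ⟨b₀, by simp, Ne.symm hy, h10⟩
    · by_cases hy : y = a₀
      · exact ⟨a₁, by simp, hy ▸ ha'.symm, h10.symm⟩
      · exact ⟨a₀, by simp, Ne.symm hy, h00.symm⟩
    · by_cases hy : y = a₀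
      · exact ⟨a₁, by simp, hy ▸ ha'.symm, h11.symm⟩
      · exact ⟨a₀, by simp, Ne.symm hy, h01.symm⟩
  have hDE : ∀ z ∈ ({a₀, a₁, b₀, b₁} : Set V), z ∈ IsEar.union {a₀, a₁, b₀, b₁} k p :=
    fun z hz => Or.inl hz
  have ha₀ := hDE a₀ (by simp)
  have ha₁ := hDE a₁ (by simp)
  have hb₀ := hDE b₀ (by simp)
  have hb₁ := hDE b₁ (by simp)
  -- both vertices of one pair on one side and both vertices of the other pair on the other side
  have hpair : ∀ P : Set V, a₀ ∈ P → a₁ ∈ P → b₀ ∉ P → b₁ ∉ P →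
      Cross G (IsEar.union {a₀, a₁, b₀, b₁} k p) P := by
    intro P h1 h2 h3 h4
    by_cases hkP : p k ∈ P
    · refine ⟨p k, a₀, b₁, b₀, ⟨Or.inr ⟨k, le_rfl, rfl⟩, hkP⟩, ⟨ha₀, h1⟩, ⟨hb₁, h4⟩, ⟨hb₀, h3⟩,
        (h.adj k le_rfl b₁ h.mem₂).2 (Or.inr ⟨rfl, rfl⟩), h00, ?_⟩
      rw [h.adj k le_rfl b₀ (by simp)]
      rintro (⟨h0, -⟩ | ⟨-, h0⟩)
      · omega
      · exact hb' h0
    have hna : ∀ i ≤ k, ¬ G.Adj a₀ (p i) := by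
      intro i hi hadj
      rcases (h.adj i hi a₀ (by simp)).1 hadj.symm with ⟨-, h0⟩ | ⟨-, h0⟩
      · exact ha' h0
      · exact h4 (h0 ▸ h1)
    by_cases h0P : p 0 ∈ P
    · have hex : ∃ i, p i ∉ P := ⟨k, hkP⟩
      have hi := Nat.find_spec hex
      have himin := fun i => Nat.find_min (m := i) hex
      have hik := Nat.find_min' hex hkP
      set i := Nat.find hex
      have hi0 : i ≠ 0 := fun h => hi (h ▸ h0P)
      have hiP := not_not.1 (himin (i - 1) (by omega))
      exact ⟨a₀, p (i - 1), b₀, p i, ⟨ha₀, h1⟩, ⟨Or.inr ⟨i - 1, by omega, rfl⟩, hiP⟩, ⟨hb₀, h3⟩,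
        ⟨Or.inr ⟨i, hik, rfl⟩, hi⟩, h00, (h.chordless.adj_iff (by omega) hik).2 (by omega),
        hna i hik⟩
    · exact ⟨a₀, a₁, b₀, p 0, ⟨ha₀, h1⟩, ⟨ha₁, h2⟩, ⟨hb₀, h3⟩, ⟨Or.inr ⟨0, by omega, rfl⟩, h0P⟩,
        h00, ((h.adj 0 (by omega) a₁ h.mem₁).2 (Or.inl ⟨rfl, rfl⟩)).symm, hna 0 (by omega)⟩
  refine ⟨?_, ?_, ?_⟩
  · refine h.twoColored (c := fun z => decide (z = a₀ ∨ z = a₁)) ?_ ?_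
    · have e1 : b₀ ≠ a₀ := h00.ne'
      have e2 : b₀ ≠ a₁ := h10.ne'
      have e3 : b₁ ≠ a₀ := h01.ne'
      have e4 : b₁ ≠ a₁ := h11.ne'
      have ha2 : ¬ G.Adj a₁ a₀ := fun h => ha h.symm
      have hb2 : ¬ G.Adj b₁ b₀ := fun h => hb h.symm
      rintro x (rfl | rfl | rfl | rfl) y (rfl | rfl | rfl | rfl) hxy <;> simp_all
    · have e3 : b₁ ≠ a₀ := h01.ne'
      have e4 : b₁ ≠ a₁ := h11.ne'
      rw [← Nat.not_even_iff_odd] at hk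
      simp [e3, e4, hk]
  · exact exists_ne_of_four ha₀ ha₁ hb₀ hb₁ ha' h00.ne h01.ne h10.ne h11.ne hb'
  · intro P x hx x' hx' y hy y' hy' hxx hyy hxP hxP' hyP hyP'
    by_cases h1 : ∀ x ∈ ({a₀, a₁, b₀, b₁} : Set V), ∀ x' ∈ ({a₀, a₁, b₀, b₁} : Set V),
        x ∈ P → x' ∈ P → x = x'
    · exact h.cross hdeg h1 ⟨x, hx, x', hx', hxP, hxP', hxx⟩
    by_cases h2 : ∀ x ∈ ({a₀, a₁, b₀, b₁} : Set V), ∀ x' ∈ ({a₀, a₁, b₀, b₁} : Set V),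
        x ∈ Pᶜ → x' ∈ Pᶜ → x = x'
    · exact (h.cross hdeg h2 ⟨y, hy, y', hy', hyP, hyP', hyy⟩).of_compl
    have hmix : ∀ a a' b b', a ∈ IsEar.union {a₀, a₁, b₀, b₁} k p →
        a' ∈ IsEar.union {a₀, a₁, b₀, b₁} k p → b ∈ IsEar.union {a₀, a₁, b₀, b₁} k p →
        b' ∈ IsEar.union {a₀, a₁, b₀, b₁} k p → G.Adj a b' → G.Adj a' b → ¬ G.Adj a a' →
        a ∈ P → b ∈ P → a' ∉ P → b' ∉ P → Cross G (IsEar.union {a₀, a₁, b₀, b₁} k p) P :=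
      fun a a' b b' k1 k2 k3 k4 k5 k6 k7 k8 k9 k10 k11 =>
        ⟨a, b, b', a', ⟨k1, k8⟩, ⟨k3, k9⟩, ⟨k4, k11⟩, ⟨k2, k10⟩, k5, k6.symm, k7⟩
    have ha2 : ¬ G.Adj a₁ a₀ := fun h => ha h.symm
    by_cases p0 : a₀ ∈ P <;> by_cases p1 : a₁ ∈ P <;> by_cases p2 : b₀ ∈ P <;>
      by_cases p3 : b₁ ∈ P
    all_goals
      first
      | exact hpair P p0 p1 p2 p3
      | exact (hpair Pᶜ p0 p1 (not_not.2 p2) (not_not.2 p3)).of_compl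
      | exact hmix a₀ a₁ b₀ b₁ ha₀ ha₁ hb₀ hb₁ h01 h10 ha p0 p2 p1 p3
      | exact hmix a₀ a₁ b₁ b₀ ha₀ ha₁ hb₁ hb₀ h00 h11 ha p0 p3 p1 p2
      | exact hmix a₁ a₀ b₀ b₁ ha₁ ha₀ hb₀ hb₁ h11 h00 ha2 p1 p2 p0 p3
      | exact hmix a₁ a₀ b₁ b₀ ha₁ ha₀ hb₁ hb₀ h10 h01 ha2 p1 p3 p0 p2
      | (refine absurd ?_ h1
         rintro u (rfl | rfl | rfl | rfl) w (rfl | rfl | rfl | rfl) hu hw <;>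
          first | rfl | contradiction)
      | (refine absurd ?_ h2
         rintro u (rfl | rfl | rfl | rfl) w (rfl | rfl | rfl | rfl) hu hw <;>
          first | rfl | exact absurd ‹_› hu | exact absurd ‹_› hw)

/-- The vertex set of a hole with at least six vertices is prime bipartite. -/
theorem Closed.primeBip (hG : IsMeyniel G) {k : ℕ} {p : ℕ → V} (hp : Closed G k p) (hk : 5 ≤ k) :
    PrimeBip G {z | ∃ i ≤ k, p i = z} := by
  classical
  have hodd := hp.odd hG (by omega)
  have hadj : ∀ i ≤ k, ∀ j ≤ k, (G.Adj (p i) (p j) ↔ j = i + 1 ∨ i = j + 1 ∨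
      i = 0 ∧ j = k ∨ j = 0 ∧ i = k) := by
    intro i hi j hj
    rcases lt_trichotomy i j with h | rfl | h
    · rw [hp.adj i j h hj]; omega
    · simp; omega
    · rw [G.adj_comm, hp.adj j i h hi]; omega
  have hmem : ∀ i ≤ k, p i ∈ {z | ∃ i ≤ k, p i = z} := fun i hi => ⟨i, hi, rfl⟩
  have key : ∀ P : Set V, p 0 ∉ P → (∃ i ≤ k, ∃ j ≤ k, i < j ∧ p i ∈ P ∧ p j ∈ P) →
      (∃ i ≤ k, 0 < i ∧ p i ∉ P) → Cross G {z | ∃ i ≤ k, p i = z} P := by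
    rintro P h0 ⟨i₀, hi₀, j₀, hj₀, hij₀, hiP₀, hjP₀⟩ ⟨l₀, hl₀, hl0, hlP₀⟩
    have hcross : ∀ i g j g', i ≤ k → g ≤ k → j ≤ k → g' ≤ k → p i ∈ P → p g ∉ P → p j ∈ P →
        p g' ∉ P → G.Adj (p i) (p g) → G.Adj (p j) (p g') → ¬ G.Adj (p i) (p g') →
        Cross G {z | ∃ i ≤ k, p i = z} P :=
      fun i g j g' h1 h2 h3 h4 h5 h6 h7 h8 h9 h10 h11 => ⟨p i, p j, p g, p g', ⟨hmem i h1, h5⟩,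
        ⟨hmem j h3, h7⟩, ⟨hmem g h2, h6⟩, ⟨hmem g' h4, h8⟩, h9, h10, h11⟩
    have hex : ∃ i, i ≤ k ∧ p i ∈ P := ⟨i₀, hi₀, hiP₀⟩
    have hi := Nat.find_spec hex
    have himin := fun i => Nat.find_min (m := i) hex
    have hi1 := Nat.find_min' hex ⟨hi₀, hiP₀⟩
    set i := Nat.find hex
    have hj := Nat.findGreatest_spec (P := fun j => p j ∈ P) hi₀ hiP₀
    have hjmax := fun j => Nat.findGreatest_is_greatest (P := fun j => p j ∈ P) (n := k) (k := j)
    have hj1 := Nat.le_findGreatest (P := fun j => p j ∈ P) hj₀ hjP₀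
    have hjk := Nat.findGreatest_le (P := fun j => p j ∈ P) k
    set j := Nat.findGreatest (fun j => p j ∈ P) k
    have hi0 : i ≠ 0 := by
      intro h
      have := hi.2
      rw [h] at this
      exact h0 this
    have hiP : p (i - 1) ∉ P := fun h => himin (i - 1) (by omega) ⟨by omega, h⟩
    by_cases hjk' : j = k
    · by_cases hi1' : i = 1
      · have hex : ∃ l, 1 < l ∧ l ≤ k ∧ p l ∉ P := by
          refine ⟨l₀, ?_, hl₀, hlP₀⟩
          rcases (show 1 ≤ l₀ by omega).eq_or_lt with rfl | h
          · rw [hi1'] at hi; exact absurd hi.2 hlP₀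
          · exact h
        have hl := Nat.find_spec hex
        have hlmin := fun i => Nat.find_min (m := i) hex
        set l := Nat.find hex
        have hlk : l ≠ k := by
          intro h
          have := hl.2.2
          rw [h, ← hjk'] at this
          exact this hj
        have hlP : p (l - 1) ∈ P := by
          by_contra hc
          by_cases h2 : l = 2
          · rw [h2] at hc
            rw [hi1'] at hi
            exact hc hi.2
          · exact hlmin (l - 1) (by omega) ⟨by omega, by omega, hc⟩
        have hkP : p k ∈ P := hjk' ▸ hj
        by_cases h2 : l = 2
        · rw [h2] at hl
          rw [hi1'] at hi
          refine hcross k 0 1 2 le_rfl (by omega) (by omega) (by omega) hkP h0 hi.2 hl.2.2 ?_ ?_ ?_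
          · rw [hadj _ (by omega) _ (by omega)]; omega
          · rw [hadj _ (by omega) _ (by omega)]; omega
          · rw [hadj _ (by omega) _ (by omega)]; omega
        · refine hcross (l - 1) l k 0 (by omega) hl.2.1 le_rfl (by omega) hlP hl.2.2 hkP h0 ?_ ?_ ?_
          · rw [hadj _ (by omega) _ (by omega)]; omega
          · rw [hadj _ (by omega) _ (by omega)]; omega
          · rw [hadj _ (by omega) _ (by omega)]; omega
      · refine hcross i (i - 1) j 0 hi.1 (by omega) hjk (by omega) hi.2 hiP hj h0 ?_ ?_ ?_
        · rw [hadj _ (by omega) _ (by omega)]; omega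
        · rw [hadj _ (by omega) _ (by omega)]; omega
        · rw [hadj _ (by omega) _ (by omega)]; omega
    · refine hcross i (i - 1) j (j + 1) hi.1 (by omega) hjk (by omega) hi.2 hiP hj
        (hjmax (j + 1) (by omega) (by omega)) ?_ ?_ ?_
      · rw [hadj _ (by omega) _ (by omega)]; omega
      · rw [hadj _ (by omega) _ (by omega)]; omega
      · rw [hadj _ (by omega) _ (by omega)]; omega
  refine ⟨?_, ?_, ?_⟩
  · obtain ⟨c, hc, -⟩ := exists_color_extending hp.ne (fun _ => false) (fun i => decide (Even i))
    refine ⟨c, ?_⟩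
    rintro _ ⟨i, hi, rfl⟩ _ ⟨j, hj, rfl⟩ hij
    rw [hadj i hi j hj] at hij
    rw [hc i hi, hc j hj]
    rw [← Nat.not_even_iff_odd] at hodd
    rcases hij with rfl | rfl | ⟨rfl, rfl⟩ | ⟨rfl, rfl⟩
    · by_cases h : Even i <;> simp [Nat.even_add_one, h]
    · by_cases h : Even j <;> simp [Nat.even_add_one, h]
    · simp [hodd]
    · simp [hodd]
  · exact exists_ne_of_four (hmem 0 (by omega)) (hmem 1 (by omega)) (hmem 2 (by omega))
      (hmem 3 (by omega)) (hp.ne _ _ (by omega) (by omega)) (hp.ne _ _ (by omega) (by omega))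
      (hp.ne _ _ (by omega) (by omega)) (hp.ne _ _ (by omega) (by omega))
      (hp.ne _ _ (by omega) (by omega)) (hp.ne _ _ (by omega) (by omega))
  · rintro P _ ⟨i, hi, rfl⟩ _ ⟨i', hi', rfl⟩ _ ⟨j, hj, rfl⟩ _ ⟨j', hj', rfl⟩ hii hjj h1 h2 h3 h4
    have hii' : i ≠ i' := by rintro rfl; exact hii rfl
    have hjj' : j ≠ j' := by rintro rfl; exact hjj rfl
    have hex : ∀ P : Set V, ∀ i ≤ k, ∀ i' ≤ k, i ≠ i' → p i ∈ P → p i' ∈ P →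
        ∃ i ≤ k, ∃ j ≤ k, i < j ∧ p i ∈ P ∧ p j ∈ P := by
      intro P i hi i' hi' hne h h'
      rcases lt_or_gt_of_ne hne with hlt | hlt
      · exact ⟨i, hi, i', hi', hlt, h, h'⟩
      · exact ⟨i', hi', i, hi, hlt, h', h⟩
    by_cases h0 : p 0 ∈ P
    · refine Cross.of_compl (key Pᶜ (not_not.2 h0) (hex Pᶜ j hj j' hj' hjj' h3 h4) ?_)
      obtain ⟨a, ha, b, hb, hab, -, h⟩ := hex P i hi i' hi' hii' h1 h2
      exact ⟨b, hb, by omega, not_not.2 h⟩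
    · refine key P h0 (hex P i hi i' hi' hii' h1 h2) ?_
      obtain ⟨a, ha, b, hb, hab, -, h⟩ := hex Pᶜ j hj j' hj' hjj' h3 h4
      exact ⟨b, hb, by omega, h⟩

end

/-! ### Chains between differently labelled sets -/

section

variable {V : Type*} {G : SimpleGraph V}

/-- A shortest chain in `O` whose ends carry different marks: it is chordless, and if it has at
least two vertices then only its ends carry marks, one each. -/
theorem exists_minimal_chain {ι : Type*} {O : Set V} {M : V → ι → Prop} {o o' : V} {d d' : ι}
    (ho : o ∈ O) (hr : Reach G O o o') (hd : M o d) (hd' : M o' d') (hne : d ≠ d') :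
    ∃ k p d₁ d₂, d₁ ≠ d₂ ∧ Chordless G k p ∧ (∀ i ≤ k, p i ∈ O) ∧ M (p 0) d₁ ∧ M (p k) d₂ ∧
      (1 ≤ k → ∀ i ≤ k, ∀ d, M (p i) d → i = 0 ∧ d = d₁ ∨ i = k ∧ d = d₂) := by
  classical
  let Q : ℕ → (ℕ → V) → ι → ι → Prop := fun k p d₁ d₂ => d₁ ≠ d₂ ∧
    (∀ i, i < k → G.Adj (p i) (p (i + 1))) ∧ (∀ i ≤ k, p i ∈ O) ∧ M (p 0) d₁ ∧ M (p k) d₂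
  have hex : ∃ k p d₁ d₂, Q k p d₁ d₂ := by
    obtain ⟨k, p, h0, hk, hO, hadj⟩ := hr.exists_seq
    refine ⟨k, p, d, d', hne, hadj, fun i hi => ?_, h0 ▸ hd, hk ▸ hd'⟩
    rcases Nat.eq_zero_or_pos i with rfl | h
    · exact h0 ▸ ho
    · exact hO i h hi
  obtain ⟨p, d₁, d₂, hne, hadj, hO, h1, h2⟩ := Nat.find_spec hex
  have hmin := fun i => Nat.find_min (m := i) hex
  set k := Nat.find hex
  have hshort : ∀ i n, 0 < n → i + 1 + n ≤ k → ¬ G.Adj (p i) (p (i + 1 + n)) := by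
    intro i n hn hik hadj'
    refine hmin (k - n) (by omega) ⟨fun t => if t ≤ i then p t else p (t + n), d₁, d₂, hne,
      ?_, ?_, by simpa using h1, ?_⟩
    · intro t ht
      dsimp only
      split_ifs with h1 h2 h2
      · exact hadj _ (by omega)
      · obtain rfl : t = i := by omega
        exact hadj'
      · omega
      · rw [show t + 1 + n = t + n + 1 by omega]
        exact hadj _ (by omega)
    · intro t ht
      dsimp only
      split_ifs with h1
      · exact hO _ (by omega)
      · exact hO _ (by omega)
    · dsimp only
      rw [if_neg (by omega), Nat.sub_add_cancel (by omega)]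
      exact h2
  have hpre : ∀ i < k, ∀ d, M (p i) d → d = d₁ := by
    intro i hi d hd
    by_contra hne'
    exact hmin i hi ⟨p, d₁, d, Ne.symm hne', fun j hj => hadj j (by omega),
      fun j hj => hO j (by omega), h1, hd⟩
  have hsuf : ∀ i, 0 < i → i ≤ k → ∀ d, M (p i) d → d = d₂ := by
    intro i hi hik d hd
    by_contra hne'
    refine hmin (k - i) (by omega) ⟨fun t => p (i + t), d, d₂, hne', fun j hj =>
      hadj (i + j) (by omega), fun j hj => hO _ (by omega), hd, ?_⟩
    dsimp only
    rw [show i + (k - i) = k by omega]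
    exact h2
  refine ⟨k, p, d₁, d₂, hne, ⟨?_, ?_⟩, hO, h1, h2, ?_⟩
  · intro i j hij hj heq
    by_cases hjk : j = k
    · have := hpre i (by omega) d₂ (heq ▸ hjk ▸ h2)
      exact hne this.symm
    · refine hshort i (j - i) (by omega) (by omega) ?_
      rw [heq, show i + 1 + (j - i) = j + 1 by omega]
      exact hadj j (by omega)
  · intro i j hij hj
    constructor
    · intro h
      by_contra hc
      refine hshort i (j - i - 1) (by omega) (by omega) ?_
      rwa [show i + 1 + (j - i - 1) = j by omega]
    · rintro rfl
      exact hadj i (by omega)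
  · intro hk i hi d hd
    by_cases h0 : i = 0
    · exact Or.inl ⟨h0, hpre i (by omega) d hd⟩
    · have e1 := hsuf i (by omega) hi d hd
      refine Or.inr ⟨?_, e1⟩
      by_contra hik
      exact hne ((hpre i (by omega) d hd).symm.trans e1)

/-! ### The core of an edge of a hole -/

/-- A core of the finite vertex set `W` around the edge `ab`: the vertices of `Z` carry labels and
form a bipartite blow-up (inside a label class any adjacency is allowed, between two classes
adjacency depends only on the labels, and the relation `R` between the labels is bipartite); the
vertices of `U` are complete to `Z`; apart from `U`, edges of `W` between different labels occur
only inside `Z`; and no single class contains an end of each nonadjacent pair of `Z`. -/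
structure Core (G : SimpleGraph V) (W : Set V) (a b : V) (U Z : Set V) (lab : V → V)
    (R : V → V → Prop) (col : V → Bool) : Prop where
  complete : ∀ u ∈ U, ∀ z ∈ Z, G.Adj u z
  sub : Z ⊆ W
  symm : ∀ i j, R i j → R j i
  col_ne : ∀ i j, R i j → col i ≠ col j
  adj_iff : ∀ z ∈ Z, ∀ z' ∈ Z, lab z ≠ lab z' → (G.Adj z z' ↔ R (lab z) (lab z'))
  boundary : ∀ v ∈ W, ∀ v' ∈ W, v ∉ U → v' ∉ U → G.Adj v v' → lab v ≠ lab v' → v ∈ Z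
  mem_left : a ∈ Z
  mem_right : b ∈ Z
  lab_ne : lab a ≠ lab b
  exists_not_adj : ∀ i, ∃ z ∈ Z, ∃ z' ∈ Z, z ≠ z' ∧ lab z ≠ i ∧ lab z' ≠ i ∧ ¬ G.Adj z z'

/-- `a` and `b` each have two neighbours in `D`, one of which is not a neighbour of the other
vertex. This is how a prime set that need not contain `a` and `b` remembers them. -/
def Spread (G : SimpleGraph V) (D : Set V) (a b : V) : Prop :=
  ∃ z₁ ∈ D, ∃ z₂ ∈ D, ∃ y₁ ∈ D, ∃ y₂ ∈ D, G.Adj a z₁ ∧ ¬ G.Adj b z₁ ∧ z₁ ≠ b ∧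
    G.Adj b z₂ ∧ ¬ G.Adj a z₂ ∧ z₂ ≠ a ∧ G.Adj a y₁ ∧ y₁ ≠ z₁ ∧ G.Adj b y₂ ∧ y₂ ≠ z₂

theorem Spread.mono {D E : Set V} {a b : V} (h : Spread G D a b) (hDE : D ⊆ E) :
    Spread G E a b := by
  obtain ⟨z₁, h1, z₂, h2, y₁, h3, y₂, h4, h⟩ := h
  exact ⟨z₁, hDE h1, z₂, hDE h2, y₁, hDE h3, y₂, hDE h4, h⟩

/-- A prime set is spread for any two vertices that are twins of the ends of one of its edges. -/
theorem PrimeBip.spread {D : Set V} (hD : PrimeBip G D) {a b α β : V} (ha : IsTwin G D α a)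
    (hb : IsTwin G D β b) (hαβ : G.Adj α β) : Spread G D a b := by
  have key : ∀ {a b α β : V}, IsTwin G D α a → IsTwin G D β b → G.Adj α β →
      ∃ z ∈ D, G.Adj a z ∧ ¬ G.Adj b z ∧ z ≠ b ∧ z ≠ β := by
    intro a b α β ha hb hαβ
    obtain ⟨z, hz, hzβ, hαz⟩ := hD.exists_adj_ne ha.mem β
    refine ⟨z, hz, (ha.adj z hz hαz.ne').2 hαz, ?_, ?_, hzβ⟩
    · rw [hb.adj z hz hzβ]
      exact fun h => hD.not_triangle ha.mem hb.mem hz hαβ h hαz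
    · rintro rfl
      exact hb.eq_or.elim hzβ fun h => h hz
  obtain ⟨z₁, h1, h2, h3, h4, h5⟩ := key ha hb hαβ
  obtain ⟨z₂, k1, k2, k3, k4, k5⟩ := key hb ha hαβ.symm
  exact ⟨z₁, h1, z₂, k1, β, hb.mem, α, ha.mem, h2, h3, h4, k2, k3, k4,
    (ha.adj β hb.mem hαβ.ne').2 hαβ, h5.symm, (hb.adj α ha.mem hαβ.ne).2 hαβ.symm, k5.symm⟩

/-- A prime bipartite subgraph of `W`, spread for `a` and `b`, of largest possible order. -/
structure IsMaxPrime (G : SimpleGraph V) (W : Set V) (a b : V) (D : Set V) : Prop where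
  finite : W.Finite
  sub : D ⊆ W
  prime : PrimeBip G D
  spread : Spread G D a b
  max : ∀ E ⊆ W, PrimeBip G E → Spread G E a b → E.ncard ≤ D.ncard

namespace IsMaxPrime

variable {W D : Set V} {a b : V}

theorem eq_of_subset (h : IsMaxPrime G W a b D) {E : Set V} (hDE : D ⊆ E) (hE : E ⊆ W)
    (hp : PrimeBip G E) : E ⊆ D :=
  (Set.eq_of_subset_of_ncard_le hDE (h.max E hE hp (h.spread.mono hDE))
    (h.finite.subset hE)).symm.subset

/-- By maximality, the last alternative of `PrimeBip.vertex_cases` does not occur. -/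
theorem vertex_cases (hG : IsMeyniel G) (h : IsMaxPrime G W a b D) {w : V} (hw : w ∈ W)
    (hwD : w ∉ D) : (∀ z ∈ D, G.Adj w z) ∨ (∃ d, IsTwin G D d w) ∨
      (∀ z ∈ D, ∀ z' ∈ D, G.Adj w z → G.Adj w z' → z = z') := by
  rcases h.prime.vertex_cases hG hwD with h1 | ⟨e, he, h1⟩ | h1 | h1
  · exact Or.inl h1
  · exact Or.inr (Or.inl ⟨e, he, Or.inr hwD, h1⟩)
  · exact Or.inr (Or.inr h1)
  · exact absurd (h.eq_of_subset (Set.subset_insert _ _) (Set.insert_subset hw h.sub) h1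
      (Set.mem_insert _ _)) hwD

/-- Adjacency between two twin classes is adjacency of the vertices of `D` they belong to. -/
theorem twin_adj_iff (hG : IsMeyniel G) (h : IsMaxPrime G W a b D) {d d' t t' : V} (ht : t ∈ W)
    (ht' : t' ∈ W) (hd : IsTwin G D d t) (hd' : IsTwin G D d' t') (hne : d ≠ d') :
    G.Adj t t' ↔ G.Adj d d' := by
  by_cases h1 : t ∈ D
  · obtain rfl : t = d := hd.eq_or.resolve_right (not_not.2 h1)
    rw [G.adj_comm, hd'.adj t h1 hne, G.adj_comm]
  by_cases h2 : t' ∈ D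
  · obtain rfl : t' = d' := hd'.eq_or.resolve_right (not_not.2 h2)
    exact hd.adj t' h2 hne.symm
  have htt : t ≠ t' := by
    rintro rfl
    exact hne (h.prime.twin_unique hd hd')
  rcases h.prime.adj_iff_or_insert_twins hG hd hd' hne h1 h2 htt with h3 | h3
  · exact h3
  · exact absurd (h.eq_of_subset (fun z hz => Or.inr (Or.inr hz))
      (Set.insert_subset ht (Set.insert_subset ht' h.sub)) h3 (Or.inl rfl)) h1

theorem exists_twins (hG : IsMeyniel G) (h : IsMaxPrime G W a b D) (ha : a ∈ W) (hb : b ∈ W)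
    (hab : G.Adj a b) : ∃ α β, IsTwin G D α a ∧ IsTwin G D β b ∧ α ≠ β ∧ G.Adj α β := by
  obtain ⟨z₁, h1, z₂, h2, y₁, h3, y₂, h4, a1, a2, a3, a4, a5, a6, a7, a8, a9, a10⟩ := h.spread
  have hA : ∃ α, IsTwin G D α a := by
    by_cases haD : a ∈ D
    · exact ⟨a, IsTwin.refl haD⟩
    · rcases h.vertex_cases hG ha haD with k | k | k
      · exact absurd (k z₂ h2) a5
      · exact k
      · exact absurd (k y₁ h3 z₁ h1 a7 a1) a8
  have hB : ∃ β, IsTwin G D β b := by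
    by_cases hbD : b ∈ D
    · exact ⟨b, IsTwin.refl hbD⟩
    · rcases h.vertex_cases hG hb hbD with k | k | k
      · exact absurd (k z₁ h1) a2
      · exact k
      · exact absurd (k y₂ h4 z₂ h2 a9 a4) a10
  obtain ⟨α, hα⟩ := hA
  obtain ⟨β, hβ⟩ := hB
  have hne : α ≠ β := by
    rintro rfl
    have e1 : z₁ = α := by
      by_contra hc
      exact a2 ((hβ.adj z₁ h1 hc).2 ((hα.adj z₁ h1 hc).1 a1))
    have e2 : z₂ = α := by
      by_contra hc
      exact a5 ((hα.adj z₂ h2 hc).2 ((hβ.adj z₂ h2 hc).1 a4))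
    rw [e2, ← e1] at a5
    exact a5 a1
  exact ⟨α, β, hα, hβ, hne, (h.twin_adj_iff hG ha hb hα hβ hne).1 hab⟩

theorem twin_exchange (hG : IsMeyniel G) (h : IsMaxPrime G W a b D) {d t e s : V} (ht : t ∈ W)
    (hs : s ∈ W) (hd : IsTwin G D d t) (he : IsTwin G D e s) (hne : e ≠ d) :
    IsTwin G (exchange D d t) e s := by
  refine ⟨mem_exchange.2 (Or.inr ⟨he.mem, hne⟩), ?_, ?_⟩
  · refine he.eq_or.imp_right fun hsD => ?_
    rw [mem_exchange]
    rintro (rfl | h')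
    · exact hne (h.prime.twin_unique he hd)
    · exact hsD h'.1
  · intro z hz hze
    rcases mem_exchange.1 hz with rfl | ⟨hzD, hzd⟩
    · rw [h.twin_adj_iff hG hs ht he hd hne, G.adj_comm e z, hd.adj e he.mem hne, G.adj_comm]
    · exact he.adj z hzD hze

theorem twin_exchange_self {d t s : V} (hd : IsTwin G D d t) (hs : IsTwin G D d s) :
    IsTwin G (exchange D d t) t s := by
  refine ⟨mem_exchange.2 (Or.inl rfl), ?_, ?_⟩
  · by_cases hst : s = t
    · exact Or.inl hst
    · refine Or.inr fun h => ?_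
      obtain ⟨h1, h2⟩ := (mem_exchange.1 h).resolve_left hst
      exact hs.eq_or.elim h2 fun h => h h1
  · intro z hz hzt
    obtain ⟨h1, h2⟩ := (mem_exchange.1 hz).resolve_left hzt
    rw [hs.adj z h1 h2, hd.adj z h1 h2]

/-- Replacing a vertex by a twin preserves maximality. -/
theorem exchanged (hG : IsMeyniel G) (h : IsMaxPrime G W a b D) (ha : a ∈ W) (hb : b ∈ W)
    (hab : G.Adj a b) {d t : V} (ht : t ∈ W) (hd : IsTwin G D d t) :
    IsMaxPrime G W a b (exchange D d t) := by
  have hp := h.prime.exchanged hd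
  refine ⟨h.finite, ?_, hp, ?_, ?_⟩
  · intro z hz
    rcases mem_exchange.1 hz with rfl | ⟨h1, -⟩
    · exact ht
    · exact h.sub h1
  · obtain ⟨α, β, hα, hβ, hne, hαβ⟩ := h.exists_twins hG ha hb hab
    by_cases h1 : α = d
    · subst h1
      exact hp.spread (twin_exchange_self hd hα) (h.twin_exchange hG ht hb hd hβ hne.symm)
        ((hd.adj β hβ.mem hne.symm).2 hαβ)
    · by_cases h2 : β = d
      · subst h2
        exact hp.spread (h.twin_exchange hG ht ha hd hα hne) (twin_exchange_self hd hβ)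
          ((hd.adj α hα.mem hne).2 hαβ.symm).symm
      · exact hp.spread (h.twin_exchange hG ht ha hd hα h1) (h.twin_exchange hG ht hb hd hβ h2) hαβ
  · intro E hE hpE hsE
    refine (h.max E hE hpE hsE).trans (le_of_eq ?_)
    rcases hd.eq_or with rfl | htD
    · rw [exchange, Set.insert_sdiff_singleton, Set.insert_eq_of_mem hd.mem]
    · exact (Set.ncard_exchange htD hd.mem).symm

theorem not_twin_of_complete (h : IsMaxPrime G W a b D) {u d : V} (hu : ∀ z ∈ D, G.Adj u z) :
    ¬ IsTwin G D d u := by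
  intro hd
  obtain ⟨e, he, hed, -⟩ := h.prime.large d d d
  obtain ⟨z, hz, -, hzd, hdz⟩ := h.prime.exists_not_adj he hd.mem hed
  exact hdz ((hd.adj z hz hzd).1 (hu z hz))

/-- A vertex complete to `D` is complete to all twins: replacing a vertex of `D` by a twin gives
another maximal prime set, in which the remaining cases for this vertex are excluded. -/
theorem complete_to_twins (hG : IsMeyniel G) (h : IsMaxPrime G W a b D) (ha : a ∈ W) (hb : b ∈ W)
    (hab : G.Adj a b) {u d z : V} (hu : u ∈ W) (huD : ∀ z ∈ D, G.Adj u z) (hz : z ∈ W)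
    (hd : IsTwin G D d z) : G.Adj u z := by
  have h' := h.exchanged hG ha hb hab hz hd
  have huz : u ∉ exchange D d z := by
    rw [mem_exchange]
    rintro (rfl | h1)
    · exact h.not_twin_of_complete huD hd
    · exact (huD u h1.1).ne rfl
  rcases h'.vertex_cases hG hu huz with h1 | ⟨e, he⟩ | h1
  · exact h1 z (mem_exchange.2 (Or.inl rfl))
  · by_contra hnot
    rcases mem_exchange.1 he.mem with rfl | ⟨heD, hed⟩
    · obtain ⟨y, hy, hyd, -⟩ := h.prime.large d d d
      obtain ⟨w, hw, -, hwd, hdw⟩ := h.prime.exists_not_adj hy hd.mem hyd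
      by_cases hwe : w = e
      · subst hwe
        exact hnot (huD w hw)
      · have := (he.adj w (mem_exchange.2 (Or.inr ⟨hw, hwd⟩)) hwe).1 (huD w hw)
        exact hdw ((hd.adj w hw hwd).1 this)
    · obtain ⟨w, hw, hwd, hwe, hew⟩ := h.prime.exists_not_adj hd.mem heD hed.symm
      exact hew ((he.adj w (mem_exchange.2 (Or.inr ⟨hw, hwd⟩)) hwe).1 (huD w hw))
  · obtain ⟨w, hw, hwd, -⟩ := h.prime.large d d d
    obtain ⟨w', hw', hwd', hww, -⟩ := h.prime.large d w d
    exact absurd (h1 w (mem_exchange.2 (Or.inr ⟨hw, hwd⟩)) w' (mem_exchange.2 (Or.inr ⟨hw', hwd'⟩))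
      (huD w hw) (huD w' hw')).symm hww

/-- The vertices of `W` that are neither complete to `D` nor twins of vertices of `D`. -/
def outer (G : SimpleGraph V) (W D : Set V) : Set V :=
  {o | o ∈ W ∧ (¬ ∀ z ∈ D, G.Adj o z) ∧ ∀ d, ¬ IsTwin G D d o}

/-- `o` has a neighbour in the twin class of `d`. -/
def Attaches (G : SimpleGraph V) (W D : Set V) (o d : V) : Prop :=
  ∃ z ∈ W, IsTwin G D d z ∧ G.Adj o z

/-- A connected set of outer vertices sees the twin class of at most one vertex of `D`. -/
theorem attaches_unique (hG : IsMeyniel G) (h : IsMaxPrime G W a b D) (ha : a ∈ W) (hb : b ∈ W)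
    (hab : G.Adj a b) {o o' d d' : V} (ho : o ∈ outer G W D) (hr : Reach G (outer G W D) o o')
    (hd : Attaches G W D o d) (hd' : Attaches G W D o' d') : d = d' := by
  by_contra hne
  obtain ⟨k, p, d₁, d₂, hne, hch, hpO, ⟨z₁, hz₁, ht₁, h01⟩, ⟨z₂, hz₂, ht₂, hk2⟩, honly⟩ :=
    exists_minimal_chain (M := Attaches G W D) ho hr hd hd' hne
  clear hd hd' ho hr
  -- a maximal prime set through `z₁` and `z₂`
  have hM₁ := h.exchanged hG ha hb hab hz₁ ht₁
  have ht₂' := h.twin_exchange hG hz₁ hz₂ ht₁ ht₂ hne.symm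
  have hM := hM₁.exchanged hG ha hb hab hz₂ ht₂'
  have hd₁W := h.sub ht₁.mem
  have hd₂W := h.sub ht₂.mem
  have hT₂ := twin_exchange_self ht₂' (h.twin_exchange hG hz₁ hd₂W ht₁ (IsTwin.refl ht₂.mem)
    hne.symm)
  have hz₁d₂ : z₁ ≠ d₂ := by
    rintro rfl
    exact ht₁.eq_or.elim hne.symm fun h => h ht₂.mem
  have hz₁z₂ : z₁ ≠ z₂ := by
    rintro rfl
    exact hne (h.prime.twin_unique ht₁ ht₂)
  have hT₁ := hM₁.twin_exchange hG hz₂ hd₁W ht₂' (twin_exchange_self ht₁ (IsTwin.refl ht₁.mem))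
    hz₁d₂
  set E := exchange (exchange D d₁ z₁) d₂ z₂ with hE
  have hmem : ∀ z, z ∈ E ↔ z = z₁ ∨ z = z₂ ∨ z ∈ D ∧ z ≠ d₁ ∧ z ≠ d₂ := by
    intro z
    rw [hE, mem_exchange, mem_exchange]
    constructor
    · tauto
    · rintro (rfl | h | h) <;> tauto
  have hEtwin : ∀ z ∈ E, z ∈ W ∧ ∃ d, IsTwin G D d z ∧ (d = d₁ → z = z₁) ∧ (d = d₂ → z = z₂) := by
    intro z hz
    refine ⟨hM.sub hz, ?_⟩
    rcases (hmem z).1 hz with rfl | rfl | ⟨h1, h2, h3⟩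
    · exact ⟨d₁, ht₁, fun _ => rfl, fun h => absurd h hne⟩
    · exact ⟨d₂, ht₂, fun h => absurd h hne.symm, fun _ => rfl⟩
    · exact ⟨z, IsTwin.refl h1, fun h => absurd h h2, fun h => absurd h h3⟩
  have hpE : ∀ i ≤ k, p i ∉ E := by
    intro i hi hpE
    obtain ⟨-, d, hd, -⟩ := hEtwin _ hpE
    exact (hpO i hi).2.2 d hd
  rcases Nat.eq_zero_or_pos k with rfl | hk
  · obtain ⟨h0W, h0c, h0t⟩ := hpO 0 le_rfl
    have h0D : p 0 ∉ D := fun h => h0t _ (IsTwin.refl h)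
    have hle : ∀ z ∈ D, ∀ z' ∈ D, G.Adj (p 0) z → G.Adj (p 0) z' → z = z' := by
      rcases h.vertex_cases hG h0W h0D with h1 | ⟨d, h1⟩ | h1
      · exact absurd h1 h0c
      · exact absurd h1 (h0t d)
      · exact h1
    -- a twin of `z₁` or `z₂` in `E` has two neighbours in `D`
    have hend : ∀ {z₁ z₂ d₁ d₂ : V}, d₂ ∈ D → IsTwin G D d₁ z₁ → z₂ ∈ E → z₂ ≠ z₁ →
        (∀ y ∈ D, y ≠ d₁ → y ≠ d₂ → y ∈ E) → IsTwin G E z₂ d₂ → d₂ ∈ W → G.Adj (p 0) z₂ →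
        ¬ IsTwin G E z₁ (p 0) := by
      intro z₁ z₂ d₁ d₂ hd₂ ht₁ hz₂ hne hyE hT₂ hd₂W hadj he
      have h1 : G.Adj (p 0) d₂ := (hM.twin_adj_iff hG h0W hd₂W he hT₂ hne.symm).2
        ((he.adj z₂ hz₂ hne).1 hadj)
      obtain ⟨y, hy, hyd, hdy⟩ := h.prime.exists_adj_ne ht₁.mem d₂
      have hyz : y ≠ z₁ := by
        rintro rfl
        exact ht₁.eq_or.elim hdy.ne' fun h => h hy
      have h2 : G.Adj (p 0) y := (he.adj y (hyE y hy hdy.ne' hyd) hyz).2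
        ((ht₁.adj y hy hdy.ne').2 hdy)
      exact hyd (hle y hy d₂ hd₂ h2 h1)
    have hz₁E : z₁ ∈ E := (hmem z₁).2 (Or.inl rfl)
    have hz₂E : z₂ ∈ E := (hmem z₂).2 (Or.inr (Or.inl rfl))
    rcases hM.vertex_cases hG h0W (hpE 0 le_rfl) with h1 | ⟨e, he⟩ | h1
    · obtain ⟨w, hw, hw1, hw2, -⟩ := h.prime.large d₁ d₂ d₁
      obtain ⟨w', hw', hw1', hw2', hww⟩ := h.prime.large d₁ d₂ w
      exact hww (hle w' hw' w hw (h1 w' ((hmem w').2 (Or.inr (Or.inr ⟨hw', hw1', hw2'⟩))))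
        (h1 w ((hmem w).2 (Or.inr (Or.inr ⟨hw, hw1, hw2⟩)))))
    · by_cases he1 : e = z₁
      · exact hend ht₂.mem ht₁ hz₂E hz₁z₂.symm
          (fun y hy h1 h2 => (hmem y).2 (Or.inr (Or.inr ⟨hy, h1, h2⟩))) hT₂ hd₂W hk2 (he1 ▸ he)
      by_cases he2 : e = z₂
      · exact hend ht₁.mem ht₂ hz₁E hz₁z₂
          (fun y hy h1 h2 => (hmem y).2 (Or.inr (Or.inr ⟨hy, h2, h1⟩))) hT₁ hd₁W h01 (he2 ▸ he)
      have h1 : G.Adj (p 0) d₁ := (hM.twin_adj_iff hG h0W hd₁W he hT₁ he1).2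
        ((he.adj z₁ hz₁E (Ne.symm he1)).1 h01)
      have h2 : G.Adj (p 0) d₂ := (hM.twin_adj_iff hG h0W hd₂W he hT₂ he2).2
        ((he.adj z₂ hz₂E (Ne.symm he2)).1 hk2)
      exact hne (hle d₁ ht₁.mem d₂ ht₂.mem h1 h2)
    · exact hz₁z₂ (h1 z₁ hz₁E z₂ hz₂E h01 hk2)
  · have hear : IsEar G E z₁ z₂ k p := by
      refine ⟨hk, hch, (hmem z₁).2 (Or.inl rfl), (hmem z₂).2 (Or.inr (Or.inl rfl)), hz₁z₂, hpE, ?_⟩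
      intro i hi z hz
      constructor
      · intro hadj
        obtain ⟨hzW, d, hd, hd1, hd2⟩ := hEtwin z hz
        rcases honly hk i hi d ⟨z, hzW, hd, hadj⟩ with ⟨h1, h2⟩ | ⟨h1, h2⟩
        · exact Or.inl ⟨h1, hd1 h2⟩
        · exact Or.inr ⟨h1, hd2 h2⟩
      · rintro (⟨rfl, rfl⟩ | ⟨rfl, rfl⟩)
        · exact h01
        · exact hk2
    have hsub := hM.eq_of_subset (fun z hz => Or.inl hz) (by
      rintro z (hz | ⟨i, hi, rfl⟩)
      · exact hM.sub hz
      · exact (hpO i hi).1) (hear.primeBip hG hM.prime)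
    exact hpE 0 (by omega) (hsub (Or.inr ⟨0, by omega, rfl⟩))

/-- The core of a maximal prime set `D`: `U` consists of the vertices complete to `D`, `Z` of the
twins, labelled by the vertex of `D` they are twins of, and the other vertices inherit the label of
the only twin class that their component sees. -/
theorem exists_core (hG : IsMeyniel G) (h : IsMaxPrime G W a b D) (ha : a ∈ W) (hb : b ∈ W)
    (hab : G.Adj a b) : ∃ U Z lab R col, Core G W a b U Z lab R col := by
  classical
  obtain ⟨α, β, hα, hβ, hαβ, -⟩ := h.exists_twins hG ha hb hab
  obtain ⟨c, hc⟩ := h.prime.bip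
  -- the label of a twin of `d` is `d`, that of an outer vertex the class seen by its component
  let L : V → V → Prop := fun v d => IsTwin G D d v ∨
    v ∈ outer G W D ∧ ∃ o, Reach G (outer G W D) v o ∧ Attaches G W D o d
  have hLuniq : ∀ v d d', L v d → L v d' → d = d' := by
    rintro v d d' (h1 | ⟨h1, o, h2, h3⟩) (h1' | ⟨h1', o', h2', h3'⟩)
    · exact h.prime.twin_unique h1 h1'
    · exact absurd h1 (h1'.2.2 d)
    · exact absurd h1' (h1.2.2 d')
    · have hr := Reach.symm h2 h1
      have ho : o ∈ outer G W D := by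
        rcases h2.cases_tail with rfl | ⟨_, -, h4⟩
        · exact h1
        · exact h4.2
      exact h.attaches_unique hG ha hb hab ho (hr.trans h2') h3 h3'
  let lab : V → V := fun v => if h : ∃ d, L v d then h.choose else a
  have hlab : ∀ v d, L v d → lab v = d := by
    intro v d hvd
    have hex : ∃ d, L v d := ⟨d, hvd⟩
    simp only [lab, dif_pos hex]
    exact hLuniq v _ _ hex.choose_spec hvd
  have hlab' : ∀ v d, IsTwin G D d v → lab v = d := fun v d hd => hlab v d (Or.inl hd)
  have hstep : ∀ v ∈ outer G W D, ∀ v' ∈ W, (¬ ∀ z ∈ D, G.Adj v' z) → G.Adj v v' →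
      lab v = lab v' := by
    intro v hv v' hv' hv'U hadj
    by_cases ht : ∃ d, IsTwin G D d v'
    · obtain ⟨d, hd⟩ := ht
      rw [hlab' v' d hd]
      exact hlab v d (Or.inr ⟨hv, v, .refl, v', hv', hd, hadj⟩)
    · have hv'O : v' ∈ outer G W D := ⟨hv', hv'U, fun d hd => ht ⟨d, hd⟩⟩
      by_cases hex : ∃ d, L v d
      · obtain ⟨d, hd⟩ := hex
        rw [hlab v d hd]
        rcases hd with hd | ⟨-, o, h1, h2⟩
        · exact absurd hd (hv.2.2 d)
        · exact (hlab v' d (Or.inr ⟨hv'O, o, (Reach.of_adj hadj.symm hv).trans h1, h2⟩)).symm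
      · have hex' : ¬ ∃ d, L v' d := by
          rintro ⟨d, hd | ⟨-, o, h1, h2⟩⟩
          · exact ht ⟨d, hd⟩
          · exact hex ⟨d, Or.inr ⟨hv, o, (Reach.of_adj hadj hv'O).trans h1, h2⟩⟩
        simp only [lab, dif_neg hex, dif_neg hex']
  refine ⟨{u | u ∈ W ∧ ∀ z ∈ D, G.Adj u z}, {z | z ∈ W ∧ ∃ d, IsTwin G D d z}, lab,
    fun i j => i ∈ D ∧ j ∈ D ∧ G.Adj i j, c, ?_⟩
  constructor
  · rintro u ⟨hu, huD⟩ z ⟨hz, d, hd⟩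
    exact h.complete_to_twins hG ha hb hab hu huD hz hd
  · exact fun z hz => hz.1
  · exact fun i j hij => ⟨hij.2.1, hij.1, hij.2.2.symm⟩
  · exact fun i j hij => hc i hij.1 j hij.2.1 hij.2.2
  · rintro z ⟨hz, d, hd⟩ z' ⟨hz', d', hd'⟩ hne
    rw [hlab' z d hd, hlab' z' d' hd'] at hne ⊢
    rw [h.twin_adj_iff hG hz hz' hd hd' hne]
    exact ⟨fun h => ⟨hd.mem, hd'.mem, h⟩, fun h => h.2.2⟩
  · intro v hv v' hv' hvU hv'U hadj hne
    refine ⟨hv, ?_⟩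
    by_contra ht
    exact hne (hstep v ⟨hv, fun h => hvU ⟨hv, h⟩, fun d hd => ht ⟨d, hd⟩⟩ v' hv'
      (fun h => hv'U ⟨hv', h⟩) hadj)
  · exact ⟨ha, α, hα⟩
  · exact ⟨hb, β, hβ⟩
  · rwa [hlab' a α hα, hlab' b β hβ]
  · intro i
    obtain ⟨x, hx, hxi, -⟩ := h.prime.large i i i
    obtain ⟨y, hy, hyi, hyx, -⟩ := h.prime.large i x i
    obtain ⟨z, hz, hzi, hzx, hzy⟩ := h.prime.large i x y
    have hZ : ∀ z ∈ D, z ∈ {z | z ∈ W ∧ ∃ d, IsTwin G D d z} := fun z hz =>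
      ⟨h.sub hz, z, IsTwin.refl hz⟩
    have hl : ∀ z ∈ D, lab z = z := fun z hz => hlab' z z (IsTwin.refl hz)
    by_cases hxy : G.Adj x y
    · by_cases hyz : G.Adj y z
      · exact ⟨x, hZ x hx, z, hZ z hz, hzx.symm, by rwa [hl x hx], by rwa [hl z hz],
          h.prime.not_triangle hx hy hz hxy hyz⟩
      · exact ⟨y, hZ y hy, z, hZ z hz, hzy.symm, by rwa [hl y hy], by rwa [hl z hz], hyz⟩
    · exact ⟨x, hZ x hx, y, hZ y hy, hyx.symm, by rwa [hl x hx], by rwa [hl y hy], hxy⟩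

end IsMaxPrime

end

/-! ### Complete pairs with connected complements -/

section

variable {V : Type*} {G : SimpleGraph V}

/-- The complement of `G` is connected on `A`. -/
def CoConn (G : SimpleGraph V) (A : Set V) : Prop :=
  ∀ P : Set V, ∀ x ∈ A, ∀ y ∈ A, x ∈ P → y ∉ P → ∃ s ∈ A, ∃ t ∈ A, s ∈ P ∧ t ∉ P ∧ ¬ G.Adj s t

theorem CoConn.pair {x y : V} (h : ¬ G.Adj x y) : CoConn G {x, y} := by
  rintro P u (rfl | rfl) w (rfl | rfl) hu hw
  · exact absurd hu hw
  · exact ⟨u, by simp, w, by simp, hu, hw, h⟩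
  · exact ⟨u, by simp, w, by simp, hu, hw, fun h' => h h'.symm⟩
  · exact absurd hu hw

theorem CoConn.insert {A : Set V} (hA : CoConn G A) {v x : V} (hx : x ∈ A) (hvx : ¬ G.Adj v x) :
    CoConn G (insert v A) := by
  intro P u hu w hw huP hwP
  by_cases h : ∃ u' ∈ A, u' ∈ P
  · by_cases h' : ∃ w' ∈ A, w' ∉ P
    · obtain ⟨u', hu', huP'⟩ := h
      obtain ⟨w', hw', hwP'⟩ := h'
      obtain ⟨s, hs, t, ht, h⟩ := hA P u' hu' w' hw' huP' hwP'
      exact ⟨s, Or.inr hs, t, Or.inr ht, h⟩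
    · push Not at h'
      have hv : v ∉ P := by
        rcases hw with rfl | hw
        · exact hwP
        · exact absurd (h' w hw) hwP
      exact ⟨x, Or.inr hx, v, Or.inl rfl, h' x hx, hv, fun h => hvx h.symm⟩
  · push Not at h
    have hv : v ∈ P := by
      rcases hu with rfl | hu
      · exact huP
      · exact absurd huP (h u hu)
    exact ⟨v, Or.inl rfl, x, Or.inr hx, hv, h x hx, hvx⟩

/-- `A` and `B` are complete to each other, and each has at least two vertices and a connected
complement. -/
structure IsCoPair (G : SimpleGraph V) (A B : Set V) : Prop where
  adj : ∀ x ∈ A, ∀ y ∈ B, G.Adj x y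
  left : CoConn G A
  right : CoConn G B
  nontrivial_left : A.Nontrivial
  nontrivial_right : B.Nontrivial

namespace IsCoPair

variable {A B : Set V}

theorem symm (h : IsCoPair G A B) : IsCoPair G B A :=
  ⟨fun x hx y hy => (h.adj y hy x hx).symm, h.right, h.left, h.nontrivial_right,
    h.nontrivial_left⟩

theorem exists_not_adj (h : IsCoPair G A B) : ∃ z ∈ A, ∃ z' ∈ A, z ≠ z' ∧ ¬ G.Adj z z' := by
  obtain ⟨x, hx, y, hy, hne⟩ := h.nontrivial_left
  obtain ⟨s, hs, t, ht, hsP, htP, hst⟩ := h.left {x} x hx y hy rfl hne.symm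
  exact ⟨s, hs, t, ht, by rintro rfl; exact htP hsP, hst⟩

/-- A vertex with neighbours on both sides is complete to one of the sides. -/
theorem complete_left_or_right (hG : IsMeyniel G) (h : IsCoPair G A B) {v a b : V} (hv : v ∉ A)
    (hv' : v ∉ B) (ha : a ∈ A) (hb : b ∈ B) (hva : G.Adj v a) (hvb : G.Adj v b) :
    (∀ x ∈ A, G.Adj v x) ∨ ∀ y ∈ B, G.Adj v y := by
  by_contra! hcon
  obtain ⟨⟨a', ha', hva'⟩, b', hb', hvb'⟩ := hcon
  obtain ⟨x, hx, y, hy, hvx, hvy, hxy⟩ := h.left {x | G.Adj v x} a ha a' ha' hva hva'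
  obtain ⟨x', hx', y', hy', hvx', hvy', hxy'⟩ := h.right {x | G.Adj v x} b hb b' hb' hvb hvb'
  simp only [Set.mem_ofPred_eq] at hvx hvy hvx' hvy'
  have hne : x ≠ y := by rintro rfl; exact hvy hvx
  have hne' : x' ≠ y' := by rintro rfl; exact hvy' hvx'
  let p : ℕ → V := fun i => if i = 0 then x else if i = 1 then y' else if i = 2 then y else x'
  have hp : Closed G 3 p := by
    have e1 := h.adj x hx y' hy'
    have e2 := h.adj x hx x' hx'
    have e3 := h.adj y hy y' hy'
    have e4 := h.adj y hy x' hx'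
    constructor
    · intro i j hij hj
      have : i = 0 ∧ j = 1 ∨ i = 0 ∧ j = 2 ∨ i = 0 ∧ j = 3 ∨ i = 1 ∧ j = 2 ∨ i = 1 ∧ j = 3 ∨
        i = 2 ∧ j = 3 := by omega
      rcases this with ⟨rfl, rfl⟩ | ⟨rfl, rfl⟩ | ⟨rfl, rfl⟩ | ⟨rfl, rfl⟩ | ⟨rfl, rfl⟩ | ⟨rfl, rfl⟩
      · exact e1.ne
      · exact hne
      · exact e2.ne
      · exact e3.ne'
      · exact hne'.symm
      · exact e4.ne
    · intro i j hij hj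
      have : i = 0 ∧ j = 1 ∨ i = 0 ∧ j = 2 ∨ i = 0 ∧ j = 3 ∨ i = 1 ∧ j = 2 ∨ i = 1 ∧ j = 3 ∨
        i = 2 ∧ j = 3 := by omega
      have hxy'' : ¬ G.Adj y' x' := fun h => hxy' h.symm
      rcases this with ⟨rfl, rfl⟩ | ⟨rfl, rfl⟩ | ⟨rfl, rfl⟩ | ⟨rfl, rfl⟩ | ⟨rfl, rfl⟩ | ⟨rfl, rfl⟩
      · simp [p, e1]
      · simp [p, hxy]
      · simp [p, e2]
      · simp [p, e3.symm]
      · simp [p, hxy'']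
      · simp [p, e4]
  obtain ⟨i, hi, hi', hadj⟩ := hp.exists_adj_inner hG le_rfl (v := v) (by
    intro i _
    simp only [p]
    split_ifs
    · rintro rfl; exact hv hx
    · rintro rfl; exact hv' hy'
    · rintro rfl; exact hv hy
    · rintro rfl; exact hv' hx') hvx hvx'
  obtain rfl | rfl : i = 1 ∨ i = 2 := by omega
  · exact hvy' hadj
  · exact hvy hadj

/-- A chordless path that starts at a vertex with neighbours in `A` only, not complete to `A`,
ends at a vertex with neighbours in `B` only, not complete to `B`, and has no other neighbours
in `A ∪ B`, is an ear of a square that contains two given vertices of `A` and `B`. -/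
theorem exists_primeBip (hG : IsMeyniel G) (h : IsCoPair G A B) {k : ℕ} {p : ℕ → V} (hk : 1 ≤ k)
    (hp : Chordless G k p) (hpA : ∀ i ≤ k, p i ∉ A) (hpB : ∀ i ≤ k, p i ∉ B)
    (hA : ∀ i ≤ k, ∀ x ∈ A, G.Adj (p i) x → i = 0) (hB : ∀ i ≤ k, ∀ y ∈ B, G.Adj (p i) y → i = k)
    (hA1 : ∃ x ∈ A, G.Adj (p 0) x) (hA0 : ∃ x ∈ A, ¬ G.Adj (p 0) x)
    (hB1 : ∃ y ∈ B, G.Adj (p k) y) (hB0 : ∃ y ∈ B, ¬ G.Adj (p k) y) {a b : V} (ha : a ∈ A)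
    (hb : b ∈ B) :
    ∃ D, PrimeBip G D ∧ a ∈ D ∧ b ∈ D ∧ D ⊆ A ∪ B ∪ {z | ∃ i ≤ k, p i = z} := by
  have hhole : ∀ x ∈ A, ∀ y ∈ B, G.Adj (p 0) x → G.Adj (p k) y →
      Closed G (k + 2) (fun i => if i = 0 then x else if i ≤ k + 1 then p (i - 1) else y) := by
    intro x hx y hy hpx hpy
    constructor
    · intro i j hij hj
      rw [if_neg (show j ≠ 0 by omega)]
      split_ifs with h1 h2 h3 h2
      · rintro rfl; exact hpA _ (by omega) hx
      · exact (h.adj x hx y hy).ne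
      · exact hp.ne _ _ (by omega) (by omega)
      · rintro rfl; exact hpB _ (by omega) hy
      · omega
      · omega
    · intro i j hij hj
      rw [if_neg (show j ≠ 0 by omega)]
      split_ifs with h1 h2 h3 h2
      · rw [G.adj_comm]
        constructor
        · intro hadj
          have := hA _ (by omega) x hx hadj
          omega
        · intro hj
          rw [show j - 1 = 0 by omega]
          exact hpx
      · simp only [h.adj x hx y hy, true_iff]
        omega
      · rw [hp.adj _ _ (by omega) (by omega)]
        omega
      · constructor
        · intro hadj
          have := hB _ (by omega) y hy hadj
          omega
        · intro hj
          rw [show i - 1 = k by omega]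
          exact hpy
      · omega
      · omega
  -- a vertex complete to the edge closing such a hole sees a third vertex of it
  have hcap : ∀ x ∈ A, ∀ y ∈ B, G.Adj (p 0) x → G.Adj (p k) y → ∀ v, (v ∈ A ∨ v ∈ B) →
      ¬ G.Adj (p 0) v → ¬ G.Adj (p k) v → G.Adj v x → ¬ G.Adj v y := by
    intro x hx y hy hpx hpy v hv h0 hk' hvx hvy
    obtain ⟨i, hi, hi', hadj⟩ := (hhole x hx y hy hpx hpy).exists_adj_inner hG (by omega) (v := v)
      (by
        intro i hi
        split_ifs
        · exact hvx.ne
        · rintro rfl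
          exact hv.elim (hpA _ (by omega)) (hpB _ (by omega))
        · exact hvy.ne) (by simpa using hvx) (by simpa using hvy)
    rw [if_neg (by omega), if_pos (by omega)] at hadj
    rcases hv with hv | hv
    · have := hA _ (by omega) v hv hadj.symm
      exact h0 (this ▸ hadj.symm)
    · have := hB _ (by omega) v hv hadj.symm
      exact hk' (this ▸ hadj.symm)
  obtain ⟨x, hx, hpx⟩ := hA1
  obtain ⟨y, hy, hpy⟩ := hB1
  have hkodd : Odd k := by
    have := (hhole x hx y hy hpx hpy).odd hG (by omega)
    rw [Nat.odd_add] at this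
    exact this.2 even_two
  obtain ⟨a₀, ha₀, a₁, ha₁, hpa₀, hpa₁, haa⟩ : ∃ a₀ ∈ A, ∃ a₁ ∈ A, ¬ G.Adj (p 0) a₀ ∧
      G.Adj (p 0) a₁ ∧ (a = a₀ ∨ a = a₁) := by
    by_cases hpa : G.Adj (p 0) a
    · obtain ⟨x', hx', hpx'⟩ := hA0
      exact ⟨x', hx', a, ha, hpx', hpa, Or.inr rfl⟩
    · exact ⟨a, ha, x, hx, hpa, hpx, Or.inl rfl⟩
  obtain ⟨b₀, hb₀, b₁, hb₁, hpb₀, hpb₁, hbb⟩ : ∃ b₀ ∈ B, ∃ b₁ ∈ B, ¬ G.Adj (p k) b₀ ∧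
      G.Adj (p k) b₁ ∧ (b = b₀ ∨ b = b₁) := by
    by_cases hpb : G.Adj (p k) b
    · obtain ⟨x', hx', hpx'⟩ := hB0
      exact ⟨x', hx', b, hb, hpx', hpb, Or.inr rfl⟩
    · exact ⟨b, hb, y, hy, hpb, hpy, Or.inl rfl⟩
  have ha01 : ¬ G.Adj a₀ a₁ := fun hadj => hcap a₁ ha₁ b₁ hb₁ hpa₁ hpb₁ a₀ (Or.inl ha₀) hpa₀
    (fun h => by have := hA k le_rfl a₀ ha₀ h; omega) hadj (h.adj a₀ ha₀ b₁ hb₁)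
  have hb01 : ¬ G.Adj b₀ b₁ := fun hadj => hcap a₁ ha₁ b₁ hb₁ hpa₁ hpb₁ b₀ (Or.inr hb₀)
    (fun h => by have := hB 0 (by omega) b₀ hb₀ h; omega) hpb₀ (h.adj a₁ ha₁ b₀ hb₀).symm hadj
  have hear : IsEar G {a₀, a₁, b₀, b₁} a₁ b₁ k p := by
    refine ⟨hk, hp, by simp, by simp, (h.adj a₁ ha₁ b₁ hb₁).ne, ?_, ?_⟩
    · rintro i hi (h1 | h1 | h1 | h1)
      · exact hpA i hi (h1 ▸ ha₀)
      · exact hpA i hi (h1 ▸ ha₁)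
      · exact hpB i hi (h1 ▸ hb₀)
      · exact hpB i hi (h1 ▸ hb₁)
    · intro i hi z hz
      constructor
      · intro hadj
        rcases hz with rfl | rfl | rfl | rfl
        · have := hA i hi z ha₀ hadj
          exact absurd (this ▸ hadj) hpa₀
        · exact Or.inl ⟨hA i hi z ha₁ hadj, rfl⟩
        · have := hB i hi z hb₀ hadj
          exact absurd (this ▸ hadj) hpb₀
        · exact Or.inr ⟨hB i hi z hb₁ hadj, rfl⟩
      · rintro (⟨rfl, rfl⟩ | ⟨rfl, rfl⟩)
        · exact hpa₁
        · exact hpb₁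
  refine ⟨_, primeBip_of_square_ear ha01 hb01 (by rintro rfl; exact hpa₀ hpa₁)
    (by rintro rfl; exact hpb₀ hpb₁) (h.adj _ ha₀ _ hb₀) (h.adj _ ha₀ _ hb₁) (h.adj _ ha₁ _ hb₀)
    (h.adj _ ha₁ _ hb₁) hkodd hear, ?_, ?_, ?_⟩
  · rcases haa with rfl | rfl <;> exact Or.inl (by simp)
  · rcases hbb with rfl | rfl <;> exact Or.inl (by simp)
  · rintro z ((rfl | rfl | rfl | rfl) | hz)
    · exact Or.inl (Or.inl ha₀)
    · exact Or.inl (Or.inl ha₁)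
    · exact Or.inl (Or.inr hb₀)
    · exact Or.inl (Or.inr hb₁)
    · exact Or.inr hz

/-- If no prime bipartite subgraph of `W` contains both `a` and `b`, then a largest complete pair
around `a` and `b` is a core. -/
theorem exists_core (hG : IsMeyniel G) {W : Set V} (hW : W.Finite) {a b : V}
    (hno : ∀ D ⊆ W, PrimeBip G D → a ∈ D → b ∉ D) {A₀ B₀ : Set V} (h₀ : IsCoPair G A₀ B₀)
    (hA₀ : A₀ ⊆ W) (hB₀ : B₀ ⊆ W) (ha₀ : a ∈ A₀) (hb₀ : b ∈ B₀) :
    ∃ U Z lab R col, Core G W a b U Z lab R col := by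
  classical
  obtain ⟨⟨A, B⟩, ⟨⟨hAW, hBW⟩, h, ha, hb⟩, hmax⟩ := Set.exists_max_image
    {q : Set V × Set V | (q.1 ⊆ W ∧ q.2 ⊆ W) ∧ IsCoPair G q.1 q.2 ∧ a ∈ q.1 ∧ b ∈ q.2}
    (fun q => q.1.ncard + q.2.ncard)
    ((hW.finite_subsets.prod hW.finite_subsets).subset fun q hq => ⟨hq.1.1, hq.1.2⟩)
    ⟨(A₀, B₀), ⟨hA₀, hB₀⟩, h₀, ha₀, hb₀⟩
  simp only at hAW hBW h ha hb
  -- by maximality, a vertex complete to one side is complete to the other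
  have hBA : ∀ v ∈ W, v ∉ A → (∀ y ∈ B, G.Adj v y) → ∀ x ∈ A, G.Adj v x := by
    intro v hv hvA hvB
    by_contra! hcon
    obtain ⟨x, hx, hvx⟩ := hcon
    have := hmax (insert v A, B) ⟨⟨Set.insert_subset hv hAW, hBW⟩, ⟨by
      rintro u (rfl | hu) y hy
      · exact hvB y hy
      · exact h.adj u hu y hy, h.left.insert hx hvx, h.right,
      h.nontrivial_left.mono (Set.subset_insert _ _), h.nontrivial_right⟩, Or.inr ha, hb⟩
    simp only [Set.ncard_insert_of_notMem hvA (hW.subset hAW)] at this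
    omega
  have hAB : ∀ v ∈ W, v ∉ B → (∀ x ∈ A, G.Adj v x) → ∀ y ∈ B, G.Adj v y := by
    intro v hv hvB hvA
    by_contra! hcon
    obtain ⟨y, hy, hvy⟩ := hcon
    have := hmax (A, insert v B) ⟨⟨hAW, Set.insert_subset hv hBW⟩, ⟨by
      rintro u hu y (rfl | hy)
      · exact (hvA u hu).symm
      · exact h.adj u hu y hy, h.left, h.right.insert hy hvy, h.nontrivial_left,
      h.nontrivial_right.mono (Set.subset_insert _ _)⟩, ha, Or.inr hb⟩
    simp only [Set.ncard_insert_of_notMem hvB (hW.subset hBW)] at this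
    omega
  let U : Set V := {u | u ∈ W ∧ (∀ x ∈ A, G.Adj u x) ∧ ∀ y ∈ B, G.Adj u y}
  let O : Set V := {o | o ∈ W ∧ o ∉ U ∧ o ∉ A ∧ o ∉ B}
  have hOA : ∀ o ∈ O, ∃ x ∈ A, ¬ G.Adj o x := by
    rintro o ⟨hoW, hoU, hoA, hoB⟩
    by_contra! hcon
    exact hoU ⟨hoW, hcon, hAB o hoW hoB hcon⟩
  have hOB : ∀ o ∈ O, ∃ y ∈ B, ¬ G.Adj o y := by
    rintro o ⟨hoW, hoU, hoA, hoB⟩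
    by_contra! hcon
    exact hoU ⟨hoW, hBA o hoW hoA hcon, hcon⟩
  have hOAB : ∀ o ∈ O, ∀ x ∈ A, ∀ y ∈ B, G.Adj o x → ¬ G.Adj o y := by
    intro o ho x hx y hy hox hoy
    obtain ⟨x', hx', hox'⟩ := hOA o ho
    obtain ⟨y', hy', hoy'⟩ := hOB o ho
    rcases h.complete_left_or_right hG ho.2.2.1 ho.2.2.2 hx hy hox hoy with h1 | h1
    · exact hox' (h1 x' hx')
    · exact hoy' (h1 y' hy')
  have hear : ∀ o ∈ O, ∀ o', Reach G O o o' → ∀ x ∈ A, ∀ y ∈ B, G.Adj o x → ¬ G.Adj o' y := by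
    intro o ho o' hr x hx y hy hox hoy
    let S : Bool → Set V := fun i => if i then A else B
    obtain ⟨k, p, d₁, d₂, hne, hch, hpO, h01, hk2, honly⟩ := exists_minimal_chain
      (M := fun v i => ∃ z ∈ S i, G.Adj v z) (d := true) (d' := false) ho hr ⟨x, hx, hox⟩
      ⟨y, hy, hoy⟩ (by simp)
    have hfin : ∀ D, PrimeBip G D → a ∈ D → b ∈ D → D ⊆ A ∪ B ∪ {z | ∃ i ≤ k, p i = z} → False := by
      intro D hD haD hbD hsub
      refine hno D (hsub.trans ?_) hD haD hbD
      rintro z ((hz | hz) | ⟨i, hi, rfl⟩)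
      · exact hAW hz
      · exact hBW hz
      · exact (hpO i hi).1
    have hk : 1 ≤ k := by
      by_contra hk
      obtain rfl : k = 0 := by omega
      obtain ⟨z₁, hz₁, h1⟩ := h01
      obtain ⟨z₂, hz₂, h2⟩ := hk2
      cases d₁ <;> cases d₂
      · exact hne rfl
      · exact hOAB _ (hpO 0 le_rfl) z₂ hz₂ z₁ hz₁ h2 h1
      · exact hOAB _ (hpO 0 le_rfl) z₁ hz₁ z₂ hz₂ h1 h2
      · exact hne rfl
    have honly := honly hk
    have hpA : ∀ i ≤ k, p i ∉ A := fun i hi => (hpO i hi).2.2.1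
    have hpB : ∀ i ≤ k, p i ∉ B := fun i hi => (hpO i hi).2.2.2
    cases d₁ <;> cases d₂
    · exact hne rfl
    · obtain ⟨D, hD, h1, h2, h3⟩ := h.symm.exists_primeBip hG hk hch hpB hpA
        (fun i hi z hz hadj => by simpa using honly i hi false ⟨z, hz, hadj⟩)
        (fun i hi z hz hadj => by simpa using honly i hi true ⟨z, hz, hadj⟩)
        h01 (hOB _ (hpO 0 (by omega))) hk2 (hOA _ (hpO k le_rfl)) hb ha
      exact hfin D hD h2 h1 (by rwa [Set.union_comm A B])
    · obtain ⟨D, hD, h1, h2, h3⟩ := h.exists_primeBip hG hk hch hpA hpB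
        (fun i hi z hz hadj => by simpa using honly i hi true ⟨z, hz, hadj⟩)
        (fun i hi z hz hadj => by simpa using honly i hi false ⟨z, hz, hadj⟩)
        h01 (hOA _ (hpO 0 (by omega))) hk2 (hOB _ (hpO k le_rfl)) ha hb
      exact hfin D hD h1 h2 h3
    · exact hne rfl
  have hab : a ≠ b := (h.adj a ha b hb).ne
  -- outer vertices get the label of the side that their component sees
  let lab : V → V := fun v =>
    if v ∈ A ∨ v ∈ O ∧ ∃ o, Reach G O v o ∧ ∃ x ∈ A, G.Adj o x then a else b
  have hlA : ∀ v ∈ A, lab v = a := fun v hv => if_pos (Or.inl hv)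
  have hlB : ∀ v ∈ B, lab v = b := by
    intro v hv
    refine if_neg ?_
    rintro (h1 | h1)
    · exact (h.adj v h1 v hv).ne rfl
    · exact h1.1.2.2.2 hv
  have hmemO : ∀ v o, v ∈ O → Reach G O v o → o ∈ O := by
    intro v o hv hr
    rcases hr.cases_tail with rfl | ⟨_, -, h4⟩
    · exact hv
    · exact h4.2
  have hlO : ∀ v ∈ O, ∀ v' ∈ W, v' ∉ U → G.Adj v v' → lab v = lab v' := by
    intro v hv v' hv' hvU' hadj
    by_cases h1 : v' ∈ A
    · rw [hlA v' h1]
      exact if_pos (Or.inr ⟨hv, v, .refl, v', h1, hadj⟩)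
    by_cases h2 : v' ∈ B
    · rw [hlB v' h2]
      refine if_neg ?_
      rintro (h3 | ⟨-, o, h4, x, hx, hox⟩)
      · exact hv.2.2.1 h3
      · exact hear o (hmemO v o hv h4) v (Reach.symm h4 hv) x hx v' h2 hox hadj
    · have hv'O : v' ∈ O := ⟨hv', hvU', h1, h2⟩
      have hiff : (v ∈ A ∨ v ∈ O ∧ ∃ o, Reach G O v o ∧ ∃ x ∈ A, G.Adj o x) ↔
          (v' ∈ A ∨ v' ∈ O ∧ ∃ o, Reach G O v' o ∧ ∃ x ∈ A, G.Adj o x) := by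
        constructor
        · rintro (h3 | ⟨-, o, h4, h5⟩)
          · exact absurd h3 hv.2.2.1
          · exact Or.inr ⟨hv'O, o, (Reach.of_adj hadj.symm hv).trans h4, h5⟩
        · rintro (h3 | ⟨-, o, h4, h5⟩)
          · exact absurd h3 h1
          · exact Or.inr ⟨hv, o, (Reach.of_adj hadj hv'O).trans h4, h5⟩
      simp only [lab, hiff]
  refine ⟨U, A ∪ B, lab, fun i j => i = a ∧ j = b ∨ i = b ∧ j = a, fun i => decide (i = a), ?_⟩
  constructor
  · rintro u ⟨-, h1, h2⟩ z (hz | hz)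
    · exact h1 z hz
    · exact h2 z hz
  · exact Set.union_subset hAW hBW
  · rintro i j (⟨rfl, rfl⟩ | ⟨rfl, rfl⟩)
    · exact Or.inr ⟨rfl, rfl⟩
    · exact Or.inl ⟨rfl, rfl⟩
  · rintro i j (⟨rfl, rfl⟩ | ⟨rfl, rfl⟩)
    · simp [hab.symm]
    · simp [hab.symm]
  · rintro z (hz | hz) z' (hz' | hz') hne
    · exact absurd ((hlA z hz).trans (hlA z' hz').symm) hne
    · rw [hlA z hz, hlB z' hz']
      simp [h.adj z hz z' hz']
    · rw [hlB z hz, hlA z' hz']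
      simp [(h.adj z' hz' z hz).symm]
    · exact absurd ((hlB z hz).trans (hlB z' hz').symm) hne
  · intro v hv v' hv' hvU hvU' hadj hne
    by_contra hvZ
    exact hne (hlO v ⟨hv, hvU, fun h => hvZ (Or.inl h), fun h => hvZ (Or.inr h)⟩ v' hv' hvU' hadj)
  · exact Or.inl ha
  · exact Or.inr hb
  · rw [hlA a ha, hlB b hb]
    exact hab
  · intro i
    by_cases hi : i = a
    · obtain ⟨z, hz, z', hz', hne, hadj⟩ := h.symm.exists_not_adj
      exact ⟨z, Or.inr hz, z', Or.inr hz', hne, by rw [hlB z hz, hi]; exact hab.symm,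
        by rw [hlB z' hz', hi]; exact hab.symm, hadj⟩
    · obtain ⟨z, hz, z', hz', hne, hadj⟩ := h.exists_not_adj
      exact ⟨z, Or.inl hz, z', Or.inl hz', hne, by rw [hlA z hz]; exact Ne.symm hi,
        by rw [hlA z' hz']; exact Ne.symm hi, hadj⟩

end IsCoPair

/-- Every edge of a hole inside a finite vertex set has a core. -/
theorem Closed.exists_core (hG : IsMeyniel G) {W : Set V} (hW : W.Finite) {k : ℕ} {p : ℕ → V}
    (hp : Closed G k p) (hk : 3 ≤ k) (hpW : ∀ i ≤ k, p i ∈ W) :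
    ∃ U Z lab R col, Core G W (p k) (p 0) U Z lab R col := by
  have hab : G.Adj (p k) (p 0) := ((hp.adj 0 k (by omega) le_rfl).2 (Or.inr ⟨rfl, rfl⟩)).symm
  by_cases hex : ∃ D ⊆ W, PrimeBip G D ∧ p k ∈ D ∧ p 0 ∈ D
  · obtain ⟨D₀, hD₀W, hD₀, ha, hb⟩ := hex
    obtain ⟨D, ⟨hDW, hD, hDs⟩, hmax⟩ := Set.exists_max_image
      {D | D ⊆ W ∧ PrimeBip G D ∧ Spread G D (p k) (p 0)} (fun D => D.ncard)
      (hW.finite_subsets.subset fun D hD => hD.1)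
      ⟨D₀, hD₀W, hD₀, hD₀.spread (IsTwin.refl ha) (IsTwin.refl hb) hab⟩
    exact IsMaxPrime.exists_core hG ⟨hW, hDW, hD, hDs, fun E h1 h2 h3 => hmax E ⟨h1, h2, h3⟩⟩
      (hpW k le_rfl) (hpW 0 (by omega)) hab
  · have hno : ∀ D ⊆ W, PrimeBip G D → p k ∈ D → p 0 ∉ D := fun D h1 h2 h3 h4 =>
      hex ⟨D, h1, h2, h3, h4⟩
    have hk3 : k = 3 := by
      by_contra hk3
      obtain ⟨m, hm⟩ := hp.odd hG hk
      have h5 := hp.primeBip hG (by omega)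
      exact hno _ (by rintro z ⟨i, hi, rfl⟩; exact hpW i hi) h5 ⟨k, le_rfl, rfl⟩
        ⟨0, by omega, rfl⟩
    subst hk3
    have h01 : G.Adj (p 0) (p 1) := (hp.adj 0 1 (by omega) (by omega)).2 (by omega)
    have h12 : G.Adj (p 1) (p 2) := (hp.adj 1 2 (by omega) (by omega)).2 (by omega)
    have h23 : G.Adj (p 2) (p 3) := (hp.adj 2 3 (by omega) (by omega)).2 (by omega)
    have h02 : ¬ G.Adj (p 0) (p 2) := by rw [hp.adj 0 2 (by omega) (by omega)]; omega
    have h13 : ¬ G.Adj (p 1) (p 3) := by rw [hp.adj 1 3 (by omega) (by omega)]; omega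
    refine IsCoPair.exists_core hG hW hno (A₀ := {p 1, p 3}) (B₀ := {p 0, p 2}) ⟨?_,
      CoConn.pair h13, CoConn.pair h02, Set.nontrivial_pair (hp.ne 1 3 (by omega) (by omega)),
      Set.nontrivial_pair (hp.ne 0 2 (by omega) (by omega))⟩ ?_ ?_ (by simp) (by simp)
    · rintro x (rfl | rfl) y (rfl | rfl)
      · exact h01.symm
      · exact h12
      · exact hab
      · exact h23.symm
    · rintro x (rfl | rfl) <;> exact hpW _ (by omega)
    · rintro x (rfl | rfl) <;> exact hpW _ (by omega)

end

/-! ### Lifting vertices of the co-contracted graph to cliques -/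

section

variable {V κ : Type*} {G : SimpleGraph V} {K : SimpleGraph κ} {I : Set κ} {N : κ → Prop}
  {E : κ → Set V}

/-- Each vertex `i ∈ I` of `K` is represented by a clique `E i` of `G`, a single vertex if `N i`
holds (`i` is not contracted), so that adjacency of `i` and `j` in `K` means that `E i` and `E j`
are complete to each other, as far as at least one of `i` and `j` is not contracted. -/
structure Expansion (G : SimpleGraph V) (K : SimpleGraph κ) (I : Set κ) (N : κ → Prop)
    (E : κ → Set V) : Prop where
  finite : (⋃ i ∈ I, E i).Finite
  nonempty : ∀ i ∈ I, N i → (E i).Nonempty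
  subsingleton : ∀ i, N i → (E i).Subsingleton
  clique : ∀ i ∈ I, ∀ x ∈ E i, ∀ y ∈ E i, x ≠ y → G.Adj x y
  adj : ∀ i ∈ I, ∀ j ∈ I, K.Adj i j → ∀ x ∈ E i, ∀ y ∈ E j, G.Adj x y
  exists_not_adj : ∀ i ∈ I, ∀ j ∈ I, N i → i ≠ j → ¬ K.Adj i j → ∃ x ∈ E i, ∃ y ∈ E j, ¬ G.Adj x y
  not_adj : ∀ i j, ¬ N i → ¬ N j → ¬ K.Adj i j
  disjoint : ∀ i ∈ I, ∀ j ∈ I, N i → i ≠ j → ∀ x ∈ E i, x ∉ E j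

/-- For a contracted clique it suffices to keep one non-neighbour of each uncontracted vertex of
`I` that is not adjacent to it in the co-contracted graph. -/
theorem exists_expansion {Q : Set (Set V)} (hQ : IsPreCoColoring G Q)
    {I : Set ({x : V // x ∉ ⋃₀ Q} ⊕ {C : Set V // C ∈ Q})} (hI : I.Finite) :
    ∃ E, Expansion G (coContraction G Q) I (fun i => i.isLeft = true) E := by
  classical
  have hwit : ∀ (x : {x : V // x ∉ ⋃₀ Q}) (C : {C : Set V // C ∈ Q}), ∃ q,
      ¬ (coContraction G Q).Adj (.inl x) (.inr C) → q ∈ C.1 ∧ ¬ G.Adj x.1 q := by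
    intro x C
    by_cases h : (coContraction G Q).Adj (.inl x) (.inr C)
    · exact ⟨x.1, fun h' => absurd h h'⟩
    · have h' : ¬ ∀ q ∈ C.1, G.Adj x.1 q := h
      push Not at h'
      obtain ⟨q, hq⟩ := h'
      exact ⟨q, fun _ => hq⟩
  choose w hw using hwit
  let E : ({x : V // x ∉ ⋃₀ Q} ⊕ {C : Set V // C ∈ Q}) → Set V := fun i => match i with
    | .inl x => {x.1}
    | .inr C => {q | ∃ x, .inl x ∈ I ∧ ¬ (coContraction G Q).Adj (.inl x) (.inr C) ∧ q = w x C}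
  have hEC : ∀ C, E (.inr C) ⊆ C.1 := by
    rintro C _ ⟨x, -, hx, rfl⟩
    exact (hw x C hx).1
  refine ⟨E, ⟨?_, ?_, ?_, ?_, ?_, ?_, ?_, ?_⟩⟩
  · refine hI.biUnion ?_
    rintro (x | C) -
    · exact Set.finite_singleton _
    · refine (Set.Finite.image (fun x => w x C)
        (hI.preimage (f := Sum.inl) Sum.inl_injective.injOn)).subset ?_
      rintro _ ⟨x, hx, -, rfl⟩
      exact ⟨x, hx, rfl⟩
  · rintro (x | C) - h
    · exact ⟨x.1, rfl⟩
    · simp at h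
  · rintro (x | C) h
    · exact Set.subsingleton_singleton
    · simp at h
  · rintro (x | C) - y hy z hz hne
    · exact absurd (hy.trans hz.symm) hne
    · exact hQ.1 C.1 C.2 (hEC C hy) (hEC C hz) hne
  · rintro (x | C) hi (y | D) hj hadj u hu v hv
    · obtain rfl : u = x.1 := hu
      obtain rfl : v = y.1 := hv
      exact hadj
    · obtain rfl : u = x.1 := hu
      exact hadj v (hEC D hv)
    · obtain rfl : v = y.1 := hv
      exact (hadj u (hEC C hu)).symm
    · exact absurd hadj id
  · rintro (x | C) hi (y | D) hj hN hne hadj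
    · exact ⟨x.1, rfl, y.1, rfl, hadj⟩
    · exact ⟨x.1, rfl, w x D, ⟨x, hi, hadj, rfl⟩, (hw x D hadj).2⟩
    · simp at hN
    · simp at hN
  · rintro (x | C) (y | D) h1 h2 hadj
    · simp at h1
    · simp at h1
    · simp at h2
    · exact hadj
  · rintro (x | C) hi (y | D) hj hN hne u hu hv
    · obtain rfl : u = x.1 := hu
      exact hne (by rw [Subtype.ext (show x.1 = y.1 from hv)])
    · obtain rfl : u = x.1 := hu
      exact x.2 ⟨D.1, D.2, hEC D hv⟩
    · simp at hN
    · simp at hN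

/-- An expansion together with a core of the edge that represents the edge `ab` of `K`. -/
structure Frame (G : SimpleGraph V) (K : SimpleGraph κ) (I : Set κ) (N : κ → Prop) (E : κ → Set V)
    (a b : κ) (α β : V) (U Z : Set V) (lab : V → V) (R : V → V → Prop) (col : V → Bool) : Prop
    extends Expansion G K I N E where
  core : Core G (⋃ i ∈ I, E i) α β U Z lab R col
  mem_a : a ∈ I
  mem_b : b ∈ I
  single_a : N a
  single_b : N b
  adj_ab : K.Adj a b
  mem_Ea : α ∈ E a
  mem_Eb : β ∈ E b

/-- An edge `ab` of `K` has a frame if it lies on a cycle of `K` no other vertex of which is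
adjacent to both `a` and `b`. -/
theorem Expansion.exists_frame (hG : IsMeyniel G) (X : Expansion G K I N E) {a b : κ} (ha : N a)
    (hb : N b) (hab : K.Adj a b) {m : ℕ} {g : ℕ → κ} (hgI : ∀ i ≤ m, g i ∈ I) (hg0 : g 0 = b)
    (hgm : g m = a) (hm : 2 ≤ m) (hg : ∀ i, i < m → K.Adj (g i) (g (i + 1)))
    (hgab : ∀ i, 0 < i → i < m → g i ≠ a ∧ g i ≠ b ∧ ¬ (K.Adj (g i) a ∧ K.Adj (g i) b)) :
    ∃ α β U Z lab R col, Frame G K I N E a b α β U Z lab R col := by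
  have haI : a ∈ I := hgm ▸ hgI m le_rfl
  have hbI : b ∈ I := hg0 ▸ hgI 0 (by omega)
  obtain ⟨α, hα⟩ := X.nonempty a haI ha
  obtain ⟨β, hβ⟩ := X.nonempty b hbI hb
  have hαβ : G.Adj α β := X.adj a haI b hbI hab α hα β hβ
  let S : Set V := {x | x ∈ (⋃ i ∈ I, E i) ∧ x ≠ α ∧ x ≠ β ∧ ¬ (G.Adj x α ∧ G.Adj x β)}
  have hpick : ∀ i, 0 < i → i < m → ∃ x ∈ E (g i), x ∈ S := by
    intro i hi him
    obtain ⟨h1, h2, h3⟩ := hgab i hi him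
    have hiI := hgI i him.le
    have hkey : ∀ c γ, c ∈ I → N c → γ ∈ E c → g i ≠ c → ¬ K.Adj (g i) c →
        ∃ x ∈ E (g i), ¬ G.Adj x γ := by
      intro c γ hc hNc hγ hne hadj
      obtain ⟨y, hy, x, hx, hyx⟩ := X.exists_not_adj c hc (g i) hiI hNc hne.symm
        fun h => hadj h.symm
      rw [X.subsingleton c hNc hy hγ] at hyx
      exact ⟨x, hx, fun h => hyx h.symm⟩
    have hx : ∃ x ∈ E (g i), ¬ (G.Adj x α ∧ G.Adj x β) := by
      by_cases hc : K.Adj (g i) a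
      · obtain ⟨x, hx, h⟩ := hkey b β hbI hb hβ h2 fun h => h3 ⟨hc, h⟩
        exact ⟨x, hx, fun h' => h h'.2⟩
      · obtain ⟨x, hx, h⟩ := hkey a α haI ha hα h1 hc
        exact ⟨x, hx, fun h' => h h'.1⟩
    obtain ⟨x, hx, h⟩ := hx
    refine ⟨x, hx, Set.mem_biUnion hiI hx, ?_, ?_, h⟩
    · rintro rfl
      exact X.disjoint a haI (g i) hiI ha h1.symm x hα hx
    · rintro rfl
      exact X.disjoint b hbI (g i) hiI hb h2.symm x hβ hx
  have hchain : ∀ i, 0 < i → i < m → ∃ x ∈ E (g i), x ∈ S ∧ Reach G S β x := by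
    intro i hi
    induction i, hi using Nat.le_induction with
    | base =>
      intro h1m
      obtain ⟨x, hx, hxS⟩ := hpick 1 (by omega) h1m
      exact ⟨x, hx, hxS, Reach.of_adj (X.adj b hbI (g 1) (hgI 1 (by omega))
        (hg0 ▸ hg 0 (by omega)) β hβ x hx) hxS⟩
    | succ i hi ih =>
      intro him
      obtain ⟨x, hx, -, hr⟩ := ih (by omega)
      obtain ⟨y, hy, hyS⟩ := hpick (i + 1) (by omega) him
      exact ⟨y, hy, hyS, hr.tail ⟨X.adj _ (hgI i (by omega)) _ (hgI _ him.le) (hg i (by omega))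
        x hx y hy, hyS⟩⟩
  obtain ⟨x, hx, hxS, hr⟩ := hchain (m - 1) (by omega) (by omega)
  have hxα : G.Adj x α := X.adj _ (hgI (m - 1) (by omega)) a haI (by
    have := hg (m - 1) (by omega)
    rwa [show m - 1 + 1 = m by omega, hgm] at this) x hx α hα
  obtain ⟨k, p, hp, hcl, -⟩ := hr.exists_chordless (fun h => h.2.2.1 rfl) (fun h => h.2.1 rfl)
    hxS hxα hαβ.ne'
  obtain ⟨h2, hcl⟩ := hcl hαβ.symm
  have hk : k ≠ 2 := by
    rintro rfl
    have h1 := hp.mem 1 (by omega) (by omega)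
    have e1 := hp.adj 0 (by omega)
    have e2 := hp.adj 1 (by omega)
    rw [hp.zero] at e1
    rw [show 1 + 1 = 2 from rfl, hp.last] at e2
    exact h1.2.2.2 ⟨e2, e1.symm⟩
  obtain ⟨U, Z, lab, R, col, hcore⟩ := hcl.exists_core hG X.finite (by omega) (by
    intro i hi
    rcases Nat.eq_zero_or_pos i with rfl | h0
    · rw [hp.zero]; exact Set.mem_biUnion hbI hβ
    rcases hi.eq_or_lt with rfl | h1
    · rw [hp.last]; exact Set.mem_biUnion haI hα
    · exact (hp.mem i h0 h1).1)
  rw [hp.zero, hp.last] at hcore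
  exact ⟨α, β, U, Z, lab, R, col, X, hcore, haI, hbI, ha, hb, hab, hα, hβ⟩

theorem Core.symm_ends {W U Z : Set V} {lab : V → V} {R : V → V → Prop} {col : V → Bool} {α β : V}
    (h : Core G W α β U Z lab R col) : Core G W β α U Z lab R col :=
  ⟨h.complete, h.sub, h.symm, h.col_ne, h.adj_iff, h.boundary, h.mem_right, h.mem_left,
    h.lab_ne.symm, h.exists_not_adj⟩

namespace Frame

variable {a b : κ} {α β : V} {U Z : Set V} {lab : V → V} {R : V → V → Prop} {col : V → Bool}

theorem swap (F : Frame G K I N E a b α β U Z lab R col) :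
    Frame G K I N E b a β α U Z lab R col :=
  ⟨F.toExpansion, F.core.symm_ends, F.mem_b, F.mem_a, F.single_b, F.single_a, F.adj_ab.symm,
    F.mem_Eb, F.mem_Ea⟩

theorem not_mem_U (F : Frame G K I N E a b α β U Z lab R col) {z : V} (hz : z ∈ Z) : z ∉ U :=
  fun h => (F.core.complete z h z hz).ne rfl

theorem not_R_triangle (F : Frame G K I N E a b α β U Z lab R col) {i j k : V} (h1 : R i j)
    (h2 : R i k) : ¬ R j k := by
  intro h3
  have e1 := F.core.col_ne i j h1
  have e2 := F.core.col_ne i k h2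
  have e3 := F.core.col_ne j k h3
  revert e1 e2 e3
  cases col i <;> cases col j <;> cases col k <;> simp

/-- Some vertex of the clique of `i` lies outside `U`. -/
def Visible (E : κ → Set V) (U : Set V) (i : κ) : Prop := ∃ x ∈ E i, x ∉ U

/-- The clique of `i` has vertices of different labels outside `U`. -/
def Amb (E : κ → Set V) (U : Set V) (lab : V → V) (i : κ) : Prop :=
  ∃ x ∈ E i, ∃ y ∈ E i, x ∉ U ∧ y ∉ U ∧ lab x ≠ lab y

/-- All vertices of the clique of `i` outside `U` lie in `Z` and have label `d`. -/
def Pure (E : κ → Set V) (U Z : Set V) (lab : V → V) (i : κ) (d : V) : Prop :=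
  ∀ x ∈ E i, x ∉ U → x ∈ Z ∧ lab x = d

/-- All neighbours of `i` show the same label, if `i` is ambiguous. -/
def Agree (K : SimpleGraph κ) (I : Set κ) (E : κ → Set V) (U : Set V) (lab : V → V) (i : κ) :
    Prop :=
  Amb E U lab i → ∀ j ∈ I, ∀ j' ∈ I, K.Adj i j → K.Adj i j' → ∀ x ∈ E j, ∀ x' ∈ E j', x ∉ U →
    x' ∉ U → lab x = lab x'

/-- `d` is the label of `i`: the label shown by its clique, or by its neighbours if its clique
shows several. -/
def HasLabel (K : SimpleGraph κ) (I : Set κ) (E : κ → Set V) (U : Set V) (lab : V → V) (i : κ)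
    (d : V) : Prop :=
  ¬ Amb E U lab i ∧ (∃ x ∈ E i, x ∉ U ∧ lab x = d) ∨
    Amb E U lab i ∧ ∃ j ∈ I, K.Adj i j ∧ ∃ x ∈ E j, x ∉ U ∧ lab x = d

theorem HasLabel.lab_eq {i : κ} {d x : V} (h : HasLabel K I E U lab i d) (hi : ¬ Amb E U lab i)
    (hx : x ∈ E i) (hxU : x ∉ U) : lab x = d := by
  rcases h with ⟨-, y, hy, hyU, rfl⟩ | ⟨h, -⟩
  · by_contra hne
    exact hi ⟨x, hx, y, hy, hxU, hyU, hne⟩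
  · exact absurd h hi

theorem visible_a (F : Frame G K I N E a b α β U Z lab R col) : Visible E U a :=
  ⟨α, F.mem_Ea, F.not_mem_U F.core.mem_left⟩

theorem visible_of_not_adj (F : Frame G K I N E a b α β U Z lab R col)
    {i : κ} (hi : i ∈ I) (hia : i ≠ a) (h : ¬ K.Adj i a) :
    Visible E U i := by
  obtain ⟨y, hy, x, hx, hyx⟩ := F.exists_not_adj a F.mem_a i hi F.single_a hia.symm
    fun h' => h h'.symm
  rw [F.subsingleton a F.single_a hy F.mem_Ea] at hyx
  exact ⟨x, hx, fun hxU => hyx (F.core.complete x hxU α F.core.mem_left).symm⟩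

theorem not_amb (F : Frame G K I N E a b α β U Z lab R col)
    {i : κ} (hi : N i) : ¬ Amb E U lab i := by
  rintro ⟨x, hx, y, hy, -, -, hne⟩
  exact hne (by rw [F.subsingleton i hi hx hy])

theorem mem_of_adj (F : Frame G K I N E a b α β U Z lab R col)
    {i j : κ} (hi : i ∈ I) (hj : j ∈ I) (hij : K.Adj i j) {x y : V} (hx : x ∈ E i)
    (hy : y ∈ E j) (hxU : x ∉ U) (hyU : y ∉ U) (hne : lab x ≠ lab y) :
    x ∈ Z ∧ y ∈ Z ∧ R (lab x) (lab y) := by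
  have hadj := F.adj i hi j hj hij x hx y hy
  have h1 := F.core.boundary x (Set.mem_biUnion hi hx) y (Set.mem_biUnion hj hy) hxU hyU hadj hne
  have h2 := F.core.boundary y (Set.mem_biUnion hj hy) x (Set.mem_biUnion hi hx) hyU hxU hadj.symm
    hne.symm
  exact ⟨h1, h2, (F.core.adj_iff x h1 y h2 hne).1 hadj⟩

/-- The neighbours of an ambiguous vertex lie in `Z`, and carry one of two labels. -/
theorem amb_adj (F : Frame G K I N E a b α β U Z lab R col)
    {i : κ} (hi : i ∈ I) (h : Amb E U lab i) : ∃ d d', R d d' ∧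
    ∀ j ∈ I, K.Adj i j → ∀ x ∈ E j, x ∉ U → x ∈ Z ∧ (lab x = d ∨ lab x = d') := by
  obtain ⟨q, hq, q', hq', hqU, hqU', hne⟩ := h
  have hadj := F.clique i hi q hq q' hq' (by rintro rfl; exact hne rfl)
  have hqW := Set.mem_biUnion (t := E) hi hq
  have hqW' := Set.mem_biUnion (t := E) hi hq'
  have h1 := F.core.boundary q hqW q' hqW' hqU hqU' hadj hne
  have h2 := F.core.boundary q' hqW' q hqW hqU' hqU hadj.symm hne.symm
  have hR := (F.core.adj_iff q h1 q' h2 hne).1 hadj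
  refine ⟨lab q, lab q', hR, fun j hj hij x hx hxU => ?_⟩
  by_cases e1 : lab x = lab q
  · obtain ⟨h3, -, -⟩ := F.mem_of_adj hj hi hij.symm hx hq' hxU hqU' (e1 ▸ hne)
    exact ⟨h3, Or.inl e1⟩
  · obtain ⟨h3, -, h4⟩ := F.mem_of_adj hj hi hij.symm hx hq hxU hqU e1
    refine ⟨h3, Or.inr ?_⟩
    by_contra e2
    obtain ⟨-, -, h5⟩ := F.mem_of_adj hj hi hij.symm hx hq' hxU hqU' e2
    exact F.not_R_triangle h4 h5 hR

/-- If some neighbour of an ambiguous vertex is not adjacent to any other neighbour, then all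
neighbours show the same label. -/
theorem agree_of_visible (F : Frame G K I N E a b α β U Z lab R col)
    {i j : κ} (hi : i ∈ I) (hj : j ∈ I) (hij : K.Adj i j)
    (hv : Visible E U j) (hnon : ∀ j' ∈ I, K.Adj i j' → ¬ K.Adj j j') :
    Agree K I E U lab i := by
  intro h
  obtain ⟨d, d', hR, hnb⟩ := F.amb_adj hi h
  obtain ⟨y, hy, hyU⟩ := hv
  have hNj : ∀ j, K.Adj i j → N j := by
    intro j hij
    by_contra hj
    exact F.not_adj i j (fun hi => F.not_amb hi h) hj hij
  have key : ∀ j' ∈ I, K.Adj i j' → ∀ x ∈ E j', x ∉ U → lab x = lab y := by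
    intro j' hj' hij' x hx hxU
    by_contra hne
    obtain ⟨hxZ, hxd⟩ := hnb j' hj' hij' x hx hxU
    obtain ⟨hyZ, hyd⟩ := hnb j hj hij y hy hyU
    have hxy : R (lab y) (lab x) := by
      rcases hxd with e1 | e1 <;> rcases hyd with e2 | e2
      · exact absurd (e1.trans e2.symm) hne
      · rw [e1, e2]; exact F.core.symm _ _ hR
      · rw [e1, e2]; exact hR
      · exact absurd (e1.trans e2.symm) hne
    have hadj := (F.core.adj_iff y hyZ x hxZ (Ne.symm hne)).2 hxy
    have hjj : j ≠ j' := by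
      rintro rfl
      rw [F.subsingleton j (hNj j hij) hx hy] at hne
      exact hne rfl
    obtain ⟨y', hy', x', hx', h'⟩ := F.exists_not_adj j hj j' hj' (hNj j hij) hjj
      (hnon j' hj' hij')
    rw [F.subsingleton j (hNj j hij) hy' hy, F.subsingleton j' (hNj j' hij') hx' hx] at h'
    exact h' hadj
  intro j₁ h₁ j₂ h₂ h₁' h₂' x hx x' hx' hxU hxU'
  rw [key j₁ h₁ h₁' x hx hxU, key j₂ h₂ h₂' x' hx' hxU']

/-- Every visible vertex has a label, and one can be chosen for each. -/
theorem exists_labels (α : V) (hvis : ∀ i ∈ I, Visible E U i → Amb E U lab i →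
    ∃ j ∈ I, K.Adj i j ∧ Visible E U j) :
    ∃ ψ : κ → V, ∀ i ∈ I, Visible E U i → HasLabel K I E U lab i (ψ i) := by
  have : ∀ i, ∃ d, i ∈ I → Visible E U i → HasLabel K I E U lab i d := by
    intro i
    by_cases hi : i ∈ I ∧ Visible E U i
    · by_cases ha : Amb E U lab i
      · obtain ⟨j, hj, hij, x, hx, hxU⟩ := hvis i hi.1 hi.2 ha
        exact ⟨lab x, fun _ _ => Or.inr ⟨ha, j, hj, hij, x, hx, hxU, rfl⟩⟩
      · obtain ⟨-, x, hx, hxU⟩ := hi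
        exact ⟨lab x, fun _ _ => Or.inl ⟨ha, x, hx, hxU, rfl⟩⟩
    · exact ⟨α, fun h1 h2 => absurd ⟨h1, h2⟩ hi⟩
  choose ψ hψ using this
  exact ⟨ψ, hψ⟩

/-- Adjacent vertices with different labels lie in `Z`, and their labels are related. -/
theorem pure_of_ne (F : Frame G K I N E a b α β U Z lab R col)
    {i j : κ} {d d' : V} (hi : i ∈ I) (hj : j ∈ I) (hij : K.Adj i j)
    (hai : Agree K I E U lab i) (haj : Agree K I E U lab j) (hid : HasLabel K I E U lab i d)
    (hjd : HasLabel K I E U lab j d') (hne : d ≠ d') :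
    Pure E U Z lab i d ∧ Pure E U Z lab j d' ∧ R d d' ∧ ¬ Amb E U lab i ∧ ¬ Amb E U lab j := by
  have hone : ∀ {i j : κ} {d d' : V}, j ∈ I → K.Adj i j → Agree K I E U lab i →
      HasLabel K I E U lab i d → HasLabel K I E U lab j d' → d ≠ d' → ¬ Amb E U lab i := by
    intro i j d d' hj hij hai hid hjd hne h
    have hNi : ¬ N i := fun hN => F.not_amb hN h
    have hNj : N j := by
      by_contra hN
      exact F.not_adj i j hNi hN hij
    rcases hid with ⟨h', -⟩ | ⟨-, j', hj', hij', x, hx, hxU, rfl⟩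
    · exact h' h
    rcases hjd with ⟨-, y, hy, hyU, rfl⟩ | ⟨h', -⟩
    · exact hne (hai h j' hj' j hj hij' hij x hx y hy hxU hyU)
    · exact F.not_amb hNj h'
  have h1 := hone hj hij hai hid hjd hne
  have h2 := hone hi hij.symm haj hjd hid hne.symm
  obtain ⟨x, hx, hxU, hxd⟩ : ∃ x ∈ E i, x ∉ U ∧ lab x = d := by
    rcases hid with ⟨-, h⟩ | ⟨h, -⟩
    · exact h
    · exact absurd h h1
  obtain ⟨y, hy, hyU, hyd⟩ : ∃ x ∈ E j, x ∉ U ∧ lab x = d' := by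
    rcases hjd with ⟨-, h⟩ | ⟨h, -⟩
    · exact h
    · exact absurd h h2
  refine ⟨fun x' hx' hxU' => ?_, fun y' hy' hyU' => ?_, ?_, h1, h2⟩
  · have e := hid.lab_eq h1 hx' hxU'
    exact ⟨(F.mem_of_adj hi hj hij hx' hy hxU' hyU (by rwa [e, hyd])).1, e⟩
  · have e := hjd.lab_eq h2 hy' hyU'
    exact ⟨(F.mem_of_adj hi hj hij hx hy' hxU hyU' (by rwa [e, hxd])).2.1, e⟩
  · rw [← hxd, ← hyd]
    exact (F.mem_of_adj hi hj hij hx hy hxU hyU (by rwa [hxd, hyd])).2.2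

/-- Vertices whose cliques show single, related labels are adjacent, if one of them is not
contracted: no pair of representatives could witness the missing edge. -/
theorem adj_of_pure (F : Frame G K I N E a b α β U Z lab R col)
    {i j : κ} {d d' : V} (hi : i ∈ I) (hj : j ∈ I) (hN : N i) (hij : i ≠ j)
    (hv : Visible E U i) (hid : Pure E U Z lab i d) (hjd : Pure E U Z lab j d') (hR : R d d') :
    K.Adj i j := by
  by_contra hadj
  obtain ⟨x, hx, y, hy, hxy⟩ := F.exists_not_adj i hi j hj hN hij hadj
  obtain ⟨x', hx', hxU⟩ := hv
  rw [F.subsingleton i hN hx' hx] at hxU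
  obtain ⟨hxZ, hxd⟩ := hid x hx hxU
  by_cases hyU : y ∈ U
  · exact hxy (F.core.complete y hyU x hxZ).symm
  · obtain ⟨hyZ, hyd⟩ := hjd y hy hyU
    have hne : d ≠ d' := by
      rintro rfl
      exact F.core.col_ne _ _ hR rfl
    exact hxy ((F.core.adj_iff x hxZ y hyZ (by rwa [hxd, hyd])).2 (by rwa [hxd, hyd]))

/-- An ambiguous vertex is contracted, so its neighbours are not; they show its label. -/
theorem pure_of_amb (F : Frame G K I N E a b α β U Z lab R col)
    {i j : κ} {d : V} (hi : i ∈ I) (hj : j ∈ I) (hij : K.Adj i j)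
    (hai : Agree K I E U lab i) (h : Amb E U lab i) (hid : HasLabel K I E U lab i d) :
    N j ∧ Pure E U Z lab j d := by
  constructor
  · by_contra hN
    exact F.not_adj i j (fun hN => F.not_amb hN h) hN hij
  · obtain ⟨_, _, -, hnb⟩ := F.amb_adj hi h
    rcases hid with ⟨h', -⟩ | ⟨-, j', hj', hij', y, hy, hyU, rfl⟩
    · exact absurd h h'
    · exact fun x hx hxU => ⟨(hnb j hj hij x hx hxU).1,
        hai h j hj j' hj' hij hij' x hx y hy hxU hyU⟩

theorem pure_a (F : Frame G K I N E a b α β U Z lab R col) : Pure E U Z lab a (lab α) := by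
  intro x hx _
  rw [F.subsingleton a F.single_a hx F.mem_Ea]
  exact ⟨F.core.mem_left, rfl⟩

theorem label_a (F : Frame G K I N E a b α β U Z lab R col)
    {d : V} (h : HasLabel K I E U lab a d) : d = lab α :=
  (h.lab_eq (F.not_amb F.single_a) F.mem_Ea (F.not_mem_U F.core.mem_left)).symm

theorem R_ab (F : Frame G K I N E a b α β U Z lab R col) : R (lab α) (lab β) :=
  (F.core.adj_iff α F.core.mem_left β F.core.mem_right F.core.lab_ne).1
    (F.adj a F.mem_a b F.mem_b F.adj_ab α F.mem_Ea β F.mem_Eb)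

/-- It is impossible that all visible vertices but `y` show the label `d`: the vertices of `Z` with
another label would then lie in the clique of `y`, but two of them are not adjacent. -/
theorem not_all_label (F : Frame G K I N E a b α β U Z lab R col) {y : κ} {d : V} (hy : y ∈ I)
    (h : ∀ i ∈ I, i ≠ y → Visible E U i → ¬ Amb E U lab i ∧ HasLabel K I E U lab i d) : False := by
  obtain ⟨z, hz, z', hz', hne, hzd, hzd', hadj⟩ := F.core.exists_not_adj d
  have key : ∀ z ∈ Z, lab z ≠ d → z ∈ E y := by
    intro z hz hzd
    obtain ⟨i, hi, hzi⟩ := Set.mem_iUnion₂.1 (F.core.sub hz)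
    by_cases hiy : i = y
    · exact hiy ▸ hzi
    · have hzU := F.not_mem_U hz
      obtain ⟨h1, h2⟩ := h i hi hiy ⟨z, hzi, hzU⟩
      exact absurd (h2.lab_eq h1 hzi hzU) hzd
  exact hadj (F.clique y hy z (key z hz hzd) z' (key z' hz' hzd') hne)

end Frame

end

/-! ### Odd holes -/

section

variable {V κ : Type*} {G : SimpleGraph V} {K : SimpleGraph κ} {I : Set κ} {N : κ → Prop}
  {E : κ → Set V}

theorem Closed.rotate {k : ℕ} {f : ℕ → κ} (hf : Closed K k f) (s : ℕ) (hs : s ≤ k) :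
    Closed K k (fun i => if i + s ≤ k then f (i + s) else f (i + s - (k + 1))) := by
  constructor
  · intro i j hij hj
    split_ifs
    · exact hf.ne _ _ (by omega) (by omega)
    · exact (hf.ne _ _ (by omega) (by omega)).symm
    · omega
    · exact hf.ne _ _ (by omega) (by omega)
  · intro i j hij hj
    split_ifs
    · rw [hf.adj _ _ (by omega) (by omega)]; omega
    · rw [K.adj_comm, hf.adj _ _ (by omega) (by omega)]; omega
    · omega
    · rw [hf.adj _ _ (by omega) (by omega)]; omega

theorem rotate_range {k : ℕ} (f : ℕ → κ) (s : ℕ) (hs : s ≤ k) :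
    {z | ∃ i ≤ k, (if i + s ≤ k then f (i + s) else f (i + s - (k + 1))) = z} =
      {z | ∃ i ≤ k, f i = z} := by
  ext z
  constructor
  · rintro ⟨i, hi, rfl⟩
    split_ifs
    · exact ⟨i + s, by omega, rfl⟩
    · exact ⟨i + s - (k + 1), by omega, rfl⟩
  · rintro ⟨i, hi, rfl⟩
    by_cases h : s ≤ i
    · exact ⟨i - s, by omega, by rw [if_pos (by omega), Nat.sub_add_cancel h]⟩
    · refine ⟨i + (k + 1) - s, by omega, ?_⟩
      rw [if_neg (by omega)]
      congr 1
      omega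

/-- A cycle can be rotated so that a given edge becomes its closing edge. -/
theorem Closed.exists_rotation {k : ℕ} {f : ℕ → κ} (hf : Closed K k f) {P : κ → κ → Prop}
    (h : (∃ i < k, P (f i) (f (i + 1))) ∨ P (f k) (f 0)) :
    ∃ f', Closed K k f' ∧ {z | ∃ i ≤ k, f' i = z} = {z | ∃ i ≤ k, f i = z} ∧ P (f' k) (f' 0) := by
  rcases h with ⟨i, hi, h⟩ | h
  · refine ⟨_, hf.rotate (i + 1) hi, rotate_range f (i + 1) hi, ?_⟩
    rw [if_neg (by omega), if_pos (by omega), show k + (i + 1) - (k + 1) = i by omega, Nat.zero_add]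
    exact h
  · exact ⟨f, hf, rfl, h⟩

theorem Closed.adj_iff {k : ℕ} {f : ℕ → κ} (hf : Closed K k f) (hk : 1 ≤ k) {i j : ℕ} (hi : i ≤ k)
    (hj : j ≤ k) : K.Adj (f i) (f j) ↔ j = i + 1 ∨ i = j + 1 ∨ i = 0 ∧ j = k ∨ j = 0 ∧ i = k := by
  rcases lt_trichotomy i j with h | rfl | h
  · rw [hf.adj i j h hj]; omega
  · simp; omega
  · rw [K.adj_comm, hf.adj j i h hi]; omega

theorem Closed.inj {k : ℕ} {f : ℕ → κ} (hf : Closed K k f) {i j : ℕ} (hi : i ≤ k) (hj : j ≤ k)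
    (h : f i = f j) : i = j := by
  by_contra hne
  rcases lt_or_gt_of_ne hne with h' | h'
  · exact hf.ne _ _ h' hj h
  · exact hf.ne _ _ h' hi h.symm

/-- A graph with expansions into a Meyniel graph has no odd hole. -/
theorem not_closed_of_expansion (hG : IsMeyniel G) {k : ℕ} {f : ℕ → κ} (hf : Closed K k f)
    (hk : 4 ≤ k) (hodd : Even k) (X : Expansion G K {z | ∃ i ≤ k, f i = z} N E) : False := by
  classical
  -- an edge of the hole with both ends not contracted, which becomes the closing edge
  obtain ⟨f, hf, hI, ha, hb⟩ := hf.exists_rotation (P := fun x y => N x ∧ N y) (by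
    by_contra! hcon
    obtain ⟨h1, h2⟩ := hcon
    have hpar := color_path (k := k) (p := f) (c := fun x => decide (N x)) (by
      intro i hi heq
      have hadj := (hf.adj i (i + 1) (by omega) (by omega)).2 (Or.inl rfl)
      have heq : N (f i) ↔ N (f (i + 1)) := by simpa using heq
      by_cases hN : N (f i)
      · exact h1 i hi hN (heq.1 hN)
      · exact X.not_adj _ _ hN (fun h => hN (heq.2 h)) hadj) k le_rfl
    have hkk : N (f k) ↔ N (f 0) := by simpa using hpar.2 hodd
    have hadj := (hf.adj 0 k (by omega) (by omega)).2 (Or.inr ⟨rfl, rfl⟩)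
    by_cases hN : N (f k)
    · exact h2 hN (hkk.1 hN)
    · exact X.not_adj _ _ (fun h => hN (hkk.2 h)) hN hadj)
  rw [← hI] at X
  clear hI
  have hab : K.Adj (f k) (f 0) := ((hf.adj 0 k (by omega) le_rfl).2 (Or.inr ⟨rfl, rfl⟩)).symm
  obtain ⟨α, β, U, Z, lab, R, col, F⟩ := X.exists_frame hG ha hb hab
    (fun i hi => ⟨i, hi, rfl⟩) rfl rfl (by omega)
    (fun i hi => (hf.adj i (i + 1) (by omega) (by omega)).2 (Or.inl rfl)) (by
      intro i hi hik
      refine ⟨hf.ne _ _ hik le_rfl, (hf.ne _ _ hi hik.le).symm, ?_⟩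
      rw [hf.adj_iff (by omega) hik.le le_rfl, hf.adj_iff (by omega) hik.le (by omega)]
      omega)
  have hvis : ∀ i ≤ k, Frame.Visible E U (f i) := by
    intro i hi
    by_cases h0 : i = 0
    · rw [h0]; exact F.swap.visible_a
    by_cases hk' : i = k
    · rw [hk']; exact F.visible_a
    by_cases h1 : K.Adj (f i) (f k)
    · refine F.swap.visible_of_not_adj ⟨i, hi, rfl⟩ (hf.ne 0 i (by omega) hi).symm ?_
      rw [hf.adj_iff (by omega) hi le_rfl] at h1
      rw [hf.adj_iff (by omega) hi (by omega)]
      omega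
    · exact F.visible_of_not_adj ⟨i, hi, rfl⟩ (hf.ne i k (by omega) le_rfl) h1
  set I : Set κ := {z | ∃ i ≤ k, f i = z} with hI
  have hvisI : ∀ i ∈ I, Frame.Visible E U i := by
    rintro _ ⟨i, hi, rfl⟩
    exact hvis i hi
  have hnbr : ∀ i ∈ I, ∃ j ∈ I, K.Adj i j := by
    rintro _ ⟨i, hi, rfl⟩
    by_cases h : i = k
    · exact ⟨f 0, ⟨0, by omega, rfl⟩, by rw [hf.adj_iff (by omega) hi (by omega)]; omega⟩
    · exact ⟨f (i + 1), ⟨i + 1, by omega, rfl⟩,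
        by rw [hf.adj_iff (by omega) hi (by omega)]; omega⟩
  have hagree : ∀ i ∈ I, Frame.Agree K I E U lab i := by
    intro i hi
    obtain ⟨j, hj, hij⟩ := hnbr i hi
    refine F.agree_of_visible hi hj hij (hvisI j hj) ?_
    obtain ⟨i, hi, rfl⟩ := hi
    obtain ⟨j, hj, rfl⟩ := hj
    rintro _ ⟨l, hl, rfl⟩ hil
    rw [hf.adj_iff (by omega) hi hj] at hij
    rw [hf.adj_iff (by omega) hi hl] at hil
    rw [hf.adj_iff (by omega) hj hl]
    omega
  obtain ⟨ψ, hψ⟩ := Frame.exists_labels (K := K) (I := I) (E := E) (U := U) (lab := lab) α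
    (fun i hi _ _ => by
      obtain ⟨j, hj, hij⟩ := hnbr i hi
      exact ⟨j, hj, hij, hvisI j hj⟩)
  have hψ : ∀ i ∈ I, Frame.HasLabel K I E U lab i (ψ i) := fun i hi => hψ i hi (hvisI i hi)
  have hψa : ψ (f k) = lab α := F.label_a (hψ _ F.mem_a)
  have hψb : ψ (f 0) = lab β := F.swap.label_a (hψ _ F.mem_b)
  have hBL : ∀ i ∈ I, ∀ j ∈ I, K.Adj i j → ψ i ≠ ψ j → Frame.Pure E U Z lab i (ψ i) ∧
      Frame.Pure E U Z lab j (ψ j) ∧ R (ψ i) (ψ j) ∧ ¬ Frame.Amb E U lab i ∧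
      ¬ Frame.Amb E U lab j := fun i hi j hj hij hne =>
    F.pure_of_ne hi hj hij (hagree i hi) (hagree j hj) (hψ i hi) (hψ j hj) hne
  have hne_ab : ψ (f k) ≠ ψ (f 0) := by
    rw [hψa, hψb]
    exact F.core.lab_ne
  -- labels alternate in colour where they change, so some edge of the odd hole keeps its label
  have hstall : (∃ i < k, ψ (f i) = ψ (f (i + 1))) ∨ ψ (f k) = ψ (f 0) := by
    by_contra! hcon
    have hpar := color_path (k := k) (p := f) (c := fun x => col (ψ x)) (by
      intro i hi
      exact F.core.col_ne _ _ (hBL _ ⟨i, by omega, rfl⟩ _ ⟨i + 1, by omega, rfl⟩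
        ((hf.adj _ _ (by omega) (by omega)).2 (Or.inl rfl)) (hcon.1 i hi)).2.2.1) k le_rfl
    exact F.core.col_ne _ _ (hBL _ F.mem_a _ F.mem_b hab hne_ab).2.2.1 (hpar.2 hodd)
  have ht : ∀ d, ∃ i ∈ I, ψ i ≠ d := by
    intro d
    by_cases h : ψ (f k) = d
    · exact ⟨f 0, F.mem_b, h ▸ hne_ab.symm⟩
    · exact ⟨f k, F.mem_a, h⟩
  obtain ⟨g, hg, hgI, hgs⟩ := hf.exists_rotation (P := fun x y => ψ x = ψ y) hstall
  rw [← hI] at hgI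
  set d := ψ (g k) with hd
  obtain ⟨i₀, hi₀I, hi₀⟩ := ht d
  rw [← hgI] at hi₀I
  obtain ⟨j₀, hj₀, rfl⟩ := hi₀I
  -- rotate so that the vertices after the vertex `0`, but not this vertex, have label `d`
  obtain ⟨h, hh, hhI, h0, h1, h2⟩ : ∃ h, Closed K k h ∧ {z | ∃ i ≤ k, h i = z} = I ∧
      ψ (h 0) ≠ d ∧ ψ (h 1) = d ∧ ψ (h 2) = d := by
    have hs := Nat.findGreatest_spec (P := fun j => ψ (g j) ≠ d) hj₀ hi₀
    have hmax := fun j => Nat.findGreatest_is_greatest (P := fun j => ψ (g j) ≠ d) (n := k) (k := j)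
    have hle := Nat.findGreatest_le (P := fun j => ψ (g j) ≠ d) k
    set s := Nat.findGreatest (fun j => ψ (g j) ≠ d) k
    have hsk : s ≠ k := by
      intro h
      rw [h] at hs
      exact hs rfl
    refine ⟨_, hg.rotate s hle, (rotate_range g s hle).trans hgI, ?_, ?_, ?_⟩
    · rw [if_pos (by omega), Nat.zero_add]
      exact hs
    · rw [if_pos (by omega)]
      exact not_not.1 (hmax (1 + s) (by omega) (by omega))
    · split_ifs with h
      · exact not_not.1 (hmax (2 + s) (by omega) (by omega))
      · rw [show 2 + s - (k + 1) = 0 by omega]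
        exact hgs.symm
  have hhm : ∀ i ≤ k, h i ∈ I := fun i hi => hhI ▸ ⟨i, hi, rfl⟩
  have hadj : ∀ {i j}, i ≤ k → j ≤ k → (K.Adj (h i) (h j) ↔ j = i + 1 ∨ i = j + 1 ∨
      i = 0 ∧ j = k ∨ j = 0 ∧ i = k) := fun hi hj => hh.adj_iff (by omega) hi hj
  obtain ⟨hp0, hp1, hR01, ha0, ha1⟩ := hBL (h 0) (hhm 0 (by omega)) (h 1) (hhm 1 (by omega))
    ((hadj (by omega) (by omega)).2 (by omega)) (by rw [h1]; exact h0)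
  rw [h1] at hp1 hR01
  have hCL : ∀ i j, i ≤ k → j ≤ k → i ≠ j → (N (h i) ∨ N (h j)) → ∀ d d',
      Frame.Pure E U Z lab (h i) d → Frame.Pure E U Z lab (h j) d' → R d d' →
      K.Adj (h i) (h j) := by
    intro i j hi hj hij hN d d' hid hjd hR
    have hne : h i ≠ h j := fun h' => hij (hh.inj hi hj h')
    rcases hN with hN | hN
    · exact F.adj_of_pure (hhm i hi) (hhm j hj) hN hne (hvisI _ (hhm i hi)) hid hjd hR
    · exact (F.adj_of_pure (hhm j hj) (hhm i hi) hN hne.symm (hvisI _ (hhm j hj)) hjd hid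
        (F.core.symm _ _ hR)).symm
  -- where the run of the label `d` ends, before `e`, each of the pairs `0, e - 1` and `1, e` would
  -- be adjacent if one of its vertices were not contracted; but `0` and `1` are not both contracted
  have hall : ∀ i, 1 ≤ i → i ≤ k → ψ (h i) = d := by
    by_contra! hcon
    have he := Nat.find_spec hcon
    have hemin := fun i => Nat.find_min (m := i) hcon
    set e := Nat.find hcon
    have he1 : e ≠ 1 := fun h => he.2.2 (h ▸ h1)
    have he2 : e ≠ 2 := fun h => he.2.2 (h ▸ h2)
    have hpre : ψ (h (e - 1)) = d := by
      by_contra hc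
      exact hemin (e - 1) (by omega) ⟨by omega, by omega, hc⟩
    obtain ⟨hpe, hpe', hRe, -, -⟩ := hBL (h (e - 1)) (hhm _ (by omega)) (h e) (hhm _ (by omega))
      ((hadj (by omega) (by omega)).2 (by omega)) (by rw [hpre]; exact he.2.2.symm)
    rw [hpre] at hpe hRe
    have hn1 : ¬ (N (h 0) ∨ N (h (e - 1))) := by
      intro hN
      have := hCL 0 (e - 1) (by omega) (by omega) (by omega) hN _ _ hp0 hpe hR01
      rw [hadj (by omega) (by omega)] at this
      omega
    have hn2 : ¬ (N (h 1) ∨ N (h e)) := by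
      intro hN
      have := hCL 1 e (by omega) (by omega) (by omega) hN _ _ hp1 hpe' hRe
      rw [hadj (by omega) (by omega)] at this
      omega
    push Not at hn1 hn2
    exact F.not_adj _ _ hn1.1 hn2.1 ((hadj (by omega) (by omega)).2 (by omega))
  refine F.not_all_label (y := h 0) (d := d) (hhm 0 (by omega)) ?_
  intro i hi hi0 _
  rw [← hhI] at hi
  obtain ⟨c, hc, rfl⟩ := hi
  have hc0 : c ≠ 0 := by rintro rfl; exact hi0 rfl
  refine ⟨?_, hall c (by omega) hc ▸ hψ _ (hhm c hc)⟩
  intro hamb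
  have hc1 : c ≠ 1 := by rintro rfl; exact ha1 hamb
  have hck : c ≠ k := by
    rintro rfl
    exact (hBL (h 0) (hhm 0 (by omega)) (h c) (hhm c le_rfl)
      ((hadj (by omega) (by omega)).2 (by omega))
      (by rw [hall c (by omega) le_rfl]; exact h0)).2.2.2.2 hamb
  -- the neighbours of an ambiguous vertex show the label `d`, so they are adjacent to `h 0`
  have hside : ∀ j ≤ k, j ≠ 0 → K.Adj (h c) (h j) → K.Adj (h 0) (h j) := by
    intro j hj hj0 hcj
    obtain ⟨hN, hP⟩ := F.pure_of_amb (hhm c hc) (hhm j hj) hcj (hagree _ (hhm c hc)) hamb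
      (hψ _ (hhm c hc))
    rw [hall c (by omega) hc] at hP
    exact hCL 0 j (by omega) hj (Ne.symm hj0) (Or.inr hN) _ _ hp0 hP hR01
  have e1 := hside (c - 1) (by omega) (by omega) ((hadj hc (by omega)).2 (by omega))
  have e2 := hside (c + 1) (by omega) (by omega) ((hadj hc (by omega)).2 (by omega))
  rw [hadj (by omega) (by omega)] at e1 e2
  omega

end

/-! ### Prisms -/

section

variable {V κ : Type*} {G : SimpleGraph V} {K : SimpleGraph κ} {I : Set κ} {N : κ → Prop}
  {E : κ → Set V}

/-- The sequences `u 0, …, u r`, `v 0, …, v s` and `w 0, …, w t` are the paths of an induced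
prism. -/
structure PrismSeq (K : SimpleGraph κ) (r s t : ℕ) (u v w : ℕ → κ) : Prop where
  one_le_r : 1 ≤ r
  one_le_s : 1 ≤ s
  one_le_t : 1 ≤ t
  path_u : Chordless K r u
  path_v : Chordless K s v
  path_w : Chordless K t w
  ne_uv : ∀ i ≤ r, ∀ j ≤ s, u i ≠ v j
  ne_uw : ∀ i ≤ r, ∀ j ≤ t, u i ≠ w j
  ne_vw : ∀ i ≤ s, ∀ j ≤ t, v i ≠ w j
  adj_uv : ∀ i ≤ r, ∀ j ≤ s, (K.Adj (u i) (v j) ↔ i = 0 ∧ j = 0 ∨ i = r ∧ j = s)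
  adj_uw : ∀ i ≤ r, ∀ j ≤ t, (K.Adj (u i) (w j) ↔ i = 0 ∧ j = 0 ∨ i = r ∧ j = t)
  adj_vw : ∀ i ≤ s, ∀ j ≤ t, (K.Adj (v i) (w j) ↔ i = 0 ∧ j = 0 ∨ i = s ∧ j = t)

namespace PrismSeq

variable {r s t : ℕ} {u v w : ℕ → κ}

theorem swap_vw (P : PrismSeq K r s t u v w) : PrismSeq K r t s u w v :=
  ⟨P.one_le_r, P.one_le_t, P.one_le_s, P.path_u, P.path_w, P.path_v, P.ne_uw, P.ne_uv,
    fun i hi j hj => (P.ne_vw j hj i hi).symm, P.adj_uw, P.adj_uv, fun i hi j hj => by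
      rw [K.adj_comm, P.adj_vw j hj i hi]; tauto⟩

theorem swap_uv (P : PrismSeq K r s t u v w) : PrismSeq K s r t v u w :=
  ⟨P.one_le_s, P.one_le_r, P.one_le_t, P.path_v, P.path_u, P.path_w,
    fun i hi j hj => (P.ne_uv j hj i hi).symm, P.ne_vw, P.ne_uw, fun i hi j hj => by
      rw [K.adj_comm, P.adj_uv j hj i hi]; tauto, P.adj_vw, P.adj_uw⟩

/-- The vertex set of a prism. -/
def verts (r s t : ℕ) (u v w : ℕ → κ) : Set κ :=
  {z | (∃ i ≤ r, u i = z) ∨ (∃ i ≤ s, v i = z) ∨ ∃ i ≤ t, w i = z}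

theorem verts_swap_vw : verts r t s u w v = verts r s t u v w := by
  ext z
  exact or_congr_right or_comm

theorem verts_swap_uv : verts s r t v u w = verts r s t u v w := by
  ext z
  exact or_left_comm

theorem mem_u {i : ℕ} (hi : i ≤ r) : u i ∈ verts r s t u v w := Or.inl ⟨i, hi, rfl⟩

theorem mem_v {i : ℕ} (hi : i ≤ s) : v i ∈ verts r s t u v w := Or.inr (Or.inl ⟨i, hi, rfl⟩)

theorem mem_w {i : ℕ} (hi : i ≤ t) : w i ∈ verts r s t u v w := Or.inr (Or.inr ⟨i, hi, rfl⟩)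

theorem not_common_adj (P : PrismSeq K r s t u v w) {i : ℕ} (hi : i < r) {z : κ}
    (hz : z ∈ verts r s t u v w) (h : K.Adj (u i) z) : ¬ K.Adj (u (i + 1)) z := by
  intro h'
  have hr := P.one_le_r
  have hs := P.one_le_s
  have ht := P.one_le_t
  rcases hz with ⟨j, hj, rfl⟩ | ⟨j, hj, rfl⟩ | ⟨j, hj, rfl⟩
  · rw [P.path_u.adj_iff (by omega) hj] at h h'
    omega
  · rw [P.adj_uv _ (by omega) _ hj] at h h'
    omega
  · rw [P.adj_uw _ (by omega) _ hj] at h h'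
    omega

/-- Each vertex of a prism has a neighbour with which it has no common neighbour. -/
theorem exists_adj_not_common (P : PrismSeq K r s t u v w) {z : κ}
    (hz : z ∈ verts r s t u v w) : ∃ y ∈ verts r s t u v w, K.Adj z y ∧
      ∀ x ∈ verts r s t u v w, K.Adj z x → ¬ K.Adj y x := by
  have key : ∀ {r s t : ℕ} {u v w : ℕ → κ}, PrismSeq K r s t u v w → ∀ i ≤ r,
      ∃ y ∈ verts r s t u v w, K.Adj (u i) y ∧
        ∀ x ∈ verts r s t u v w, K.Adj (u i) x → ¬ K.Adj y x := by
    intro r s t u v w P i hi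
    have hr := P.one_le_r
    rcases hi.eq_or_lt with rfl | h
    · obtain ⟨i, rfl⟩ : ∃ i', i = i' + 1 := ⟨i - 1, by omega⟩
      exact ⟨u i, mem_u (by omega), by rw [P.path_u.adj_iff hi (by omega)]; omega,
        fun x hx h1 h2 => P.not_common_adj (by omega) hx h2 h1⟩
    · exact ⟨u (i + 1), mem_u (by omega), by rw [P.path_u.adj_iff hi (by omega)]; omega,
        fun x hx h1 h2 => P.not_common_adj h hx h1 h2⟩
  rcases hz with ⟨i, hi, rfl⟩ | ⟨i, hi, rfl⟩ | ⟨i, hi, rfl⟩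
  · exact key P i hi
  · have := key P.swap_uv i hi
    rwa [verts_swap_uv] at this
  · have := key P.swap_vw.swap_uv i hi
    rwa [verts_swap_uv, verts_swap_vw] at this

theorem adj_u_zero (P : PrismSeq K r s t u v w) {z : κ} (hz : z ∈ verts r s t u v w)
    (h : K.Adj (u 0) z) : z = u 1 ∨ z = v 0 ∨ z = w 0 := by
  have hr := P.one_le_r
  rcases hz with ⟨j, hj, rfl⟩ | ⟨j, hj, rfl⟩ | ⟨j, hj, rfl⟩
  · rw [P.path_u.adj_iff (by omega) hj] at h
    obtain rfl : j = 1 := by omega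
    exact Or.inl rfl
  · rw [P.adj_uv _ (by omega) _ hj] at h
    obtain rfl : j = 0 := by omega
    exact Or.inr (Or.inl rfl)
  · rw [P.adj_uw _ (by omega) _ hj] at h
    obtain rfl : j = 0 := by omega
    exact Or.inr (Or.inr rfl)

theorem exists_adj_not_adj_w_zero (P : PrismSeq K r s t u v w) {z : κ}
    (hz : z ∈ verts r s t u v w) (hw : z ≠ w 0) :
    ∃ y ∈ verts r s t u v w, K.Adj z y ∧ y ≠ w 0 ∧ ¬ K.Adj (w 0) y := by
  have hr := P.one_le_r
  have hs := P.one_le_s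
  have ht := P.one_le_t
  have hur : ¬ K.Adj (w 0) (u r) := by
    rw [K.adj_comm, P.adj_uw _ le_rfl _ (by omega)]
    omega
  rcases hz with ⟨i, hi, rfl⟩ | ⟨i, hi, rfl⟩ | ⟨i, hi, rfl⟩
  · rcases hi.eq_or_lt with rfl | h
    · refine ⟨v s, mem_v le_rfl, (P.adj_uv _ hi _ le_rfl).2 (by omega),
        P.ne_vw _ le_rfl _ (by omega), ?_⟩
      rw [K.adj_comm, P.adj_vw _ le_rfl _ (by omega)]
      omega
    · refine ⟨u (i + 1), mem_u h, (P.path_u.adj_iff hi h).2 (by omega), P.ne_uw _ h _ (by omega),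
        ?_⟩
      rw [K.adj_comm, P.adj_uw _ h _ (by omega)]
      omega
  · rcases hi.eq_or_lt with rfl | h
    · exact ⟨u r, mem_u le_rfl, ((P.adj_uv _ le_rfl _ hi).2 (by omega)).symm,
        P.ne_uw _ le_rfl _ (by omega), hur⟩
    · refine ⟨v (i + 1), mem_v h, (P.path_v.adj_iff hi h).2 (by omega), P.ne_vw _ h _ (by omega),
        ?_⟩
      rw [K.adj_comm, P.adj_vw _ h _ (by omega)]
      omega
  · have hi0 : i ≠ 0 := by rintro rfl; exact hw rfl
    rcases hi.eq_or_lt with rfl | h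
    · exact ⟨u r, mem_u le_rfl, ((P.adj_uw _ le_rfl _ hi).2 (by omega)).symm,
        P.ne_uw _ le_rfl _ (by omega), hur⟩
    · refine ⟨w (i + 1), mem_w h, (P.path_w.adj_iff hi h).2 (by omega),
        (P.path_w.ne _ _ (by omega) h).symm, ?_⟩
      rw [P.path_w.adj_iff (by omega) h]
      omega

/-- Each vertex off the first triangle has a neighbour off this triangle and different from `u 1`,
namely the next vertex in the direction of the second triangle, or a vertex of this one. -/
theorem exists_adj_far (P : PrismSeq K r s t u v w) {z : κ} (hz : z ∈ verts r s t u v w)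
    (hu : z ≠ u 0) (hv : z ≠ v 0) (hw : z ≠ w 0) : ∃ y ∈ verts r s t u v w, K.Adj z y ∧
      y ≠ u 0 ∧ y ≠ v 0 ∧ y ≠ w 0 ∧ y ≠ u 1 := by
  have hr := P.one_le_r
  have hs := P.one_le_s
  have ht := P.one_le_t
  have hvs : v s ≠ u 0 ∧ v s ≠ v 0 ∧ v s ≠ w 0 ∧ v s ≠ u 1 :=
    ⟨(P.ne_uv _ (by omega) _ le_rfl).symm, (P.path_v.ne _ _ (by omega) le_rfl).symm,
      P.ne_vw _ le_rfl _ (by omega), (P.ne_uv _ (by omega) _ le_rfl).symm⟩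
  rcases hz with ⟨i, hi, rfl⟩ | ⟨i, hi, rfl⟩ | ⟨i, hi, rfl⟩
  · have hi0 : i ≠ 0 := by rintro rfl; exact hu rfl
    rcases hi.eq_or_lt with rfl | h
    · exact ⟨v s, mem_v le_rfl, (P.adj_uv _ hi _ le_rfl).2 (by omega), hvs⟩
    · exact ⟨u (i + 1), mem_u h, (P.path_u.adj_iff hi h).2 (by omega),
        (P.path_u.ne _ _ (by omega) h).symm, P.ne_uv _ h _ (by omega), P.ne_uw _ h _ (by omega),
        (P.path_u.ne _ _ (by omega) h).symm⟩
  · have hi0 : i ≠ 0 := by rintro rfl; exact hv rfl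
    rcases hi.eq_or_lt with rfl | h
    · exact ⟨w t, mem_w le_rfl, (P.adj_vw _ hi _ le_rfl).2 (by omega),
        (P.ne_uw _ (by omega) _ le_rfl).symm, (P.ne_vw _ (by omega) _ le_rfl).symm,
        (P.path_w.ne _ _ (by omega) le_rfl).symm, (P.ne_uw _ (by omega) _ le_rfl).symm⟩
    · exact ⟨v (i + 1), mem_v h, (P.path_v.adj_iff hi h).2 (by omega),
        (P.ne_uv _ (by omega) _ h).symm, (P.path_v.ne _ _ (by omega) h).symm,
        P.ne_vw _ h _ (by omega), (P.ne_uv _ (by omega) _ h).symm⟩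
  · have hi0 : i ≠ 0 := by rintro rfl; exact hw rfl
    rcases hi.eq_or_lt with rfl | h
    · exact ⟨v s, mem_v le_rfl, ((P.adj_vw _ le_rfl _ hi).2 (by omega)).symm, hvs⟩
    · exact ⟨w (i + 1), mem_w h, (P.path_w.adj_iff hi h).2 (by omega),
        (P.ne_uw _ (by omega) _ h).symm, (P.ne_vw _ (by omega) _ h).symm,
        (P.path_w.ne _ _ (by omega) h).symm, (P.ne_uw _ (by omega) _ h).symm⟩

variable {α β : V} {U Z : Set V} {lab : V → V} {R : V → V → Prop} {col : V → Bool} {ψ : κ → V}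

/-- Only `u 0` is adjacent to both `v 0` and `w 0`, so all other vertices are visible. -/
theorem visible (P : PrismSeq K r s t u v w) (hI : I = verts r s t u v w)
    (F : Frame G K I N E (v 0) (w 0) α β U Z lab R col) {i : κ} (hi : i ∈ I) (hne : i ≠ u 0) :
    Frame.Visible E U i := by
  have hs := P.one_le_s
  have ht := P.one_le_t
  by_cases h1 : i = v 0
  · rw [h1]; exact F.visible_a
  by_cases h2 : i = w 0
  · rw [h2]; exact F.swap.visible_a
  by_cases h3 : K.Adj i (v 0)
  · refine F.swap.visible_of_not_adj hi h2 fun h4 => ?_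
    subst hI
    have e1 := P.swap_uv.adj_u_zero (z := i) (by rwa [verts_swap_uv]) h3.symm
    have e2 := P.swap_vw.swap_uv.adj_u_zero (z := i)
      (by rwa [verts_swap_uv, verts_swap_vw]) h4.symm
    rcases e1 with e1 | e1 | e1
    · rcases e2 with e2 | e2 | e2
      · exact P.ne_vw 1 hs 1 ht (e1.symm.trans e2)
      · exact hne e2
      · exact h1 e2
    · exact hne e1
    · exact h2 e1
  · exact F.visible_of_not_adj hi h1 h3

/-- If all vertices are visible and `u 0` has the label of `v 0`, then so has every vertex but
`w 0`, and none of these is ambiguous, which is impossible. -/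
theorem false_of_label_u (P : PrismSeq K r s t u v w) (hI : I = verts r s t u v w)
    (F : Frame G K I N E (v 0) (w 0) α β U Z lab R col) (hvis : ∀ i ∈ I, Frame.Visible E U i)
    (hagree : ∀ i ∈ I, Frame.Agree K I E U lab i)
    (hψ : ∀ i ∈ I, Frame.HasLabel K I E U lab i (ψ i)) (h0 : ψ (u 0) = lab α) : False := by
  have hr := P.one_le_r
  have hs := P.one_le_s
  have ht := P.one_le_t
  have hu : ∀ {i}, i ≤ r → u i ∈ I := fun hi => hI ▸ mem_u hi
  have hv : ∀ {i}, i ≤ s → v i ∈ I := fun hi => hI ▸ mem_v hi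
  have hw : ∀ {i}, i ≤ t → w i ∈ I := fun hi => hI ▸ mem_w hi
  have hψv : ψ (v 0) = lab α := F.label_a (hψ _ F.mem_a)
  have hψw : ψ (w 0) = lab β := F.swap.label_a (hψ _ F.mem_b)
  have hBL : ∀ i ∈ I, ∀ j ∈ I, K.Adj i j → ψ i ≠ ψ j → Frame.Pure E U Z lab i (ψ i) ∧
      Frame.Pure E U Z lab j (ψ j) ∧ R (ψ i) (ψ j) := fun i hi j hj hij hne =>
    have h := F.pure_of_ne hi hj hij (hagree i hi) (hagree j hj) (hψ i hi) (hψ j hj) hne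
    ⟨h.1, h.2.1, h.2.2.1⟩
  -- a vertex outside the class of `v 0` next to that class is adjacent to `v 0`
  have hclaim : ∀ i ∈ I, ∀ j ∈ I, K.Adj i j → ψ j = lab α → i ≠ w 0 → i ≠ v 1 → ψ i = lab α := by
    intro i hi j hj hij hjα hiw hiv
    by_contra hiα
    obtain ⟨h1, -, h3⟩ := hBL i hi j hj hij (by rwa [hjα])
    rw [hjα] at h3
    have hadj := F.adj_of_pure F.mem_a hi F.single_a (by rintro rfl; exact hiα hψv) F.visible_a
      F.pure_a h1 (F.core.symm _ _ h3)
    rcases P.swap_uv.adj_u_zero (z := i) (by rw [verts_swap_uv, ← hI]; exact hi) hadj with e | e | e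
    · exact hiv e
    · exact hiα (e ▸ h0)
    · exact hiw e
  have hψu : ∀ i, i ≤ r → ψ (u i) = lab α := by
    intro i
    induction i with
    | zero => exact fun _ => h0
    | succ i ih =>
      intro hi
      exact hclaim _ (hu hi) _ (hu (by omega)) ((P.path_u.adj_iff hi (by omega)).2 (by omega))
        (ih (by omega)) (P.ne_uw _ hi _ (by omega)) (P.ne_uv _ hi _ hs)
  have hψw' : ∀ n, n < t → ψ (w (t - n)) = lab α := by
    intro n
    induction n with
    | zero =>
      intro _
      exact hclaim _ (hw le_rfl) _ (hu le_rfl) ((P.adj_uw _ le_rfl _ le_rfl).2 (by omega)).symm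
        (hψu r le_rfl) (P.path_w.ne _ _ (by omega) le_rfl).symm (P.ne_vw _ hs _ le_rfl).symm
    | succ n ih =>
      intro hn
      exact hclaim _ (hw (by omega)) _ (hw (by omega))
        ((P.path_w.adj_iff (by omega) (by omega)).2 (by omega)) (ih (by omega))
        (P.path_w.ne _ _ (by omega) (by omega)).symm (P.ne_vw _ hs _ (by omega)).symm
  have hψv' : ∀ n, n + 1 < s → ψ (v (s - n)) = lab α := by
    intro n
    induction n with
    | zero =>
      intro _
      exact hclaim _ (hv le_rfl) _ (hu le_rfl) ((P.adj_uv _ le_rfl _ le_rfl).2 (by omega)).symm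
        (hψu r le_rfl) (P.ne_vw _ le_rfl _ (by omega)) (P.path_v.ne _ _ (by omega) le_rfl).symm
    | succ n ih =>
      intro hn
      exact hclaim _ (hv (by omega)) _ (hv (by omega))
        ((P.path_v.adj_iff (by omega) (by omega)).2 (by omega)) (ih (by omega))
        (P.ne_vw _ (by omega) _ (by omega)) (P.path_v.ne _ _ (by omega) (by omega)).symm
  have hRβ : R (lab β) (lab α) := F.swap.R_ab
  have hψv1 : ψ (v 1) = lab α := by
    by_contra hne
    obtain ⟨h1, -, h2⟩ := hBL _ (hv hs) _ (hv (Nat.zero_le s))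
      ((P.path_v.adj_iff hs (by omega)).2 (by omega)) (by rwa [hψv])
    rw [hψv] at h2
    obtain ⟨h3, -, -⟩ := hBL _ (hu (Nat.zero_le r)) _ (hw (Nat.zero_le t))
      ((P.adj_uw _ (by omega) _ (by omega)).2 (by omega)) (by rw [h0, hψw]; exact F.core.lab_ne)
    rw [h0] at h3
    have hN : ¬ N (v 1) := by
      intro hN
      have := F.adj_of_pure (hv hs) (hu (Nat.zero_le r)) hN (P.ne_uv _ (by omega) _ hs).symm
        (hvis _ (hv hs)) h1 h3 h2
      rw [K.adj_comm, P.adj_uv _ (by omega) _ hs] at this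
      omega
    obtain ⟨g, hg, hadj, hψg, hgw, hgw'⟩ : ∃ g ∈ I, K.Adj (v 1) g ∧ ψ g = lab α ∧ g ≠ w 0 ∧
        ¬ K.Adj (w 0) g := by
      by_cases hs1 : s = 1
      · refine ⟨u r, hu le_rfl, ((P.adj_uv _ le_rfl _ hs).2 (by omega)).symm, hψu r le_rfl,
          P.ne_uw _ le_rfl _ (by omega), ?_⟩
        rw [K.adj_comm, P.adj_uw _ le_rfl _ (by omega)]
        omega
      · refine ⟨v 2, hv (by omega), (P.path_v.adj_iff hs (by omega)).2 (by omega), ?_,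
          P.ne_vw _ (by omega) _ (by omega), ?_⟩
        · have := hψv' (s - 2) (by omega)
          rwa [show s - (s - 2) = 2 by omega] at this
        · rw [K.adj_comm, P.adj_vw _ (by omega) _ (by omega)]
          omega
    obtain ⟨-, h4, -⟩ := hBL _ (hv hs) g hg hadj (by rwa [hψg])
    rw [hψg] at h4
    exact hgw' (F.adj_of_pure F.mem_b hg F.single_b hgw.symm F.swap.visible_a F.swap.pure_a h4 hRβ)
  have hall : ∀ i ∈ I, i ≠ w 0 → ψ i = lab α := by
    intro i hi hne
    rw [hI] at hi
    rcases hi with ⟨i, hi, rfl⟩ | ⟨i, hi, rfl⟩ | ⟨i, hi, rfl⟩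
    · exact hψu i hi
    · by_cases h0 : i = 0
      · rw [h0]; exact hψv
      by_cases h1 : i = 1
      · rw [h1]; exact hψv1
      have := hψv' (s - i) (by omega)
      rwa [show s - (s - i) = i by omega] at this
    · have hi0 : i ≠ 0 := by rintro rfl; exact hne rfl
      have := hψw' (t - i) (by omega)
      rwa [show t - (t - i) = i by omega] at this
  refine F.not_all_label (y := w 0) (d := lab α) F.mem_b fun i hi hne _ =>
    ⟨fun hamb => ?_, hall i hi hne ▸ hψ i hi⟩
  obtain ⟨y, hy, hiy, hyw, hadj⟩ := P.exists_adj_not_adj_w_zero (z := i) (hI ▸ hi) hne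
  rw [← hI] at hy
  obtain ⟨-, h1⟩ := F.pure_of_amb hi hy hiy (hagree i hi) hamb (hψ i hi)
  rw [hall i hi hne] at h1
  exact hadj (F.adj_of_pure F.mem_b hy F.single_b hyw.symm F.swap.visible_a F.swap.pure_a h1 hRβ)

/-- The label of `u 0` agrees with that of `v 0` or of `w 0`, since the labels are related by a
bipartite relation. -/
theorem false_of_visible (P : PrismSeq K r s t u v w) (hI : I = verts r s t u v w)
    (F : Frame G K I N E (v 0) (w 0) α β U Z lab R col) (h0 : Frame.Visible E U (u 0)) : False := by
  have hr := P.one_le_r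
  have hvis : ∀ i ∈ I, Frame.Visible E U i := by
    intro i hi
    by_cases hne : i = u 0
    · rwa [hne]
    · exact P.visible hI F hi hne
  have hnbr : ∀ i ∈ I, ∃ y ∈ I, K.Adj i y ∧ ∀ x ∈ I, K.Adj i x → ¬ K.Adj y x := by
    intro i hi
    rw [hI] at hi ⊢
    exact P.exists_adj_not_common hi
  have hagree : ∀ i ∈ I, Frame.Agree K I E U lab i := by
    intro i hi
    obtain ⟨y, hy, hiy, h⟩ := hnbr i hi
    exact F.agree_of_visible hi hy hiy (hvis y hy) h
  obtain ⟨ψ, hψ⟩ := Frame.exists_labels (K := K) (I := I) (E := E) (U := U) (lab := lab) α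
    (fun i hi _ _ => by
      obtain ⟨y, hy, hiy, -⟩ := hnbr i hi
      exact ⟨y, hy, hiy, hvis y hy⟩)
  have hψ : ∀ i ∈ I, Frame.HasLabel K I E U lab i (ψ i) := fun i hi => hψ i hi (hvis i hi)
  have hψv : ψ (v 0) = lab α := F.label_a (hψ _ F.mem_a)
  have hψw : ψ (w 0) = lab β := F.swap.label_a (hψ _ F.mem_b)
  have hu0 : u 0 ∈ I := hI ▸ mem_u (Nat.zero_le r)
  by_cases h1 : ψ (u 0) = lab α
  · exact P.false_of_label_u hI F hvis hagree hψ h1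
  by_cases h2 : ψ (u 0) = lab β
  · exact P.swap_vw.false_of_label_u (hI.trans verts_swap_vw.symm) F.swap hvis hagree hψ h2
  obtain ⟨-, -, h3, -⟩ := F.pure_of_ne hu0 F.mem_a
    ((P.adj_uv _ (Nat.zero_le r) _ (Nat.zero_le s)).2 (by omega)) (hagree _ hu0)
    (hagree _ F.mem_a) (hψ _ hu0) (hψ _ F.mem_a) (by rwa [hψv])
  obtain ⟨-, -, h4, -⟩ := F.pure_of_ne hu0 F.mem_b
    ((P.adj_uw _ (Nat.zero_le r) _ (Nat.zero_le t)).2 (by omega)) (hagree _ hu0)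
    (hagree _ F.mem_b) (hψ _ hu0) (hψ _ F.mem_b) (by rwa [hψw])
  rw [hψv] at h3
  rw [hψw] at h4
  exact F.not_R_triangle h3 h4 F.R_ab

/-- If the clique of `u 0` lies in `U`, it is complete to `Z`, so the uncontracted vertices that are
represented in `Z` are neighbours of `u 0`. -/
theorem eq_of_mem_Z (P : PrismSeq K r s t u v w) (hI : I = verts r s t u v w)
    (F : Frame G K I N E (v 0) (w 0) α β U Z lab R col) (h0 : ∀ x ∈ E (u 0), x ∈ U) {j : κ}
    (hj : j ∈ I) (hju : j ≠ u 0) (hN : N j) {x : V} (hx : x ∈ E j) (hxZ : x ∈ Z) :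
    j = u 1 ∨ j = v 0 ∨ j = w 0 := by
  refine P.adj_u_zero (hI ▸ hj) ?_
  by_contra hadj
  obtain ⟨x', hx', y, hy, h⟩ := F.exists_not_adj j hj (u 0) (hI ▸ mem_u (Nat.zero_le r)) hN hju
    fun h => hadj h.symm
  rw [F.subsingleton j hN hx' hx] at h
  exact h (F.core.complete y (h0 y hy) x hxZ).symm

/-- If the clique of `u 0` lies in `U`, no other vertex is ambiguous: it would have an uncontracted
neighbour that is represented in `Z` but not adjacent to `u 0`. -/
theorem not_amb (P : PrismSeq K r s t u v w) (hI : I = verts r s t u v w)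
    (F : Frame G K I N E (v 0) (w 0) α β U Z lab R col) (h0 : ∀ x ∈ E (u 0), x ∈ U) {i : κ}
    (hi : i ∈ I) (hne : i ≠ u 0) : ¬ Frame.Amb E U lab i := by
  intro hamb
  obtain ⟨y, hy, hiy, h1, h2, h3, h4⟩ := P.exists_adj_far (z := i) (hI ▸ hi) hne
    (by rintro rfl; exact F.not_amb F.single_a hamb)
    (by rintro rfl; exact F.not_amb F.single_b hamb)
  rw [← hI] at hy
  have hN : N y := by
    by_contra hN
    exact F.not_adj i y (fun h => F.not_amb h hamb) hN hiy
  obtain ⟨x, hx, hxU⟩ := P.visible hI F hy h1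
  obtain ⟨_, _, -, hnb⟩ := F.amb_adj hi hamb
  rcases P.eq_of_mem_Z hI F h0 hy h1 hN hx (hnb y hy hiy x hx hxU).1 with h | h | h
  · exact h4 h
  · exact h2 h
  · exact h3 h

/-- If the clique of `u 0` lies in `U`, then labels change only along edges with an end next to
`u 0`: both ends of such an edge are represented in `Z`, and one of them is not contracted. -/
theorem label_eq_of_adj (P : PrismSeq K r s t u v w) (hI : I = verts r s t u v w)
    (F : Frame G K I N E (v 0) (w 0) α β U Z lab R col) (h0 : ∀ x ∈ E (u 0), x ∈ U)
    (hψ : ∀ i ∈ I, i ≠ u 0 → Frame.HasLabel K I E U lab i (ψ i)) {i j : κ} (hi : i ∈ I)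
    (hj : j ∈ I) (hij : K.Adj i j) (hi0 : i ≠ u 0) (hi1 : i ≠ u 1) (hi2 : i ≠ v 0) (hi3 : i ≠ w 0)
    (hj0 : j ≠ u 0) (hj1 : j ≠ u 1) (hj2 : j ≠ v 0) (hj3 : j ≠ w 0) : ψ i = ψ j := by
  by_contra hne
  obtain ⟨h1, h2, -⟩ := F.pure_of_ne hi hj hij (fun h => absurd h (P.not_amb hI F h0 hi hi0))
    (fun h => absurd h (P.not_amb hI F h0 hj hj0)) (hψ i hi hi0) (hψ j hj hj0) hne
  have key : ∀ {i d}, i ∈ I → i ≠ u 0 → i ≠ u 1 → i ≠ v 0 → i ≠ w 0 →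
      Frame.Pure E U Z lab i d → ¬ N i := by
    intro i d hi hi0 hi1 hi2 hi3 hp hN
    obtain ⟨x, hx, hxU⟩ := P.visible hI F hi hi0
    rcases P.eq_of_mem_Z hI F h0 hi hi0 hN hx (hp x hx hxU).1 with h | h | h
    · exact hi1 h
    · exact hi2 h
    · exact hi3 h
  exact F.not_adj i j (key hi hi0 hi1 hi2 hi3 h1) (key hj hj0 hj1 hj2 hj3 h2) hij

/-- If the clique of `u 0` lies in `U`, then the labels are constant away from the first triangle
and `u 1`. -/
theorem labels_far (P : PrismSeq K r s t u v w) (hI : I = verts r s t u v w)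
    (F : Frame G K I N E (v 0) (w 0) α β U Z lab R col) (h0 : ∀ x ∈ E (u 0), x ∈ U)
    (hψ : ∀ i ∈ I, i ≠ u 0 → Frame.HasLabel K I E U lab i (ψ i)) :
    (∀ i, 1 ≤ i → i ≤ s → ψ (v i) = ψ (v 1)) ∧ (∀ i, 1 ≤ i → i ≤ t → ψ (w i) = ψ (v 1)) ∧
      ∀ i, 2 ≤ i → i ≤ r → ψ (u i) = ψ (v 1) := by
  have hr := P.one_le_r
  have hs := P.one_le_s
  have ht := P.one_le_t
  have hu : ∀ {i}, i ≤ r → u i ∈ I := fun hi => hI ▸ mem_u hi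
  have hv : ∀ {i}, i ≤ s → v i ∈ I := fun hi => hI ▸ mem_v hi
  have hw : ∀ {i}, i ≤ t → w i ∈ I := fun hi => hI ▸ mem_w hi
  have hL : ∀ {i j}, i ∈ I → j ∈ I → K.Adj i j → (i ≠ u 0 ∧ i ≠ u 1 ∧ i ≠ v 0 ∧ i ≠ w 0) →
      (j ≠ u 0 ∧ j ≠ u 1 ∧ j ≠ v 0 ∧ j ≠ w 0) → ψ i = ψ j := fun hi hj hij h h' =>
    P.label_eq_of_adj hI F h0 hψ hi hj hij h.1 h.2.1 h.2.2.1 h.2.2.2 h'.1 h'.2.1 h'.2.2.1 h'.2.2.2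
  have fu : ∀ {i}, 2 ≤ i → i ≤ r → u i ≠ u 0 ∧ u i ≠ u 1 ∧ u i ≠ v 0 ∧ u i ≠ w 0 := fun h1 h2 =>
    ⟨(P.path_u.ne _ _ (by omega) h2).symm, (P.path_u.ne _ _ (by omega) h2).symm,
      P.ne_uv _ h2 _ (by omega), P.ne_uw _ h2 _ (by omega)⟩
  have fv : ∀ {i}, 1 ≤ i → i ≤ s → v i ≠ u 0 ∧ v i ≠ u 1 ∧ v i ≠ v 0 ∧ v i ≠ w 0 := fun h1 h2 =>
    ⟨(P.ne_uv _ (by omega) _ h2).symm, (P.ne_uv _ hr _ h2).symm,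
      (P.path_v.ne _ _ (by omega) h2).symm, P.ne_vw _ h2 _ (by omega)⟩
  have fw : ∀ {i}, 1 ≤ i → i ≤ t → w i ≠ u 0 ∧ w i ≠ u 1 ∧ w i ≠ v 0 ∧ w i ≠ w 0 := fun h1 h2 =>
    ⟨(P.ne_uw _ (by omega) _ h2).symm, (P.ne_uw _ hr _ h2).symm,
      (P.ne_vw _ (by omega) _ h2).symm, (P.path_w.ne _ _ (by omega) h2).symm⟩
  have hψv : ∀ i, 1 ≤ i → i ≤ s → ψ (v i) = ψ (v 1) := by
    intro i hi
    induction i, hi using Nat.le_induction with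
    | base => exact fun _ => rfl
    | succ i hi ih =>
      intro his
      rw [← ih (by omega)]
      exact hL (hv his) (hv (by omega)) ((P.path_v.adj_iff his (by omega)).2 (by omega))
        (fv (by omega) his) (fv hi (by omega))
  refine ⟨hψv, ?_, ?_⟩
  · have : ∀ n, n < t → ψ (w (t - n)) = ψ (v 1) := by
      intro n
      induction n with
      | zero =>
        intro _
        rw [← hψv s hs le_rfl]
        exact hL (hw le_rfl) (hv le_rfl) ((P.adj_vw _ le_rfl _ le_rfl).2 (by omega)).symm
          (fw ht le_rfl) (fv hs le_rfl)
      | succ n ih =>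
        intro hn
        rw [← ih (by omega)]
        exact hL (hw (by omega)) (hw (by omega))
          ((P.path_w.adj_iff (by omega) (by omega)).2 (by omega)) (fw (by omega) (by omega))
          (fw (by omega) (by omega))
    intro i hi hit
    have h := this (t - i) (by omega)
    rwa [show t - (t - i) = i by omega] at h
  · have : ∀ n, n + 1 < r → ψ (u (r - n)) = ψ (v 1) := by
      intro n
      induction n with
      | zero =>
        intro hr2
        rw [← hψv s hs le_rfl]
        exact hL (hu le_rfl) (hv le_rfl) ((P.adj_uv _ le_rfl _ le_rfl).2 (by omega))
          (fu (by omega) le_rfl) (fv hs le_rfl)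
      | succ n ih =>
        intro hn
        rw [← ih (by omega)]
        exact hL (hu (by omega)) (hu (by omega))
          ((P.path_u.adj_iff (by omega) (by omega)).2 (by omega)) (fu (by omega) (by omega))
          (fu (by omega) (by omega))
    intro i hi hit
    have h := this (r - i) (by omega)
    rwa [show r - (r - i) = i by omega] at h

/-- If the clique of `u 0` lies in `U` and `v 1` has the label of `v 0`, then so has every visible
vertex but `w 0`, which is impossible. -/
theorem false_of_label_v (P : PrismSeq K r s t u v w) (hI : I = verts r s t u v w)
    (F : Frame G K I N E (v 0) (w 0) α β U Z lab R col) (h0 : ∀ x ∈ E (u 0), x ∈ U)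
    (hψ : ∀ i ∈ I, i ≠ u 0 → Frame.HasLabel K I E U lab i (ψ i)) (h1 : ψ (v 1) = lab α) :
    False := by
  have hr := P.one_le_r
  have hs := P.one_le_s
  have ht := P.one_le_t
  have hu : ∀ {i}, i ≤ r → u i ∈ I := fun hi => hI ▸ mem_u hi
  have hv : ∀ {i}, i ≤ s → v i ∈ I := fun hi => hI ▸ mem_v hi
  have hψv : ψ (v 0) = lab α :=
    F.label_a (hψ _ F.mem_a (P.ne_uv 0 (by omega) 0 (by omega)).symm)
  obtain ⟨hv', hw', hu'⟩ := P.labels_far hI F h0 hψ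
  rw [h1] at hv' hw' hu'
  have hu10 : u 1 ≠ u 0 := (P.path_u.ne 0 1 (by omega) hr).symm
  have hψu1 : ψ (u 1) = lab α := by
    by_contra hne
    obtain ⟨g, hg, hadj, hψg, hg0⟩ : ∃ g ∈ I, K.Adj (u 1) g ∧ ψ g = lab α ∧ g ≠ u 0 := by
      by_cases hr1 : r = 1
      · exact ⟨v s, hv le_rfl, (P.adj_uv _ hr _ le_rfl).2 (by omega), hv' s hs le_rfl,
          (P.ne_uv _ (by omega) _ le_rfl).symm⟩
      · exact ⟨u 2, hu (by omega), (P.path_u.adj_iff hr (by omega)).2 (by omega),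
          hu' 2 le_rfl (by omega), (P.path_u.ne _ _ (by omega) (by omega)).symm⟩
    obtain ⟨h2, -, h3, -⟩ := F.pure_of_ne (hu hr) hg hadj
      (fun h => absurd h (P.not_amb hI F h0 (hu hr) hu10))
      (fun h => absurd h (P.not_amb hI F h0 hg hg0)) (hψ _ (hu hr) hu10) (hψ _ hg hg0)
      (by rwa [hψg])
    rw [hψg] at h3
    have := F.adj_of_pure F.mem_a (hu hr) F.single_a (P.ne_uv _ hr _ (by omega)).symm F.visible_a
      F.pure_a h2 (F.core.symm _ _ h3)
    rw [K.adj_comm, P.adj_uv _ hr _ (by omega)] at this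
    omega
  refine F.not_all_label (y := w 0) (d := lab α) F.mem_b fun i hi hne hvis => ?_
  have hi0 : i ≠ u 0 := by
    rintro rfl
    obtain ⟨x, hx, hxU⟩ := hvis
    exact hxU (h0 x hx)
  refine ⟨P.not_amb hI F h0 hi hi0, ?_⟩
  have hψi : ψ i = lab α := by
    rw [hI] at hi
    rcases hi with ⟨i, hi, rfl⟩ | ⟨i, hi, rfl⟩ | ⟨i, hi, rfl⟩
    · have hi0 : i ≠ 0 := by rintro rfl; exact hi0 rfl
      by_cases hi1 : i = 1
      · rw [hi1]; exact hψu1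
      · exact hu' i (by omega) hi
    · by_cases hi0 : i = 0
      · rw [hi0]; exact hψv
      · exact hv' i (by omega) hi
    · have hi0 : i ≠ 0 := by rintro rfl; exact hne rfl
      exact hw' i (by omega) hi
  exact hψi ▸ hψ i hi hi0

/-- The common label of `v 1` and `w 1` is that of `v 0` or of `w 0`, since the labels are related
by a bipartite relation. -/
theorem false_of_not_visible (P : PrismSeq K r s t u v w) (hI : I = verts r s t u v w)
    (F : Frame G K I N E (v 0) (w 0) α β U Z lab R col) (h0 : ∀ x ∈ E (u 0), x ∈ U) : False := by
  have hs := P.one_le_s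
  have ht := P.one_le_t
  obtain ⟨ψ, hψ⟩ := Frame.exists_labels (K := K) (I := I) (E := E) (U := U) (lab := lab) α
    (fun i hi hvis hamb => by
      have hi0 : i ≠ u 0 := by
        rintro rfl
        obtain ⟨x, hx, hxU⟩ := hvis
        exact hxU (h0 x hx)
      exact absurd hamb (P.not_amb hI F h0 hi hi0))
  have hψ : ∀ i ∈ I, i ≠ u 0 → Frame.HasLabel K I E U lab i (ψ i) := fun i hi hne =>
    hψ i hi (P.visible hI F hi hne)
  by_cases h1 : ψ (v 1) = lab α
  · exact P.false_of_label_v hI F h0 hψ h1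
  have hw1 := (P.labels_far hI F h0 hψ).2.1 1 le_rfl ht
  by_cases h2 : ψ (w 1) = lab β
  · exact P.swap_vw.false_of_label_v (hI.trans verts_swap_vw.symm) F.swap h0 hψ h2
  have hA : ∀ {i}, i ∈ I → i ≠ u 0 → Frame.Agree K I E U lab i := fun hi hne h =>
    absurd h (P.not_amb hI F h0 hi hne)
  have hv1 : v 1 ∈ I := hI ▸ mem_v hs
  have hw1' : w 1 ∈ I := hI ▸ mem_w ht
  have n0 := (P.ne_uv 0 (Nat.zero_le r) 0 (Nat.zero_le s)).symm
  have n1 := (P.ne_uv 0 (Nat.zero_le r) 1 hs).symm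
  have n2 := (P.ne_uw 0 (Nat.zero_le r) 0 (Nat.zero_le t)).symm
  have n3 := (P.ne_uw 0 (Nat.zero_le r) 1 ht).symm
  have hψv : ψ (v 0) = lab α := F.label_a (hψ _ F.mem_a n0)
  have hψw : ψ (w 0) = lab β := F.swap.label_a (hψ _ F.mem_b n2)
  obtain ⟨-, -, h3, -⟩ := F.pure_of_ne F.mem_a hv1 ((P.path_v.adj_iff (by omega) hs).2 (by omega))
    (hA F.mem_a n0) (hA hv1 n1) (hψ _ F.mem_a n0) (hψ _ hv1 n1) (by rw [hψv]; exact Ne.symm h1)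
  obtain ⟨-, -, h4, -⟩ := F.pure_of_ne F.mem_b hw1' ((P.path_w.adj_iff (by omega) ht).2 (by omega))
    (hA F.mem_b n2) (hA hw1' n3) (hψ _ F.mem_b n2) (hψ _ hw1' n3) (by rw [hψw]; exact Ne.symm h2)
  rw [hψv] at h3
  rw [hψw, hw1] at h4
  exact F.not_R_triangle F.R_ab h3 h4

/-- A prism two of whose vertices `v 0` and `w 0` in the first triangle are not contracted. -/
theorem false_of_single (hG : IsMeyniel G) (P : PrismSeq K r s t u v w) (hv : N (v 0))
    (hw : N (w 0)) (X : Expansion G K (verts r s t u v w) N E) : False := by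
  have hs := P.one_le_s
  have ht := P.one_le_t
  -- the edge lies on the hole formed by the second and the third path
  obtain ⟨α, β, U, Z, lab, R, col, F⟩ := X.exists_frame hG (a := v 0) (b := w 0) hv hw
    ((P.adj_vw _ (by omega) _ (by omega)).2 (by omega)) (m := t + s + 1)
    (g := fun i => if i ≤ t then w i else v (t + s + 1 - i)) (by
      intro i hi
      split_ifs with h
      · exact mem_w h
      · exact mem_v (by omega)) (by simp) (by
      rw [if_neg (by omega), Nat.sub_self]) (by omega) (by
      intro i hi
      split_ifs with h1 h2 h2
      · exact (P.path_w.adj_iff h1 h2).2 (by omega)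
      · exact ((P.adj_vw _ (by omega) _ h1).2 (by omega)).symm
      · omega
      · exact (P.path_v.adj_iff (by omega) (by omega)).2 (by omega)) (by
      intro i hi him
      split_ifs with h
      · refine ⟨(P.ne_vw _ (by omega) _ h).symm, (P.path_w.ne _ _ hi h).symm, ?_⟩
        rw [K.adj_comm, P.adj_vw _ (by omega) _ h]
        omega
      · refine ⟨(P.path_v.ne _ _ (by omega) (by omega)).symm, P.ne_vw _ (by omega) _ (by omega), ?_⟩
        rw [P.adj_vw _ (by omega) _ (by omega)]
        omega)
  by_cases h0 : Frame.Visible E U (u 0)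
  · exact P.false_of_visible rfl F h0
  · refine P.false_of_not_visible rfl F fun x hx => ?_
    by_contra hxU
    exact h0 ⟨x, hx, hxU⟩

/-- A graph with expansions into a Meyniel graph has no prism. -/
theorem false_of_expansion (hG : IsMeyniel G) (P : PrismSeq K r s t u v w)
    (X : Expansion G K (verts r s t u v w) N E) : False := by
  have huv := (P.adj_uv 0 (Nat.zero_le _) 0 (Nat.zero_le _)).2 (by omega)
  have huw := (P.adj_uw 0 (Nat.zero_le _) 0 (Nat.zero_le _)).2 (by omega)
  have hvw := (P.adj_vw 0 (Nat.zero_le _) 0 (Nat.zero_le _)).2 (by omega)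
  by_cases hv : N (v 0)
  · by_cases hw : N (w 0)
    · exact P.false_of_single hG hv hw X
    · have hu : N (u 0) := by
        by_contra hu
        exact X.not_adj _ _ hu hw huw
      exact P.swap_vw.swap_uv.false_of_single hG hu hv (by rwa [verts_swap_uv, verts_swap_vw])
  · have hu : N (u 0) := by
      by_contra hu
      exact X.not_adj _ _ hu hv huv
    have hw : N (w 0) := by
      by_contra hw
      exact X.not_adj _ _ hv hw hvw
    exact P.swap_uv.false_of_single hG hu hw (by rwa [verts_swap_uv])

end PrismSeq

end

/-! ### Antiholes -/

section

variable {V κ : Type*} {G : SimpleGraph V} {K : SimpleGraph κ} {I : Set κ} {N : κ → Prop}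
  {E : κ → Set V}

/-- The contracted vertices of an antihole are pairwise non-adjacent, so they are at most two
consecutive vertices of the hole of the complement. -/
theorem Expansion.exists_rotation_compl {k : ℕ} {f : ℕ → κ} (hf : Closed Kᶜ k f) (hk : 3 ≤ k)
    (X : Expansion G K I N E) : ∃ f', Closed Kᶜ k f' ∧
      {z | ∃ i ≤ k, f' i = z} = {z | ∃ i ≤ k, f i = z} ∧ ∀ i, 1 ≤ i → i < k → N (f' i) := by
  have hN : ∀ i j, i ≤ k → j ≤ k → i ≠ j → ¬ N (f i) → ¬ N (f j) →
      j = i + 1 ∨ i = j + 1 ∨ i = 0 ∧ j = k ∨ j = 0 ∧ i = k := fun i j hi hj hij h1 h2 =>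
    (hf.adj_iff (by omega) hi hj).1
      ((compl_adj _ _ _).2 ⟨fun h => hij (hf.inj hi hj h), X.not_adj _ _ h1 h2⟩)
  obtain ⟨g, hg, hgf, hgN⟩ := hf.exists_rotation
    (P := fun x y => ∀ i ≤ k, ¬ N (f i) → f i = x ∨ f i = y) (by
    by_contra! hcon
    obtain ⟨h1, i, hi, hNi, hik, hi0⟩ := hcon
    have hik : i ≠ k := fun h => hik (by rw [h])
    have hi0 : i ≠ 0 := fun h => hi0 (by rw [h])
    obtain ⟨j, hj, hNj, hji, hji'⟩ := h1 i (by omega)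
    have hji : j ≠ i := fun h => hji (by rw [h])
    have hji' : j ≠ i + 1 := fun h => hji' (by rw [h])
    obtain ⟨l, hl, hNl, hli, hli'⟩ := h1 (i - 1) (by omega)
    have hli : l ≠ i - 1 := fun h => hli (by rw [h])
    have hli' : l ≠ i := fun h => hli' (by rw [h, Nat.sub_add_cancel (by omega)])
    have e1 := hN i j hi hj hji.symm hNi hNj
    have e2 := hN i l hi hl hli'.symm hNi hNl
    have e3 := hN j l hj hl (by omega) hNj hNl
    omega)
  refine ⟨g, hg, hgf, fun i hi hik => ?_⟩
  by_contra hc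
  have hi' : g i ∈ {z | ∃ i ≤ k, f i = z} := hgf ▸ ⟨i, hik.le, rfl⟩
  obtain ⟨l, hl, hli⟩ := hi'
  rcases hgN l hl (by rwa [hli]) with h | h
  · exact hg.ne i k hik le_rfl (hli.symm.trans h)
  · exact hg.ne 0 i hi hik.le (hli.symm.trans h).symm

/-- A graph with expansions into a Meyniel graph has no antihole with at least six vertices. Five
consecutive vertices of the hole of the complement, at most the last of which is contracted, would
yield a cycle of length five with a single chord. -/
theorem not_closed_compl_of_expansion (hG : IsMeyniel G) {k : ℕ} {f : ℕ → κ} (hf : Closed Kᶜ k f)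
    (hk : 5 ≤ k) (X : Expansion G K {z | ∃ i ≤ k, f i = z} N E) : False := by
  obtain ⟨f, hf, hI, hN⟩ := X.exists_rotation_compl hf (by omega)
  rw [← hI] at X
  clear hI
  have hI : ∀ i ≤ k, f i ∈ {z | ∃ i ≤ k, f i = z} := fun i hi => ⟨i, hi, rfl⟩
  have hne : ∀ {i j}, i < j → j ≤ k → f i ≠ f j := fun h h' => hf.ne _ _ h h'
  have hnadj : ∀ i, i < k → ¬ K.Adj (f i) (f (i + 1)) := fun i hi =>
    ((compl_adj _ _ _).1 ((hf.adj i (i + 1) (by omega) hi).2 (Or.inl rfl))).2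
  have hadj : ∀ i j, i + 1 < j → 1 ≤ i → j ≤ k → K.Adj (f i) (f j) := by
    intro i j hij hi hj
    by_contra h
    have := (hf.adj i j (by omega) hj).1 ((compl_adj _ _ _).2 ⟨hne (by omega) hj, h⟩)
    omega
  obtain ⟨x₄, h₄, x₅, h₅, h45⟩ := X.exists_not_adj _ (hI 4 (by omega)) _ (hI 5 hk)
    (hN 4 (by omega) (by omega)) (hne (by omega) hk) (hnadj 4 (by omega))
  obtain ⟨x₁, h₁⟩ := X.nonempty _ (hI 1 (by omega)) (hN 1 (by omega) (by omega))
  obtain ⟨x₂, h₂⟩ := X.nonempty _ (hI 2 (by omega)) (hN 2 (by omega) (by omega))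
  obtain ⟨x₃, h₃⟩ := X.nonempty _ (hI 3 (by omega)) (hN 3 (by omega) (by omega))
  have hno : ∀ i, 1 ≤ i → i < 4 → ∀ x ∈ E (f i), ∀ y ∈ E (f (i + 1)), ¬ G.Adj x y := by
    intro i hi hi4 x hx y hy hxy
    obtain ⟨x', hx', y', hy', h⟩ := X.exists_not_adj _ (hI i (by omega)) _ (hI (i + 1) (by omega))
      (hN i (by omega) (by omega)) (hne (by omega) (by omega)) (hnadj i (by omega))
    rw [X.subsingleton _ (hN i (by omega) (by omega)) hx' hx,
      X.subsingleton _ (hN (i + 1) (by omega) (by omega)) hy' hy] at h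
    exact h hxy
  have hyes : ∀ i j, i + 1 < j → 1 ≤ i → j ≤ 5 → ∀ x ∈ E (f i), ∀ y ∈ E (f j), G.Adj x y :=
    fun i j hij hi hj => X.adj _ (hI i (by omega)) _ (hI j (by omega)) (hadj i j hij hi (by omega))
  have hdis : ∀ i j, i < j → 1 ≤ i → j ≤ 5 → ∀ x ∈ E (f i), ∀ y ∈ E (f j), x ≠ y := by
    rintro i j hij hi hj x hx y hy rfl
    exact X.disjoint _ (hI i (by omega)) _ (hI j (by omega)) (hN i (by omega) (by omega))
      (hne hij (by omega)) x hx hy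
  -- the only chord of the cycle `x₁, x₃, x₅, x₂, x₄` is `x₁x₅`
  let p : ℕ → V := fun i => match i with
    | 0 => x₁ | 1 => x₃ | 2 => x₅ | 3 => x₂ | _ => x₄
  have d12 := hdis 1 2 (by omega) (by omega) (by omega) x₁ h₁ x₂ h₂
  have d13 := hdis 1 3 (by omega) (by omega) (by omega) x₁ h₁ x₃ h₃
  have d14 := hdis 1 4 (by omega) (by omega) (by omega) x₁ h₁ x₄ h₄
  have d15 := hdis 1 5 (by omega) (by omega) (by omega) x₁ h₁ x₅ h₅
  have d23 := hdis 2 3 (by omega) (by omega) (by omega) x₂ h₂ x₃ h₃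
  have d24 := hdis 2 4 (by omega) (by omega) (by omega) x₂ h₂ x₄ h₄
  have d25 := hdis 2 5 (by omega) (by omega) (by omega) x₂ h₂ x₅ h₅
  have d34 := hdis 3 4 (by omega) (by omega) (by omega) x₃ h₃ x₄ h₄
  have d35 := hdis 3 5 (by omega) (by omega) (by omega) x₃ h₃ x₅ h₅
  have d45 := hdis 4 5 (by omega) (by omega) (by omega) x₄ h₄ x₅ h₅
  obtain ⟨i, j, hij, hj, h1, h2, h3⟩ := hG.exists_chord (k := 4) le_rfl (by decide) p
    (by
      intro i j hij hj
      interval_cases j <;> interval_cases i <;> first | assumption | exact Ne.symm (by assumption))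
    (by
      intro i hi
      interval_cases i
      · exact hyes 1 3 (by omega) (by omega) (by omega) x₁ h₁ x₃ h₃
      · exact hyes 3 5 (by omega) (by omega) (by omega) x₃ h₃ x₅ h₅
      · exact (hyes 2 5 (by omega) (by omega) (by omega) x₂ h₂ x₅ h₅).symm
      · exact hyes 2 4 (by omega) (by omega) (by omega) x₂ h₂ x₄ h₄)
    (hyes 1 4 (by omega) (by omega) (by omega) x₁ h₁ x₄ h₄) 0 2
  obtain ⟨rfl, rfl⟩ | ⟨rfl, rfl⟩ | ⟨rfl, rfl⟩ | ⟨rfl, rfl⟩ : i = 0 ∧ j = 3 ∨ i = 1 ∧ j = 3 ∨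
      i = 1 ∧ j = 4 ∨ i = 2 ∧ j = 4 := by omega
  · exact hno 1 (by omega) (by omega) x₁ h₁ x₂ h₂ h2
  · exact hno 2 (by omega) (by omega) x₂ h₂ x₃ h₃ h2.symm
  · exact hno 3 (by omega) (by omega) x₃ h₃ x₄ h₄ h2
  · exact h45 h2.symm

/-- The complement of a hole of length five is a hole of length five. -/
theorem Closed.of_compl_five {f : ℕ → κ} (hf : Closed Kᶜ 4 f) :
    ∃ g, Closed K 4 g ∧ {z | ∃ i ≤ 4, g i = z} = {z | ∃ i ≤ 4, f i = z} := by
  -- taking every second vertex makes the diagonals of the pentagon its sides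
  refine ⟨fun i => f (2 * i % 5), ⟨?_, ?_⟩, ?_⟩
  · intro i j hij hj h
    have := hf.inj (by omega) (by omega) h
    omega
  · intro i j hij hj
    have hne : f (2 * i % 5) ≠ f (2 * j % 5) := fun h => by
      have := hf.inj (by omega) (by omega) h
      omega
    have h := hf.adj_iff (by omega) (show 2 * i % 5 ≤ 4 by omega) (show 2 * j % 5 ≤ 4 by omega)
    rw [compl_adj, and_iff_right hne] at h
    rw [← not_iff_not, h]
    interval_cases j <;> interval_cases i <;> decide
  · ext z
    constructor
    · rintro ⟨i, hi, rfl⟩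
      exact ⟨2 * i % 5, by omega, rfl⟩
    · rintro ⟨i, hi, rfl⟩
      exact ⟨3 * i % 5, by omega, by simp only []; congr 1; omega⟩

/-! ### Holes, antiholes and prisms of the co-contracted graph -/

theorem IsHole.exists_closed {n : ℕ} {v : Fin n → κ} (h : IsHole K v) :
    ∃ f, Closed K (n - 1) f := by
  obtain ⟨hn, ⟨-, hinj, hadj⟩, hch⟩ := h
  refine ⟨fun i => v ⟨i % n, Nat.mod_lt _ (by omega)⟩, ⟨?_, ?_⟩⟩
  · intro i j hij hj h
    have := congrArg Fin.val (hinj h)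
    simp only [] at this
    rw [Nat.mod_eq_of_lt (by omega), Nat.mod_eq_of_lt (by omega)] at this
    omega
  · intro i j hij hj
    have hmi : i % n = i := Nat.mod_eq_of_lt (by omega)
    have hmj : j % n = j := Nat.mod_eq_of_lt (by omega)
    have hcyc : ∀ a b, K.Adj (v a) (v b) ↔ (cycleGraph n).Adj a b := by
      refine fun a b => ⟨fun h => ?_, hadj a b⟩
      by_contra hc
      have : s(v a, v b) ∈ chords K v := ⟨a, b, hc, h, rfl⟩
      rw [hch] at this
      exact this
    rw [hcyc, cycleGraph_adj_iff (by omega)]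
    simp only [hmi, hmj]
    omega

theorem IsPrism.exists_prismSeq {r s t : ℕ} {u : pathGraph (r + 1) ↪g K}
    {v : pathGraph (s + 1) ↪g K} {w : pathGraph (t + 1) ↪g K} (h : IsPrism K u v w) :
    ∃ u' v' w', PrismSeq K r s t u' v' w' := by
  have hpath : ∀ {m : ℕ} (x : pathGraph (m + 1) ↪g K),
      Chordless K m (fun i => x (Fin.ofNat _ i)) := by
    intro m x
    constructor
    · intro i j hij hj h
      have := congrArg Fin.val (x.injective h)
      simp only [Fin.val_ofNat] at this
      rw [Nat.mod_eq_of_lt (by omega), Nat.mod_eq_of_lt (by omega)] at this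
      omega
    · intro i j hij hj
      rw [x.map_adj_iff, pathGraph_adj]
      simp only [Fin.val_ofNat]
      rw [Nat.mod_eq_of_lt (by omega), Nat.mod_eq_of_lt (by omega)]
      omega
  have h0 : ∀ {m i : ℕ}, i ≤ m → (Fin.ofNat (m + 1) i = 0 ↔ i = 0) := by
    intro m i hi
    rw [Fin.ext_iff, Fin.val_ofNat, Nat.mod_eq_of_lt (by omega)]
    rfl
  have hl : ∀ {m i : ℕ}, i ≤ m → (Fin.ofNat (m + 1) i = Fin.last m ↔ i = m) := by
    intro m i hi
    rw [Fin.ext_iff, Fin.val_ofNat, Nat.mod_eq_of_lt (by omega)]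
    rfl
  exact ⟨_, _, _, h.one_le_r, h.one_le_s, h.one_le_t, hpath u, hpath v, hpath w,
    fun _ _ _ _ => h.disjoint_uv _ _, fun _ _ _ _ => h.disjoint_uw _ _,
    fun _ _ _ _ => h.disjoint_vw _ _,
    fun i hi j hj => by rw [h.adj_uv, h0 hi, h0 hj, hl hi, hl hj],
    fun i hi j hj => by rw [h.adj_uw, h0 hi, h0 hj, hl hi, hl hj],
    fun i hi j hj => by rw [h.adj_vw, h0 hi, h0 hj, hl hi, hl hj]⟩

end

end CoContraction

theorem theorem2 {V : Type*} (G : SimpleGraph V) (hG : CoContraction.IsMeyniel G)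
    (Q : Set (Set V)) (hQ : CoContraction.IsPreCoColoring G Q) :
    CoContraction.IsArtemis (CoContraction.coContraction G Q) := by
  have hfin : ∀ {κ : Type _} (k : ℕ) (f : ℕ → κ), {z | ∃ i ≤ k, f i = z}.Finite := fun k f =>
    (Set.finite_Iic k).image f
  refine ⟨fun n v hn hv => ?_, fun n v hn hv => ?_, fun r s t u v w h => ?_⟩
  · obtain ⟨f, hf⟩ := hv.exists_closed
    obtain ⟨E, X⟩ := CoContraction.exists_expansion hQ (hfin (n - 1) f)
    have h4 := hv.1
    obtain ⟨m, rfl⟩ := hn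
    exact CoContraction.not_closed_of_expansion hG hf (by omega) ⟨m, by omega⟩ X
  · obtain ⟨f, hf⟩ := CoContraction.IsHole.exists_closed hv
    obtain ⟨E, X⟩ := CoContraction.exists_expansion hQ (hfin (n - 1) f)
    rcases hn.eq_or_lt with rfl | hn
    · obtain ⟨g, hg, hgf⟩ := CoContraction.Closed.of_compl_five hf
      exact CoContraction.not_closed_of_expansion hG hg le_rfl (by decide) (hgf ▸ X)
    · exact CoContraction.not_closed_compl_of_expansion hG hf (by omega) X
  · obtain ⟨u, v, w, P⟩ := h.exists_prismSeq
    obtain ⟨E, X⟩ := CoContraction.exists_expansion hQ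
      (I := CoContraction.PrismSeq.verts r s t u v w)
      ((hfin r u).union ((hfin s v).union (hfin t w)))
    exact P.false_of_expansion hG X
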